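/- Let $X$ and $Y$ be strings. A maximal common subsequence (MCS) of $X$ and $Y$ is a common subsequence $Z$ of $X$ and $Y$ such that inserting any character into $Z$ at any position never yields a common subsequence of $X$ and $Y$. An $(f_p,f_s,f_d)$-algorithm for MCS enumeration is an algorithm on the unit-cost RAM that, for every positive integer $n$ and all strings $X,Y$ of length $O(n)$, performs a preprocessing in $O(f_p(n))$ time, uses $O(f_s(n))$ space in total, and after the preprocessing outputs every MCS of $X$ and $Y$ exactly once (and nothing else) with delay $O(f_d(n))$: this bounds the time from the end of the preprocessing to the first output, between consecutive outputs, and from the last output to the halt. Algorithm Enum221 first brings the strings into the form $X[1]=Y[1]=1$, $X[|X|]=Y[|Y|]=\sigma$ with all other characters in $\{2,\dots,\sigma-1\}$ and $\sigma\le |X|+|Y|-2$, by renaming the characters and adding the two end characters (which are removed, and the renaming undone, at output). For a string $W$, a character $c$ and a position $h$, let $\mathrm{next}_W(c,h)$ be the least position $h'>h$ with $W[h']=c$ (or $|W|+1$ if there is none), and $\mathrm{prev}_W(c,h)$ the greatest position $h'<h$ with $W[h']=c$ (or $0$). A suff-match is a pair $(i,j)$ for which there is a nonempty string $Z$ such that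 $X[i]\cdots X[|X|]$ and $Y[j]\cdots Y[|Y|]$ are the shortest suffixes of $X$ and $Y$ that contain $Z$ as a subsequence. For $1\le i\le |X|$ and $1\le j\le |Y|$, let $\mathrm{Suff}_i[j]$ be the least $i'$ with $i\le i'\le |X|$ such that $(i',j)$ is a suff-match, or $|X|+1$ if there is none. For a sequence $S$ of integers, $\mathrm{RMQ}_S(k':k'')$ is the greatest index $k\in[k',k'']$ such that all of $S[k'],\dots,S[k-1]$ are greater than $S[k]$. The data structure $D221$ consists of the sequences $\mathrm{Suff}_i$ together with structures that answer the queries $\mathrm{RMQ}_{\mathrm{Suff}_i}$ in $O(1)$ time, for all $i$ with $1\le i\le |X|$. The preprocessing of Enum221 builds tables of $\mathrm{next}$ and $\mathrm{prev}$, and $D221$ by computing $\mathrm{Suff}_i$ from $\mathrm{Suff}_{i+1}$ for descending $i$ (for each $j$ with $\mathrm{Suff}_{i+1}[j]\ne|X|+1$, $\mathrm{prev}_Y(X[i],j)\ge1$ and $\mathrm{prev}_X(X[i],\mathrm{Suff}_{i+1}[j])=i$, set $\mathrm{Suff}_i[\mathrm{prev}_Y(X[i],j)]=i$; all other elements are copied).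 The enumeration is a walk in lexicographical order through the trie of the prefixes $Z'$ of MCSs. It maintains, for each prefix of the current $Z'$, the pair $\mathrm{pref}(Z')$ of the ends of the shortest prefixes of $X$ and $Y$ that contain $Z'$, a pair $\mathrm{safe}(Z')$ and the list of the characters still to be tried. Initially $Z'=1$ and $\mathrm{safe}(1)=(|X|+1,|Y|+1)$. When a character $c$ is appended to $Z'$, with $\mathrm{pref}(Z')=(p,q)$, $\mathrm{safe}(Z')=(s,t)$ and $\mathrm{pref}(Z'c)=(p',q')$, the first component of $\mathrm{safe}(Z'c)$ is the minimum of $|X|+1$, of $\mathrm{next}_X(c,\mathrm{next}_X(Y[j],p))$ over all $j$ with $q<j<q'$ and $\mathrm{next}_X(Y[j],p)\le|X|$, and of $\mathrm{next}_X(c,s)$ if $s\le|X|$; the second component is obtained by exchanging the roles of $X$ and $Y$. The characters tried after $Z'$ are the $Y[j]$ for the positions $j$ found by successive queries $\mathrm{RMQ}_{\mathrm{Suff}_{p+1}}(q+1:h)$, starting with $h=\min(t,|Y|)$ and continuing with $h=j-1$ after each $j$ that is found, as long as $h>q$ and $\mathrm{Suff}_{p+1}[j]\le\min(s,|X|)$.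 When $Z'$ ends in $\sigma$ it is output, and the walk backtracks to the longest prefix with a character still to be tried. Theorem. Algorithm Enum221 is an $(n^2,n^2,n)$-algorithm for MCS enumeration. Moreover its preprocessing builds the data structure $D221$ (for the strings in the above form) in $O(n^2)$ time and $O(n^2)$ space. -/

import Mathlib

/-! ## Maximal common subsequences -/

/-- `Z` is a common subsequence of `X` and `Y`. -/
def IsCommonSubseq {α : Type*} (X Y Z : List α) : Prop :=
  Z.Sublist X ∧ Z.Sublist Y

/-- `Z` is a maximal common subsequence (MCS) of `X` and `Y`: a common subsequence such that
inserting any character at any position never yields a common subsequence. -/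
def IsMCS {α : Type*} (X Y Z : List α) : Prop :=
  IsCommonSubseq X Y Z ∧
    ∀ (U V : List α) (c : α), Z = U ++ V → ¬ IsCommonSubseq X Y (U ++ c :: V)

/-! ## The unit-cost random access machine

Programs are structured programs that use finitely many registers and finitely many named
arrays. The machine has `M` memory cells for each array, and every word holds a natural number
that is at most `W`; an access to a cell outside the memory, a number that exceeds `W` and a
division by zero have no outcome (the machine is stuck). Every operation costs one unit of
time. -/

namespace RAM

/-- Expressions over registers `R` and arrays `A`; `sub` is truncated subtraction. -/
inductive Expr (R A : Type) where
  | const (k : ℕ)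
  | reg (r : R)
  | get (a : A) (e : Expr R A)
  | add (e f : Expr R A)
  | sub (e f : Expr R A)
  | mul (e f : Expr R A)
  | div (e f : Expr R A)
  | mod (e f : Expr R A)

instance {R A : Type} (k : ℕ) : OfNat (Expr R A) k := ⟨.const k⟩
instance {R A : Type} : Add (Expr R A) := ⟨.add⟩
instance {R A : Type} : Sub (Expr R A) := ⟨.sub⟩
instance {R A : Type} : Mul (Expr R A) := ⟨.mul⟩
instance {R A : Type} : Div (Expr R A) := ⟨.div⟩
instance {R A : Type} : Mod (Expr R A) := ⟨.mod⟩

/-- Conditions. -/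
inductive Cond (R A : Type) where
  | eq (e f : Expr R A)
  | ne (e f : Expr R A)
  | lt (e f : Expr R A)
  | le (e f : Expr R A)
  | and (b b' : Cond R A)

/-- Programs. `emit e` writes a character to the output, `endOutput` completes the output
string that has been written since the last completed one. -/
inductive Cmd (R A : Type) where
  | skip
  | assign (r : R) (e : Expr R A)
  | store (a : A) (i e : Expr R A)
  | seq (p q : Cmd R A)
  | ite (b : Cond R A) (p q : Cmd R A)
  | while (b : Cond R A) (p : Cmd R A)
  | emit (e : Expr R A)
  | endOutput

/-- A state: contents of the registers and of the arrays, the output string being written,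
the completed output strings (in the order of completion, each with its completion time), and
the time that has elapsed. -/
structure State (R A : Type) where
  reg : R → ℕ
  arr : A → ℕ → ℕ
  buf : List ℕ
  out : List (List ℕ × ℕ)
  time : ℕ

variable {R A : Type}

/-- The value of an expression. -/
def Expr.val (s : State R A) : Expr R A → ℕ
  | .const k => k
  | .reg r => s.reg r
  | .get a e => s.arr a (e.val s)
  | .add e f => e.val s + f.val s
  | .sub e f => e.val s - f.val s
  | .mul e f => e.val s * f.val s
  | .div e f => e.val s / f.val s
  | .mod e f => e.val s % f.val s

/-- The evaluation of an expression accesses only existing memory cells, computes only numbers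
that fit into a word, and does not divide by zero. -/
def Expr.Ok (M W : ℕ) (s : State R A) : Expr R A → Prop
  | .const k => k ≤ W
  | .reg r => s.reg r ≤ W
  | .get a e => e.Ok M W s ∧ e.val s < M ∧ s.arr a (e.val s) ≤ W
  | .add e f => e.Ok M W s ∧ f.Ok M W s ∧ e.val s + f.val s ≤ W
  | .sub e f => e.Ok M W s ∧ f.Ok M W s
  | .mul e f => e.Ok M W s ∧ f.Ok M W s ∧ e.val s * f.val s ≤ W
  | .div e f => e.Ok M W s ∧ f.Ok M W s ∧ f.val s ≠ 0
  | .mod e f => e.Ok M W s ∧ f.Ok M W s ∧ f.val s ≠ 0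

/-- The time for the evaluation of an expression: the number of its nodes. -/
def Expr.cost : Expr R A → ℕ
  | .const _ => 1
  | .reg _ => 1
  | .get _ e => e.cost + 1
  | .add e f => e.cost + f.cost + 1
  | .sub e f => e.cost + f.cost + 1
  | .mul e f => e.cost + f.cost + 1
  | .div e f => e.cost + f.cost + 1
  | .mod e f => e.cost + f.cost + 1

/-- The truth of a condition. -/
def Cond.Holds (s : State R A) : Cond R A → Prop
  | .eq e f => e.val s = f.val s
  | .ne e f => e.val s ≠ f.val s
  | .lt e f => e.val s < f.val s
  | .le e f => e.val s ≤ f.val s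
  | .and b b' => b.Holds s ∧ b'.Holds s

/-- All expressions in a condition can be evaluated. -/
def Cond.Ok (M W : ℕ) (s : State R A) : Cond R A → Prop
  | .eq e f => e.Ok M W s ∧ f.Ok M W s
  | .ne e f => e.Ok M W s ∧ f.Ok M W s
  | .lt e f => e.Ok M W s ∧ f.Ok M W s
  | .le e f => e.Ok M W s ∧ f.Ok M W s
  | .and b b' => b.Ok M W s ∧ b'.Ok M W s

/-- The time for testing a condition. -/
def Cond.cost : Cond R A → ℕ
  | .eq e f => e.cost + f.cost + 1
  | .ne e f => e.cost + f.cost + 1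
  | .lt e f => e.cost + f.cost + 1
  | .le e f => e.cost + f.cost + 1
  | .and b b' => b.cost + b'.cost + 1

/-- `t` units of time pass. -/
def State.tick (s : State R A) (t : ℕ) : State R A := { s with time := s.time + t }

/-- Change of a register. -/
def State.setReg [DecidableEq R] (s : State R A) (r : R) (x : ℕ) : State R A :=
  { s with reg := Function.update s.reg r x }

/-- Change of an array element. -/
def State.setArr [DecidableEq A] (s : State R A) (a : A) (i x : ℕ) : State R A :=
  { s with arr := Function.update s.arr a (Function.update (s.arr a) i x) }

/-- Appending a character to the output string being written. -/
def State.write (s : State R A) (x : ℕ) : State R A := { s with buf := s.buf ++ [x] }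

/-- Completion of the output string being written. -/
def State.complete (s : State R A) : State R A :=
  { s with buf := [], out := s.out ++ [(s.buf, s.time)] }

/-- `Exec M W p s s'`: on the machine with `M` memory cells per array and words that hold the
numbers up to `W`, the program `p` started in state `s` halts in state `s'`. -/
inductive Exec [DecidableEq R] [DecidableEq A] (M W : ℕ) :
    Cmd R A → State R A → State R A → Prop
  | skip (s : State R A) : Exec M W .skip s (s.tick 1)
  | assign (s : State R A) (r : R) (e : Expr R A) (he : e.Ok M W s) :
      Exec M W (.assign r e) s ((s.tick (e.cost + 1)).setReg r (e.val s))
  | store (s : State R A) (a : A) (i e : Expr R A) (hi : i.Ok M W s) (he : e.Ok M W s)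
      (hM : i.val s < M) :
      Exec M W (.store a i e) s
        ((s.tick (i.cost + e.cost + 1)).setArr a (i.val s) (e.val s))
  | seq (s s' s'' : State R A) (p q : Cmd R A) (hp : Exec M W p s s')
      (hq : Exec M W q s' s'') : Exec M W (.seq p q) s s''
  | iteTrue (s s' : State R A) (b : Cond R A) (p q : Cmd R A) (hb : b.Ok M W s)
      (h : b.Holds s) (hp : Exec M W p (s.tick (b.cost + 1)) s') :
      Exec M W (.ite b p q) s s'
  | iteFalse (s s' : State R A) (b : Cond R A) (p q : Cmd R A) (hb : b.Ok M W s)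
      (h : ¬ b.Holds s) (hq : Exec M W q (s.tick (b.cost + 1)) s') :
      Exec M W (.ite b p q) s s'
  | whileTrue (s s' s'' : State R A) (b : Cond R A) (p : Cmd R A) (hb : b.Ok M W s)
      (h : b.Holds s) (hp : Exec M W p (s.tick (b.cost + 1)) s')
      (hw : Exec M W (.while b p) s' s'') : Exec M W (.while b p) s s''
  | whileFalse (s : State R A) (b : Cond R A) (p : Cmd R A) (hb : b.Ok M W s)
      (h : ¬ b.Holds s) : Exec M W (.while b p) s (s.tick (b.cost + 1))
  | emit (s : State R A) (e : Expr R A) (he : e.Ok M W s) :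
      Exec M W (.emit e) s ((s.tick (e.cost + 1)).write (e.val s))
  | endOutput (s : State R A) : Exec M W .endOutput s ((s.tick 1).complete)

/-- `for r from lo to hi (ascending) do p`. -/
def Cmd.forUp (r : R) (lo hi : Expr R A) (p : Cmd R A) : Cmd R A :=
  .seq (.assign r lo) (.while (.le (.reg r) hi) (.seq p (.assign r (.reg r + 1))))

/-- `for r from hi down to 1 do p`. -/
def Cmd.forDown (r : R) (hi : Expr R A) (p : Cmd R A) : Cmd R A :=
  .seq (.assign r hi) (.while (.le 1 (.reg r)) (.seq p (.assign r (.reg r - 1))))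

end RAM

open RAM

infixr:35 " ;; " => RAM.Cmd.seq

/-! ## Algorithms for the MCS enumeration problem -/

/-- An algorithm with a preprocessing phase and an enumeration phase; two registers and two arrays
(at the positions `0, 1, …`) receive the lengths and the characters of the input strings. -/
structure EnumAlgorithm (R A : Type) where
  lenX : R
  lenY : R
  inX : A
  inY : A
  preprocessing : Cmd R A
  enumeration : Cmd R A

/-- The initial state for the input strings `X` and `Y`. -/
def EnumAlgorithm.init {R A : Type} [DecidableEq R] [DecidableEq A] (P : EnumAlgorithm R A)
    (X Y : List ℕ) : State R A where
  reg := Function.update (Function.update (fun _ => 0) P.lenX X.length) P.lenY Y.length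
  arr := Function.update (Function.update (fun _ _ => 0) P.inX (fun k => X.getD k 0))
    P.inY (fun k => Y.getD k 0)
  buf := []
  out := []
  time := 0

/-- `P` is an `(fp, fs, fd)`-algorithm for the MCS enumeration problem. For all input strings `X`
and `Y` of length `O(n)` (at most `a * n`), on a machine with `O(fs n)` memory cells whose words
can hold the addresses of these cells and the characters of `X` and `Y`, the preprocessing takes
`O(fp n)` time, and after it the enumeration outputs every MCS of `X` and `Y` exactly once and
nothing else, with delay `O(fd n)`: this bounds the time from the end of the preprocessing
to the first output, between consecutive outputs, and from the last output to the halt. -/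
def EnumAlgorithm.SolvesMCSEnumeration {R A : Type} [DecidableEq R] [DecidableEq A]
    (P : EnumAlgorithm R A) (fp fs fd : ℕ → ℕ) : Prop :=
  ∀ a : ℕ, ∃ C : ℕ, ∀ n : ℕ, 0 < n → ∀ X Y : List ℕ, X.length ≤ a * n → Y.length ≤ a * n →
    ∀ W : ℕ, C * fs n ≤ W → (∀ c ∈ X ++ Y, c ≤ W) →
    ∃ s₁ s₂ : State R A,
      Exec (C * fs n) W P.preprocessing (P.init X Y) s₁ ∧
      s₁.time ≤ C * fp n ∧ s₁.buf = [] ∧ s₁.out = [] ∧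
      Exec (C * fs n) W P.enumeration s₁ s₂ ∧ s₂.buf = [] ∧
      (s₂.out.map Prod.fst).Nodup ∧
      (∀ Z : List ℕ, Z ∈ s₂.out.map Prod.fst ↔ IsMCS X Y Z) ∧
      List.IsChain (fun t t' => t' ≤ t + C * fd n)
        (s₁.time :: (s₂.out.map Prod.snd ++ [s₂.time]))

/-! ## Algorithm Enum221

The input strings are first brought into the form `X[1] = Y[1] = 1`, `X[|X|] = Y[|Y|] = σ`, with
all other characters in `{2, …, σ - 1}`, where `σ = |X| + |Y| - 2`; the strings in this form are
referred to as `X` and `Y` in the comments below. All sequences are 1-based. A two-dimensional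
table with row width `w` has its element in row `i` and column `j` at position `i * w + j`. -/

namespace Enum221

/-- The registers. -/
inductive Reg where
  /-- lengths of the input strings -/
  | lenX0 | lenY0
  /-- `|X|`, `|Y|`, `σ`, and the row widths `|X| + 1`, `|Y| + 1` -/
  | m | l | σ | wX | wY
  /-- block length, number of blocks, number of sparse table levels of the RMQ structures -/
  | b | nb | lev
  /-- loop indices and temporary values -/
  | i | j | c | h | p | q | t | u
  /-- construction of RMQ structures: mask, stack height -/
  | cur | sp
  /-- range minimum query: row and range, result, auxiliary values -/
  | qi | ql | qr | res | cand | bl | br | qt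
  /-- `|Z'|`, end of the last alternative sequence, bounds for the witnesses -/
  | len | top | lim | hi
  /-- components of `pref` and `safe` of the old and of the new prefix -/
  | pI | pJ | nI | nJ | sI | sJ
  deriving DecidableEq

/-- The arrays. -/
inductive Arr where
  /-- input strings -/
  | inX | inY
  /-- `X` and `Y` -/
  | X | Y
  /-- tables of `next_X(c, h)`, `next_Y(c, h)`, `prev_X(c, h)`, `prev_Y(c, h)`; row `c`, column `h` -/
  | nextX | nextY | prevX | prevY
  /-- `Suff_i[j]` in row `i`, column `j` -/
  | suff
  /-- RMQ structures: powers of two, binary logarithms, lowest set bits, then for each `i` the bit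
  masks and the sparse table; a stack for their construction -/
  | pow | lg | lsb | mask | sparse | stack
  /-- `Z'`, `pref`, `safe` of its prefixes, the end of `alt` of its prefixes within `alt` -/
  | Z | prefI | prefJ | safeI | safeJ | altEnd | alt
  /-- marks of characters -/
  | mark
  deriving DecidableEq

/-- The register `r` as an expression. -/
def v (r : Reg) : Expr Reg Arr := .reg r

/-! ### Preprocessing -/

/-- Storing `|X|`, `|Y|`, `σ` and the row widths. -/
def initLengths : Cmd Reg Arr :=
  .assign .m (v .lenX0 + 2) ;;
  .assign .l (v .lenY0 + 2) ;;
  .assign .σ (v .lenX0 + v .lenY0 + 2) ;;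
  .assign .wX (v .m + 1) ;;
  .assign .wY (v .l + 1)

/-- `u` becomes the code of the character `c`: `q + 2`, where `q` is the first position of `c` in
the concatenation of the input strings. -/
def encodeChar : Cmd Reg Arr :=
  .assign .u 0 ;;
  .forDown .q (v .lenY0)
    (.ite (.eq (.get .inY (v .q - 1)) (v .c)) (.assign .u (v .lenX0 + v .q + 1)) .skip) ;;
  .forDown .q (v .lenX0)
    (.ite (.eq (.get .inX (v .q - 1)) (v .c)) (.assign .u (v .q + 1)) .skip)

/-- Construction of `X` and `Y`. -/
def buildStrings : Cmd Reg Arr :=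
  .store .X 1 1 ;;
  .forUp .p 1 (v .lenX0)
    (.assign .c (.get .inX (v .p - 1)) ;; encodeChar ;; .store .X (v .p + 1) (v .u)) ;;
  .store .X (v .m) (v .σ) ;;
  .store .Y 1 1 ;;
  .forUp .p 1 (v .lenY0)
    (.assign .c (.get .inY (v .p - 1)) ;; encodeChar ;; .store .Y (v .p + 1) (v .u)) ;;
  .store .Y (v .l) (v .σ)

/-- Construction of the tables for a string `S` of length `lenS`, row width `w`. -/
def buildTable (S next prev : Arr) (lenS w : Reg) : Cmd Reg Arr :=
  .forUp .c 1 (v .σ)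
    (.assign .t (v lenS + 1) ;;
     .forDown .h (v lenS)
      (.store next (v .c * v w + v .h) (v .t) ;;
       .ite (.eq (.get S (v .h)) (v .c)) (.assign .t (v .h)) .skip) ;;
     .assign .t 0 ;;
     .forUp .h 1 (v lenS)
      (.store prev (v .c * v w + v .h) (v .t) ;;
       .ite (.eq (.get S (v .h)) (v .c)) (.assign .t (v .h)) .skip))

/-- Construction of `Suff_{|X|}`. -/
def initSuff : Cmd Reg Arr :=
  .forUp .j 1 (v .l) (.store .suff (v .m * v .wY + v .j) (v .m + 1)) ;;
  .store .suff (v .m * v .wY + v .l) (v .m)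

/-- Procedure UpdateSuff: construction of `Suff_i` from `Suff_{i+1}`. -/
def updateSuff : Cmd Reg Arr :=
  .forUp .j 1 (v .l)
    (.store .suff (v .i * v .wY + v .j) (.get .suff ((v .i + 1) * v .wY + v .j))) ;;
  .assign .c (.get .X (v .i)) ;;
  .forUp .j 1 (v .l)
    (.assign .t (.get .suff ((v .i + 1) * v .wY + v .j)) ;;
     .assign .u (.get .prevY (v .c * v .wY + v .j)) ;;
     .ite (.and (.ne (v .t) (v .m + 1)) (.le 1 (v .u)))
      (.ite (.eq (.get .prevX (v .c * v .wX + v .t)) (v .i))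
        (.store .suff (v .i * v .wY + v .u) (v .i)) .skip)
      .skip)

/-- Tables shared by all RMQ structures: binary logarithms and lowest set bits of `1, …, |Y|`,
the block length `b = ⌊log₂ |Y|⌋`, and the powers `2^0, …, 2^b`. -/
def buildLookup : Cmd Reg Arr :=
  .store .lg 1 0 ;;
  .store .lsb 1 0 ;;
  .forUp .p 2 (v .l)
    (.store .lg (v .p) (.get .lg (v .p / 2) + 1) ;;
     .ite (.eq (v .p % 2) 0) (.store .lsb (v .p) (.get .lsb (v .p / 2) + 1))
      (.store .lsb (v .p) 0)) ;;
  .assign .b (.get .lg (v .l)) ;;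
  .assign .nb ((v .l - 1) / v .b + 1) ;;
  .assign .lev (v .b + 1) ;;
  .store .pow 0 1 ;;
  .forUp .p 1 (v .b) (.store .pow (v .p) (2 * .get .pow (v .p - 1)))

/-- `Suff_i[e]` -/
def suffI (e : Expr Reg Arr) : Expr Reg Arr := .get .suff (v .i * v .wY + e)

/-- The position of the element of level `t` for the blocks `p, …, p + 2^t - 1` in the sparse
table of `Suff_i`. -/
def sparseAt (i t p : Expr Reg Arr) : Expr Reg Arr := (i * v .lev + t) * v .nb + p

/-- Construction of the RMQ structure for `Suff_i` in linear time. The sequence is cut into blocks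
of length `b`. The mask at `j` is the set of the positions `j' ≤ j` in the block of `j` with
`Suff_i[j'] ≤ Suff_i[q]` for all `q` with `j' < q ≤ j`, and the sparse table has the positions of
the minima over runs of `2^t` blocks. -/
def buildRMQ : Cmd Reg Arr :=
  .forUp .j 1 (v .l)
    (.assign .q ((v .j - 1) % v .b) ;;
     .ite (.eq (v .q) 0)
      (.assign .cur 0 ;; .assign .sp 0 ;; .assign .u (v .j))
      (.ite (.lt (suffI (v .j)) (suffI (v .u))) (.assign .u (v .j)) .skip) ;;
     .while (.and (.lt 0 (v .sp)) (.lt (suffI (v .j)) (suffI (.get .stack (v .sp - 1)))))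
      (.assign .sp (v .sp - 1) ;;
       .assign .cur (v .cur - .get .pow ((.get .stack (v .sp) - 1) % v .b))) ;;
     .store .stack (v .sp) (v .j) ;;
     .assign .sp (v .sp + 1) ;;
     .assign .cur (v .cur + .get .pow (v .q)) ;;
     .store .mask (v .i * v .wY + v .j) (v .cur) ;;
     .store .sparse (sparseAt (v .i) 0 ((v .j - 1) / v .b)) (v .u)) ;;
  .forUp .t 1 (.get .lg (v .nb))
    (.forUp .p 0 (v .nb - .get .pow (v .t))
      (.assign .q (.get .sparse (sparseAt (v .i) (v .t - 1) (v .p))) ;;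
       .assign .u (.get .sparse (sparseAt (v .i) (v .t - 1) (v .p + .get .pow (v .t - 1)))) ;;
       .ite (.lt (suffI (v .u)) (suffI (v .q)))
        (.store .sparse (sparseAt (v .i) (v .t) (v .p)) (v .u))
        (.store .sparse (sparseAt (v .i) (v .t) (v .p)) (v .q))))

/-- The preprocessing: construction of the tables for next/prev-queries and of `D221`, i.e. of
`Suff_i` and its RMQ structure for `i = |X|, …, 1`. -/
def preprocessing : Cmd Reg Arr :=
  initLengths ;; buildStrings ;;
  buildTable .X .nextX .prevX .m .wX ;;
  buildTable .Y .nextY .prevY .l .wY ;;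
  buildLookup ;;
  initSuff ;;
  .assign .i (v .m) ;; buildRMQ ;;
  .forDown .i (v .m - 1) (updateSuff ;; buildRMQ)

/-! ### Enumeration -/

/-- `dst` becomes the position of the leftmost minimum of `Suff_qi` on `lo, …, r`, where `lo` and
`r` lie in the same block. -/
def inBlock (dst : Reg) (lo r : Expr Reg Arr) : Cmd Reg Arr :=
  .assign dst
    (lo + .get .lsb (.get .mask (v .qi * v .wY + r) / .get .pow ((lo - 1) % v .b)))

/-- If the element of `Suff_qi` at `cand` is smaller than the one at `res`, then `res` becomes
`cand`. -/
def improve : Cmd Reg Arr :=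
  .ite (.lt (.get .suff (v .qi * v .wY + v .cand)) (.get .suff (v .qi * v .wY + v .res)))
    (.assign .res (v .cand)) .skip

/-- The query `res ← RMQ_{Suff_qi}(ql : qr)`. -/
def rmq : Cmd Reg Arr :=
  .assign .bl ((v .ql - 1) / v .b) ;;
  .assign .br ((v .qr - 1) / v .b) ;;
  .ite (.eq (v .bl) (v .br))
    (inBlock .res (v .ql) (v .qr))
    (inBlock .res (v .ql) ((v .bl + 1) * v .b) ;;
     .ite (.lt (v .bl + 1) (v .br))
      (.assign .qt (.get .lg (v .br - v .bl - 1)) ;;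
       .assign .cand (.get .sparse (sparseAt (v .qi) (v .qt) (v .bl + 1))) ;;
       improve ;;
       .assign .cand (.get .sparse (sparseAt (v .qi) (v .qt) (v .br - .get .pow (v .qt)))) ;;
       improve)
      .skip ;;
     inBlock .cand (v .br * v .b + 1) (v .qr) ;;
     improve)

/-- `r ← min(r, e)` -/
def setMin (r : Reg) (e : Expr Reg Arr) : Cmd Reg Arr :=
  .ite (.lt e (v r)) (.assign r e) .skip

/-- Loading `pref(Z')` and `safe(Z')`. -/
def load : Cmd Reg Arr :=
  .assign .pI (.get .prefI (v .len)) ;;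
  .assign .pJ (.get .prefJ (v .len)) ;;
  .assign .sI (.get .safeI (v .len)) ;;
  .assign .sJ (.get .safeJ (v .len))

/-- The query of `ext(Z')`: the witnesses `(Suff_i[j], j)`, where `i` and `j` range over
`i = i_{pref(Z')} + 1` and the positions found by range minimum queries, in descending order
of `j`. Their distinct characters are put into `alt`, between `altEnd[|Z'|]` and `top`. -/
def queryExt : Cmd Reg Arr :=
  .assign .top (.get .altEnd (v .len)) ;;
  .assign .qi (v .pI + 1) ;;
  .assign .ql (v .pJ + 1) ;;
  .assign .lim (v .sI) ;; setMin .lim (v .m) ;;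
  .assign .hi (v .sJ) ;; setMin .hi (v .l) ;;
  .while (.lt (v .pJ) (v .hi))
    (.assign .qr (v .hi) ;; rmq ;;
     .ite (.le (.get .suff (v .qi * v .wY + v .res)) (v .lim))
      (.assign .c (.get .Y (v .res)) ;;
       .ite (.eq (.get .mark (v .c)) 0)
        (.store .mark (v .c) 1 ;; .store .alt (v .top) (v .c) ;; .assign .top (v .top + 1))
        .skip ;;
       .assign .hi (v .res - 1))
      (.assign .hi 0)) ;;
  .assign .p (.get .altEnd (v .len)) ;;
  .while (.lt (v .p) (v .top))
    (.store .mark (.get .alt (v .p)) 0 ;; .assign .p (v .p + 1))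

/-- Removal of the least character `c` from the part of `alt` between `altEnd[|Z'|]` and `top`;
the rest becomes the sequence `alt(Z' ∘ c)`. -/
def selectLeast : Cmd Reg Arr :=
  .assign .q (.get .altEnd (v .len)) ;;
  .assign .p (v .q + 1) ;;
  .while (.lt (v .p) (v .top))
    (.ite (.lt (.get .alt (v .p)) (.get .alt (v .q))) (.assign .q (v .p)) .skip ;;
     .assign .p (v .p + 1)) ;;
  .assign .c (.get .alt (v .q)) ;;
  .assign .top (v .top - 1) ;;
  .store .alt (v .q) (.get .alt (v .top)) ;;
  .store .altEnd (v .len + 1) (v .top)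

/-- Appending `c` to `Z'`, with the computation of `pref(Z' ∘ c)` and `safe(Z' ∘ c)`. -/
def appendChar : Cmd Reg Arr :=
  .assign .nI (.get .nextX (v .c * v .wX + v .pI)) ;;
  .assign .nJ (.get .nextY (v .c * v .wY + v .pJ)) ;;
  .assign .u (v .m + 1) ;;
  .forUp .j (v .pJ + 1) (v .nJ - 1)
    (.assign .t (.get .nextX (.get .Y (v .j) * v .wX + v .pI)) ;;
     .ite (.le (v .t) (v .m)) (setMin .u (.get .nextX (v .c * v .wX + v .t))) .skip) ;;
  .ite (.le (v .sI) (v .m)) (setMin .u (.get .nextX (v .c * v .wX + v .sI))) .skip ;;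
  .store .safeI (v .len + 1) (v .u) ;;
  .assign .u (v .l + 1) ;;
  .forUp .i (v .pI + 1) (v .nI - 1)
    (.assign .t (.get .nextY (.get .X (v .i) * v .wY + v .pJ)) ;;
     .ite (.le (v .t) (v .l)) (setMin .u (.get .nextY (v .c * v .wY + v .t))) .skip) ;;
  .ite (.le (v .sJ) (v .l)) (setMin .u (.get .nextY (v .c * v .wY + v .sJ))) .skip ;;
  .store .safeJ (v .len + 1) (v .u) ;;
  .assign .len (v .len + 1) ;;
  .store .Z (v .len) (v .c) ;;
  .store .prefI (v .len) (v .nI) ;;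
  .store .prefJ (v .len) (v .nJ)

/-- Output of `Z'`: without its first and last character, and in the characters of the input. -/
def outputZ : Cmd Reg Arr :=
  .forUp .p 2 (v .len - 1)
    (.assign .q (.get .Z (v .p) - 2) ;;
     .ite (.lt (v .q) (v .lenX0)) (.emit (.get .inX (v .q)))
      (.emit (.get .inY (v .q - v .lenX0)))) ;;
  .endOutput

/-- The enumeration: a walk through the trie of all MCSs, in lexicographical order of their
codes. -/
def enumeration : Cmd Reg Arr :=
  .assign .len 1 ;;
  .store .Z 1 1 ;;
  .store .prefI 1 1 ;;
  .store .prefJ 1 1 ;;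
  .store .safeI 1 (v .m + 1) ;;
  .store .safeJ 1 (v .l + 1) ;;
  .store .altEnd 0 0 ;;
  .store .altEnd 1 0 ;;
  .while (.ne (v .len) 0)
    (.ite (.ne (.get .Z (v .len)) (v .σ))
      (load ;; queryExt ;; selectLeast ;; appendChar)
      (outputZ ;;
       .while (.and (.ne (v .len) 0)
          (.eq (.get .altEnd (v .len)) (.get .altEnd (v .len - 1))))
        (.assign .len (v .len - 1)) ;;
       .ite (.ne (v .len) 0)
        (.assign .top (.get .altEnd (v .len)) ;;
         .assign .len (v .len - 1) ;;
         load ;; selectLeast ;; appendChar)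
        .skip))

end Enum221

/-- Algorithm Enum221. -/
def Enum221 : EnumAlgorithm Enum221.Reg Enum221.Arr where
  lenX := .lenX0
  lenY := .lenY0
  inX := .inX
  inY := .inY
  preprocessing := Enum221.preprocessing
  enumeration := Enum221.enumeration

/-! ## The data structure D221 -/

/-- The code of a character of the input strings `X` and `Y`. -/
def encode (X Y : List ℕ) (c : ℕ) : ℕ := (X ++ Y).idxOf c + 2

/-- The string `S`, one of the input strings `X` and `Y`, in the form used by the algorithm:
`1`, then the codes of the characters, then `σ = |X| + |Y| + 2`. -/
def normalForm (X Y S : List ℕ) : List ℕ :=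
  1 :: (S.map (encode X Y) ++ [X.length + Y.length + 2])

/-- `S[i⟩` is the shortest suffix of `S` that contains `Z` (positions are 1-based). -/
def IsShortestSuffix (S Z : List ℕ) (i : ℕ) : Prop :=
  IsGreatest {k : ℕ | 1 ≤ k ∧ k ≤ S.length + 1 ∧ Z.Sublist (S.drop (k - 1))} i

/-- `(i, j)` is a suff-match of `X` and `Y`: `(i, j) = suff(Z)` for some nonempty `Z`. -/
def IsSuffMatch (X Y : List ℕ) (i j : ℕ) : Prop :=
  ∃ Z : List ℕ, Z ≠ [] ∧ IsShortestSuffix X Z i ∧ IsShortestSuffix Y Z j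

/-- `x = Suff_i[j]`: the least `i'` with `i ≤ i' ≤ |X|` such that `(i', j)` is a suff-match, if any,
and `|X| + 1` otherwise. -/
def IsSuff (X Y : List ℕ) (i j x : ℕ) : Prop :=
  IsLeast ({i' : ℕ | i ≤ i' ∧ i' ≤ X.length ∧ IsSuffMatch X Y i' j} ∪ {X.length + 1}) x

/-- `k = RMQ_S(k' : k'')`: the greatest `k` with `k' ≤ k ≤ k''` such that all elements in
`S[k' : k - 1]` are greater than `S[k]`. -/
def IsRMQ (S : ℕ → ℕ) (k' k'' k : ℕ) : Prop :=
  IsGreatest {q : ℕ | k' ≤ q ∧ q ≤ k'' ∧ ∀ p, k' ≤ p → p < q → S q < S p} k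

/-- In state `s` the memory has the data structure `D221` for the strings `X` and `Y`: the
sequences `Suff_i` for `1 ≤ i ≤ |X|`, and structures for them such that the query
`RMQ_{Suff_i}(k' : k'')` for `1 ≤ k' ≤ k'' ≤ |Y|` is answered in time at most `T`. -/
def HasD221 (M W T : ℕ) (X Y : List ℕ) (s : State Enum221.Reg Enum221.Arr) : Prop :=
  ∀ i : ℕ, 1 ≤ i → i ≤ X.length →
    (∀ j : ℕ, 1 ≤ j → j ≤ Y.length →
      IsSuff X Y i j (s.arr .suff (i * (Y.length + 1) + j))) ∧
    ∀ k' k'' : ℕ, 1 ≤ k' → k' ≤ k'' → k'' ≤ Y.length →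
      ∃ s' : State Enum221.Reg Enum221.Arr,
        Exec M W Enum221.rmq (((s.setReg .qi i).setReg .ql k').setReg .qr k'') s' ∧
        s'.time ≤ s.time + T ∧ s'.arr = s.arr ∧
        IsRMQ (fun j => s.arr .suff (i * (Y.length + 1) + j)) k' k'' (s'.reg .res)

/-!
The proof has a half about the combinatorics of two strings and a half about the program.

*Combinatorics.* Strings are functions on the positions `1, …, m`. A concatenation `U ++ V` is a
common subsequence iff in both strings the shortest prefix that contains `U` ends before the
shortest suffix that contains `V` begins (`MCS.Gap`), and it is maximal iff at every splitting
nothing can be inserted (`MCS.Border`). If nothing can be inserted at the splitting between `U` and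
`V`, then insertions further to the left are impossible iff the shortest suffixes that contain `V`
begin at most at the pair `safe(U)`; this characterizes `safe`, and `MCS.IsSafe.step` is its
recursion. Insertions into the part after `U` move these suffixes to the left only, hence
`U ++ c :: V` extends to a maximal common subsequence with prefix `U ++ [c]` as soon as nothing can
be inserted up to the splitting after `U` (`MCS.exists_maximal_extension`). With `pref(U) = (p, q)`,
this means that `c` continues `U` iff there is a suff-match at positions of `c` that is greater than
`(p, q)` and at most `safe(U)` in both components, and for which no character has an occurrence in
both gaps between `(p, q)` and the suff-match. Such pairs come from the strict prefix minima of
`Suff_{p+1}` on the positions after `q` (`MCS.exists_maximal_iff_wit`), and these are what the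
successive queries for leftmost minima find. The rows `Suff_i` satisfy the recursion of the
preprocessing (`MCS.sf_step`) because of the end characters.

*Delay.* At a node `U` of the trie, no witness has both components beyond `pref(U ++ [c])`, for
any `c` that continues `U`, since otherwise `c` would occur in both of its gaps. So the number of
witnesses is at most the sum of the distances by which the two components of `pref` grow when `c` is
appended (`MCS.card_wit_le`), and the computation of `safe(U ++ [c])` takes time of the same order.
Along a path of the trie these costs telescope to `O(m + l)`. As every node of the trie leads to an
output, the walk goes down a single path between two outputs, after one backtracking.

*Range minimum queries.* A row of length `l` is cut into blocks of length `⌊log₂ l⌋`. Within a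
block, the suffix minima of the part up to a position are kept as a bit mask, and the lowest set
bit of the mask, after a shift to the left end of the query, is the leftmost minimum
(`RMQ.IsMask.query`). Over whole blocks there is a sparse table, which has `O(l)` entries because
there are only `O(l / log l)` blocks.

*The program.* Executions are obtained from weakest preconditions (`RAM.wp_sound`) with rules for
the loops, where time is part of the state; by the frame rule (`RAM.Frame`) a command
changes only the registers and arrays that occur in it as targets. The invariant `Enum221.Walk` of
the enumeration says that the memory has the path to the current prefix, with the characters still
to be tried, and that the strings output so far are the maximal common subsequences that do not lie
ahead.
-/

/-! ### Weakest preconditions -/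

namespace RAM

variable {R A : Type}

/-- The part of `Expr.Ok` that remains to be checked when all registers and all memory cells
are known to hold words. -/
def Expr.Safe (M W : ℕ) (s : State R A) : Expr R A → Prop
  | .const k => k ≤ W
  | .reg _ => True
  | .get _ e => e.Safe M W s ∧ e.val s < M
  | .add e f => e.Safe M W s ∧ f.Safe M W s ∧ e.val s + f.val s ≤ W
  | .sub e f => e.Safe M W s ∧ f.Safe M W s
  | .mul e f => e.Safe M W s ∧ f.Safe M W s ∧ e.val s * f.val s ≤ W
  | .div e f => e.Safe M W s ∧ f.Safe M W s ∧ f.val s ≠ 0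
  | .mod e f => e.Safe M W s ∧ f.Safe M W s ∧ f.val s ≠ 0

/-- The counterpart of `Expr.Safe` for conditions. -/
def Cond.Safe (M W : ℕ) (s : State R A) : Cond R A → Prop
  | .eq e f => e.Safe M W s ∧ f.Safe M W s
  | .ne e f => e.Safe M W s ∧ f.Safe M W s
  | .lt e f => e.Safe M W s ∧ f.Safe M W s
  | .le e f => e.Safe M W s ∧ f.Safe M W s
  | .and b b' => b.Safe M W s ∧ b'.Safe M W s

/-- All registers and all memory cells hold words. Every step of the machine preserves this. -/
structure State.Bdd (W : ℕ) (s : State R A) : Prop where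
  reg : ∀ r, s.reg r ≤ W
  arr : ∀ a k, s.arr a k ≤ W

theorem Expr.Safe.ok {M W : ℕ} {s : State R A} (hs : s.Bdd W) :
    ∀ {e : Expr R A}, e.Safe M W s → e.Ok M W s ∧ e.val s ≤ W := by
  intro e
  induction e with
  | const k => exact fun h => ⟨h, h⟩
  | reg r => exact fun _ => ⟨hs.reg r, hs.reg r⟩
  | get a e ih => exact fun h => ⟨⟨(ih h.1).1, h.2, hs.arr _ _⟩, hs.arr _ _⟩
  | add e f ihe ihf => exact fun h => ⟨⟨(ihe h.1).1, (ihf h.2.1).1, h.2.2⟩, h.2.2⟩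
  | sub e f ihe ihf =>
    exact fun h => ⟨⟨(ihe h.1).1, (ihf h.2).1⟩, (Nat.sub_le _ _).trans (ihe h.1).2⟩
  | mul e f ihe ihf => exact fun h => ⟨⟨(ihe h.1).1, (ihf h.2.1).1, h.2.2⟩, h.2.2⟩
  | div e f ihe ihf =>
    exact fun h => ⟨⟨(ihe h.1).1, (ihf h.2.1).1, h.2.2⟩, (Nat.div_le_self _ _).trans (ihe h.1).2⟩
  | mod e f ihe ihf =>
    exact fun h => ⟨⟨(ihe h.1).1, (ihf h.2.1).1, h.2.2⟩, (Nat.mod_le _ _).trans (ihe h.1).2⟩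

theorem Cond.Safe.ok {M W : ℕ} {s : State R A} (hs : s.Bdd W) :
    ∀ {b : Cond R A}, b.Safe M W s → b.Ok M W s := by
  intro b
  induction b with
  | and b b' ih ih' => exact fun h => ⟨ih h.1, ih' h.2⟩
  | _ => exact fun h => ⟨(h.1.ok hs).1, (h.2.ok hs).1⟩

/-- The program produces no output. -/
def Cmd.silent : Cmd R A → Bool
  | .seq p q => p.silent && q.silent
  | .ite _ p q => p.silent && q.silent
  | .while _ p => p.silent
  | .emit _ => false
  | .endOutput => false
  | _ => true

section simpLemmas

variable {M W : ℕ} {s : State R A}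

variable {e f : Expr R A} {k t : ℕ} {r r' : R} {a a' : A} {b b' : Cond R A} {i x : ℕ}

@[simp] theorem val_const : (Expr.const k).val s = k := rfl
@[simp] theorem val_ofNat : Expr.val s ofNat(k) = OfNat.ofNat k := rfl
@[simp] theorem val_reg : (Expr.reg r).val s = s.reg r := rfl
@[simp] theorem val_get : (Expr.get a e).val s = s.arr a (e.val s) := rfl
@[simp] theorem val_add : (e + f).val s = e.val s + f.val s := rfl
@[simp] theorem val_sub : (e - f).val s = e.val s - f.val s := rfl
@[simp] theorem val_mul : (e * f).val s = e.val s * f.val s := rfl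
@[simp] theorem val_div : (e / f).val s = e.val s / f.val s := rfl
@[simp] theorem val_mod : (e % f).val s = e.val s % f.val s := rfl

@[simp] theorem cost_ofNat : Expr.cost (ofNat(k) : Expr R A) = 1 := rfl
@[simp] theorem cost_reg : (Expr.reg r : Expr R A).cost = 1 := rfl
@[simp] theorem cost_get : (Expr.get a e).cost = e.cost + 1 := rfl
@[simp] theorem cost_add : (e + f).cost = e.cost + f.cost + 1 := rfl
@[simp] theorem cost_sub : (e - f).cost = e.cost + f.cost + 1 := rfl
@[simp] theorem cost_mul : (e * f).cost = e.cost + f.cost + 1 := rfl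
@[simp] theorem cost_div : (e / f).cost = e.cost + f.cost + 1 := rfl
@[simp] theorem cost_mod : (e % f).cost = e.cost + f.cost + 1 := rfl
@[simp] theorem cost_eq : (Cond.eq e f).cost = e.cost + f.cost + 1 := rfl
@[simp] theorem cost_ne : (Cond.ne e f).cost = e.cost + f.cost + 1 := rfl
@[simp] theorem cost_lt : (Cond.lt e f).cost = e.cost + f.cost + 1 := rfl
@[simp] theorem cost_le : (Cond.le e f).cost = e.cost + f.cost + 1 := rfl
@[simp] theorem cost_and : (Cond.and b b').cost = b.cost + b'.cost + 1 := rfl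

@[simp] theorem safe_ofNat : Expr.Safe M W s ofNat(k) = (OfNat.ofNat k ≤ W) := rfl
@[simp] theorem safe_reg : (Expr.reg r).Safe M W s = True := rfl
@[simp] theorem safe_get :
    (Expr.get a e).Safe M W s = (e.Safe M W s ∧ e.val s < M) := rfl
@[simp] theorem safe_add :
    (e + f).Safe M W s = (e.Safe M W s ∧ f.Safe M W s ∧ e.val s + f.val s ≤ W) := rfl
@[simp] theorem safe_sub : (e - f).Safe M W s = (e.Safe M W s ∧ f.Safe M W s) := rfl
@[simp] theorem safe_mul :
    (e * f).Safe M W s = (e.Safe M W s ∧ f.Safe M W s ∧ e.val s * f.val s ≤ W) := rfl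
@[simp] theorem safe_div :
    (e / f).Safe M W s = (e.Safe M W s ∧ f.Safe M W s ∧ f.val s ≠ 0) := rfl
@[simp] theorem safe_mod :
    (e % f).Safe M W s = (e.Safe M W s ∧ f.Safe M W s ∧ f.val s ≠ 0) := rfl
@[simp] theorem safe_eq : (Cond.eq e f).Safe M W s = (e.Safe M W s ∧ f.Safe M W s) := rfl
@[simp] theorem safe_ne : (Cond.ne e f).Safe M W s = (e.Safe M W s ∧ f.Safe M W s) := rfl
@[simp] theorem safe_lt : (Cond.lt e f).Safe M W s = (e.Safe M W s ∧ f.Safe M W s) := rfl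
@[simp] theorem safe_le : (Cond.le e f).Safe M W s = (e.Safe M W s ∧ f.Safe M W s) := rfl
@[simp] theorem safe_and : (Cond.and b b').Safe M W s = (b.Safe M W s ∧ b'.Safe M W s) := rfl

@[simp] theorem holds_eq : (Cond.eq e f).Holds s = (e.val s = f.val s) := rfl
@[simp] theorem holds_ne : (Cond.ne e f).Holds s = (e.val s ≠ f.val s) := rfl
@[simp] theorem holds_lt : (Cond.lt e f).Holds s = (e.val s < f.val s) := rfl
@[simp] theorem holds_le : (Cond.le e f).Holds s = (e.val s ≤ f.val s) := rfl
@[simp] theorem holds_and : (Cond.and b b').Holds s = (b.Holds s ∧ b'.Holds s) := rfl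

@[simp] theorem tick_reg : (s.tick t).reg = s.reg := rfl
@[simp] theorem tick_arr : (s.tick t).arr = s.arr := rfl
@[simp] theorem tick_buf : (s.tick t).buf = s.buf := rfl
@[simp] theorem tick_out : (s.tick t).out = s.out := rfl
@[simp] theorem tick_time : (s.tick t).time = s.time + t := rfl
@[simp] theorem write_reg : (s.write t).reg = s.reg := rfl
@[simp] theorem write_arr : (s.write t).arr = s.arr := rfl
@[simp] theorem write_buf : (s.write t).buf = s.buf ++ [t] := rfl
@[simp] theorem write_out : (s.write t).out = s.out := rfl
@[simp] theorem write_time : (s.write t).time = s.time := rfl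
@[simp] theorem complete_reg : s.complete.reg = s.reg := rfl
@[simp] theorem complete_arr : s.complete.arr = s.arr := rfl
@[simp] theorem complete_buf : s.complete.buf = [] := rfl
@[simp] theorem complete_out : s.complete.out = s.out ++ [(s.buf, s.time)] := rfl
@[simp] theorem complete_time : s.complete.time = s.time := rfl

@[simp] theorem setReg_reg [DecidableEq R] :
    (s.setReg r x).reg r' = if r' = r then x else s.reg r' := by
  simp [State.setReg, Function.update_apply]
@[simp] theorem setReg_arr [DecidableEq R] : (s.setReg r x).arr = s.arr := rfl
@[simp] theorem setReg_buf [DecidableEq R] : (s.setReg r x).buf = s.buf := rfl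
@[simp] theorem setReg_out [DecidableEq R] : (s.setReg r x).out = s.out := rfl
@[simp] theorem setReg_time [DecidableEq R] : (s.setReg r x).time = s.time := rfl
@[simp] theorem setArr_arr [DecidableEq A] :
    (s.setArr a i x).arr a' = if a' = a then Function.update (s.arr a) i x else s.arr a' := by
  simp [State.setArr, Function.update_apply]
@[simp] theorem setArr_reg [DecidableEq A] : (s.setArr a i x).reg = s.reg := rfl
@[simp] theorem setArr_buf [DecidableEq A] : (s.setArr a i x).buf = s.buf := rfl
@[simp] theorem setArr_out [DecidableEq A] : (s.setArr a i x).out = s.out := rfl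
@[simp] theorem setArr_time [DecidableEq A] : (s.setArr a i x).time = s.time := rfl

end simpLemmas

variable [DecidableEq R] [DecidableEq A]

/-- A sufficient condition on the state `s` for the program to halt in a state that satisfies
`Q`, if all registers and memory cells hold words in state `s`. For a loop, the number of
iterations is bounded by some `n`. -/
def wp (M W : ℕ) : Cmd R A → (State R A → Prop) → State R A → Prop
  | .skip, Q => fun s => Q (s.tick 1)
  | .assign r e, Q => fun s => e.Safe M W s ∧ Q ((s.tick (e.cost + 1)).setReg r (e.val s))
  | .store a i e, Q => fun s => i.Safe M W s ∧ e.Safe M W s ∧ i.val s < M ∧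
      Q ((s.tick (i.cost + e.cost + 1)).setArr a (i.val s) (e.val s))
  | .seq p q, Q => wp M W p (wp M W q Q)
  | .ite b p q, Q => fun s => b.Safe M W s ∧ (b.Holds s → wp M W p Q (s.tick (b.cost + 1))) ∧
      (¬ b.Holds s → wp M W q Q (s.tick (b.cost + 1)))
  | .while b p, Q => fun s => ∃ n : ℕ, (fun (F : State R A → Prop) s =>
      b.Safe M W s ∧ (b.Holds s → wp M W p F (s.tick (b.cost + 1))) ∧
        (¬ b.Holds s → Q (s.tick (b.cost + 1))))^[n] (fun _ => False) s
  | .emit e, Q => fun s => e.Safe M W s ∧ Q ((s.tick (e.cost + 1)).write (e.val s))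
  | .endOutput, Q => fun s => Q ((s.tick 1).complete)

theorem wp_sound {M W : ℕ} (c : Cmd R A) : ∀ (Q : State R A → Prop) (s : State R A), s.Bdd W →
    wp M W c Q s → ∃ s', Exec M W c s s' ∧ s'.Bdd W ∧ Q s' := by
  induction c with
  | skip => exact fun Q s hs h => ⟨_, .skip s, ⟨hs.reg, hs.arr⟩, h⟩
  | assign r e =>
    refine fun Q s hs h => ⟨_, .assign s r e (h.1.ok hs).1, ⟨fun r' => ?_, hs.arr⟩, h.2⟩
    simp only [State.setReg, State.tick, Function.update_apply]
    split_ifs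
    exacts [(h.1.ok hs).2, hs.reg _]
  | store a i e =>
    refine fun Q s hs h => ⟨_, .store s a i e (h.1.ok hs).1 (h.2.1.ok hs).1 h.2.2.1,
      ⟨hs.reg, fun a' k => ?_⟩, h.2.2.2⟩
    simp only [State.setArr, State.tick, Function.update_apply]
    split_ifs
    · simp only [Function.update_apply]
      split_ifs
      exacts [(h.2.1.ok hs).2, hs.arr _ _]
    · exact hs.arr _ _
  | seq p q ihp ihq =>
    intro Q s hs h
    obtain ⟨s', hp, hs', h'⟩ := ihp _ s hs h
    obtain ⟨s'', hq, hs'', h''⟩ := ihq _ s' hs' h'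
    exact ⟨s'', .seq _ _ _ _ _ hp hq, hs'', h''⟩
  | ite b p q ihp ihq =>
    intro Q s hs h
    by_cases hb : b.Holds s
    · obtain ⟨s', hp, hs', h'⟩ := ihp Q (s.tick (b.cost + 1)) ⟨hs.reg, hs.arr⟩ (h.2.1 hb)
      exact ⟨s', .iteTrue _ _ _ _ _ (h.1.ok hs) hb hp, hs', h'⟩
    · obtain ⟨s', hp, hs', h'⟩ := ihq Q (s.tick (b.cost + 1)) ⟨hs.reg, hs.arr⟩ (h.2.2 hb)
      exact ⟨s', .iteFalse _ _ _ _ _ (h.1.ok hs) hb hp, hs', h'⟩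
  | emit e => exact fun Q s hs h => ⟨_, .emit s e (h.1.ok hs).1, ⟨hs.reg, hs.arr⟩, h.2⟩
  | endOutput => exact fun Q s hs h => ⟨_, .endOutput s, ⟨hs.reg, hs.arr⟩, h⟩
  | _ b p ih =>
    rintro Q s hs ⟨n, h⟩
    induction n generalizing s with
    | zero => exact h.elim
    | succ n ihn =>
      rw [Function.iterate_succ_apply'] at h
      by_cases hb : b.Holds s
      · obtain ⟨s', hp, hs', h'⟩ := ih _ (s.tick (b.cost + 1)) ⟨hs.reg, hs.arr⟩ (h.2.1 hb)
        obtain ⟨s'', hw, hs'', h''⟩ := ihn s' hs' h'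
        exact ⟨s'', .whileTrue _ _ _ _ _ (h.1.ok hs) hb hp hw, hs'', h''⟩
      · exact ⟨_, .whileFalse _ _ _ (h.1.ok hs) hb, ⟨hs.reg, hs.arr⟩, h.2.2 hb⟩

/-! ### Frames -/

/-- The program contains an assignment to the register `r`. -/
def Cmd.modReg (r : R) : Cmd R A → Bool
  | .assign r' _ => decide (r' = r)
  | .seq p q => p.modReg r || q.modReg r
  | .ite _ p q => p.modReg r || q.modReg r
  | .while _ p => p.modReg r
  | _ => false

/-- The program contains an assignment to an element of the array `a`. -/
def Cmd.modArr (a : A) : Cmd R A → Bool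
  | .store a' _ _ => decide (a' = a)
  | .seq p q => p.modArr a || q.modArr a
  | .ite _ p q => p.modArr a || q.modArr a
  | .while _ p => p.modArr a
  | _ => false

/-- `s` and `s'` agree on the registers and arrays that `c` does not mention as a target, and on
the output if `c` produces none. -/
structure Frame (c : Cmd R A) (s s' : State R A) : Prop where
  reg : ∀ r, c.modReg r = false → s'.reg r = s.reg r
  arr : ∀ a, c.modArr a = false → s'.arr a = s.arr a
  out : c.silent = true → s'.out = s.out ∧ s'.buf = s.buf

theorem Frame.refl (c : Cmd R A) (s : State R A) : Frame c s s :=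
  ⟨fun _ _ => rfl, fun _ _ => rfl, fun _ => ⟨rfl, rfl⟩⟩

/-- `c` mentions only targets that `c'` mentions. -/
structure Cmd.Le (c c' : Cmd R A) : Prop where
  reg : ∀ r, c'.modReg r = false → c.modReg r = false
  arr : ∀ a, c'.modArr a = false → c.modArr a = false
  out : c'.silent = true → c.silent = true

theorem wp_mono_frame {M W : ℕ} (c₀ : Cmd R A) (s₀ : State R A) (c : Cmd R A) :
    ∀ (Q Q' : State R A → Prop) (s : State R A), c.Le c₀ → Frame c₀ s₀ s →
      (∀ s', Frame c₀ s₀ s' → Q s' → Q' s') → wp M W c Q s → wp M W c Q' s := by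
  induction c with
  | skip => exact fun Q Q' s hc hF hQ h => hQ _ ⟨hF.reg, hF.arr, hF.out⟩ h
  | assign r e =>
    refine fun Q Q' s hc hF hQ h => ⟨h.1, hQ _ ⟨fun r' hr' => ?_, hF.arr, hF.out⟩ h.2⟩
    have := hc.reg r' hr'
    simp only [Cmd.modReg, decide_eq_false_iff_not] at this
    simp [State.setReg, State.tick, Function.update_of_ne (Ne.symm this), hF.reg r' hr']
  | store a i e =>
    refine fun Q Q' s hc hF hQ h =>
      ⟨h.1, h.2.1, h.2.2.1, hQ _ ⟨hF.reg, fun a' ha' => ?_, hF.out⟩ h.2.2.2⟩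
    have := hc.arr a' ha'
    simp only [Cmd.modArr, decide_eq_false_iff_not] at this
    simp [State.setArr, State.tick, Function.update_of_ne (Ne.symm this), hF.arr a' ha']
  | seq p q ihp ihq =>
    intro Q Q' s hc hF hQ h
    have hp : p.Le c₀ := ⟨fun r hr => (Bool.or_eq_false_iff.1 (hc.reg r hr)).1,
      fun r hr => (Bool.or_eq_false_iff.1 (hc.arr r hr)).1,
      fun hr => (Bool.and_eq_true_iff.1 (hc.out hr)).1⟩
    have hq : q.Le c₀ := ⟨fun r hr => (Bool.or_eq_false_iff.1 (hc.reg r hr)).2,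
      fun r hr => (Bool.or_eq_false_iff.1 (hc.arr r hr)).2,
      fun hr => (Bool.and_eq_true_iff.1 (hc.out hr)).2⟩
    exact ihp _ _ s hp hF (fun s' hF' h' => ihq _ _ s' hq hF' hQ h') h
  | ite b p q ihp ihq =>
    intro Q Q' s hc hF hQ h
    have hp : p.Le c₀ := ⟨fun r hr => (Bool.or_eq_false_iff.1 (hc.reg r hr)).1,
      fun r hr => (Bool.or_eq_false_iff.1 (hc.arr r hr)).1,
      fun hr => (Bool.and_eq_true_iff.1 (hc.out hr)).1⟩
    have hq : q.Le c₀ := ⟨fun r hr => (Bool.or_eq_false_iff.1 (hc.reg r hr)).2,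
      fun r hr => (Bool.or_eq_false_iff.1 (hc.arr r hr)).2,
      fun hr => (Bool.and_eq_true_iff.1 (hc.out hr)).2⟩
    exact ⟨h.1, fun hb => ihp _ _ _ hp ⟨hF.reg, hF.arr, hF.out⟩ hQ (h.2.1 hb),
      fun hb => ihq _ _ _ hq ⟨hF.reg, hF.arr, hF.out⟩ hQ (h.2.2 hb)⟩
  | emit e =>
    exact fun Q Q' s hc hF hQ h => ⟨h.1, hQ _ ⟨hF.reg, hF.arr, fun ho =>
      absurd (hc.out ho) (by simp [Cmd.silent])⟩ h.2⟩
  | endOutput =>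
    exact fun Q Q' s hc hF hQ h => hQ _ ⟨hF.reg, hF.arr, fun ho =>
      absurd (hc.out ho) (by simp [Cmd.silent])⟩ h
  | _ b p ih =>
    rintro Q Q' s hc hF hQ ⟨n, h⟩
    refine ⟨n, ?_⟩
    induction n generalizing s with
    | zero => exact h.elim
    | succ n ihn =>
      rw [Function.iterate_succ_apply'] at h ⊢
      exact ⟨h.1, fun hb => ih _ _ _ ⟨hc.reg, hc.arr, hc.out⟩ ⟨hF.reg, hF.arr, hF.out⟩
          (fun s' hF' h' => ihn s' hF' h') (h.2.1 hb),
        fun hb => hQ _ ⟨hF.reg, hF.arr, hF.out⟩ (h.2.2 hb)⟩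

/-- The rule of consequence; the new postcondition may use that `c` leaves alone what it does not
mention. -/
theorem wp_then {M W : ℕ} {c : Cmd R A} {Q Q' : State R A → Prop} {s : State R A}
    (h : wp M W c Q s) (hQ : ∀ s', Frame c s s' → Q s' → Q' s') : wp M W c Q' s :=
  wp_mono_frame c s c Q Q' s ⟨fun _ => id, fun _ => id, id⟩ (.refl _ _) hQ h

/-- The rule for loops, with an invariant `I` and a variant `μ`. -/
theorem wp_while {M W : ℕ} {b : Cond R A} {p : Cmd R A} {Q : State R A → Prop} {s : State R A}
    (I : State R A → Prop) (μ : State R A → ℕ) (h0 : I s)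
    (hstep : ∀ s', Frame (.while b p) s s' → I s' → b.Safe M W s' ∧
      (b.Holds s' → wp M W p (fun s'' => I s'' ∧ μ s'' < μ s') (s'.tick (b.cost + 1))) ∧
      (¬ b.Holds s' → Q (s'.tick (b.cost + 1)))) :
    wp M W (.while b p) Q s := by
  have key : ∀ n s', Frame (.while b p) s s' → I s' → μ s' < n →
      (fun (F : State R A → Prop) s => b.Safe M W s ∧
        (b.Holds s → wp M W p F (s.tick (b.cost + 1))) ∧
        (¬ b.Holds s → Q (s.tick (b.cost + 1))))^[n] (fun _ => False) s' := by
    intro n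
    induction n with
    | zero => exact fun s' _ _ h => absurd h (Nat.not_lt_zero _)
    | succ n ihn =>
      intro s' hF hI hμ
      rw [Function.iterate_succ_apply']
      obtain ⟨h1, h2, h3⟩ := hstep s' hF hI
      exact ⟨h1, fun hb => wp_mono_frame (.while b p) s p _ _ _ ⟨fun _ => id, fun _ => id, id⟩
        ⟨hF.reg, hF.arr, hF.out⟩ (fun s'' hF' h' => ihn s'' hF' h'.1 (by omega)) (h2 hb), h3⟩
  exact ⟨μ s + 1, key _ s (.refl _ _) h0 (Nat.lt_succ_self _)⟩

section simpLemmas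

variable {M W : ℕ} {Q : State R A → Prop} {s : State R A}

@[simp] theorem wp_skip : wp M W .skip Q s = Q (s.tick 1) := rfl
@[simp] theorem wp_assign {r : R} {e : Expr R A} : wp M W (.assign r e) Q s =
    (e.Safe M W s ∧ Q ((s.tick (e.cost + 1)).setReg r (e.val s))) := rfl
@[simp] theorem wp_store {a : A} {i e : Expr R A} : wp M W (.store a i e) Q s =
    (i.Safe M W s ∧ e.Safe M W s ∧ i.val s < M ∧
      Q ((s.tick (i.cost + e.cost + 1)).setArr a (i.val s) (e.val s))) := rfl
@[simp] theorem wp_seq {p q : Cmd R A} : wp M W (.seq p q) Q s = wp M W p (wp M W q Q) s := rfl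
@[simp] theorem wp_ite {b : Cond R A} {p q : Cmd R A} : wp M W (.ite b p q) Q s =
    (b.Safe M W s ∧ (b.Holds s → wp M W p Q (s.tick (b.cost + 1))) ∧
      (¬ b.Holds s → wp M W q Q (s.tick (b.cost + 1)))) := rfl
@[simp] theorem wp_emit {e : Expr R A} : wp M W (.emit e) Q s =
    (e.Safe M W s ∧ Q ((s.tick (e.cost + 1)).write (e.val s))) := rfl
@[simp] theorem wp_endOutput : wp M W .endOutput Q s = Q ((s.tick 1).complete) := rfl

end simpLemmas

/-- The rule for ascending loops from `a` to `N`; the invariant `I k` holds when the loop condition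
is tested with `k` in the loop register. -/
theorem wp_forUp {M W : ℕ} {r : R} {lo hi : Expr R A} {p : Cmd R A} {Q : State R A → Prop}
    {s : State R A} (a N : ℕ) (I : ℕ → State R A → Prop) (hlo : lo.Safe M W s)
    (hlov : lo.val s = a) (haN : a ≤ N + 1) (hW : N + 1 ≤ W)
    (h0 : I a ((s.tick (lo.cost + 1)).setReg r a))
    (hhi : ∀ s', Frame (.forUp r lo hi p) s s' → hi.Safe M W s' ∧ hi.val s' = N)
    (hstep : ∀ k s', a ≤ k → k ≤ N → Frame (.forUp r lo hi p) s s' → s'.reg r = k → I k s' →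
      wp M W p (fun s'' => s''.reg r = k ∧ I (k + 1) ((s''.tick 4).setReg r (k + 1)))
        (s'.tick (hi.cost + 3)))
    (hend : ∀ s', Frame (.forUp r lo hi p) s s' → s'.reg r = N + 1 → I (N + 1) s' →
      Q (s'.tick (hi.cost + 3))) :
    wp M W (.forUp r lo hi p) Q s := by
  have hr : (Cmd.forUp r lo hi p).modReg r = true := by simp [Cmd.forUp, Cmd.modReg]
  have htr : ∀ s', Frame (.while (.le (.reg r) hi) (.seq p (.assign r (.reg r + 1))))
      ((s.tick (lo.cost + 1)).setReg r a) s' → Frame (.forUp r lo hi p) s s' := by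
    intro s' hF
    refine ⟨fun r' h => ?_, fun a' h => ?_, fun h => ?_⟩
    · have h' : Cmd.modReg r' p = false ∧ ¬ r = r' :=
        (by simpa [Cmd.forUp, Cmd.modReg] using h : _ ∧ _ ∧ _).2
      rw [hF.reg r' (by simpa [Cmd.modReg] using h')]
      have : r' ≠ r := by rintro rfl; simp [hr] at h
      simp [this]
    · exact hF.arr a' (by simpa [Cmd.forUp, Cmd.modArr] using h)
    · exact hF.out (by simpa [Cmd.forUp, Cmd.silent] using h)
  refine ⟨hlo, ?_⟩
  rw [hlov]
  refine wp_while (fun s' => ∃ k, a ≤ k ∧ k ≤ N + 1 ∧ s'.reg r = k ∧ I k s')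
    (fun s' => N + 1 - s'.reg r) ⟨a, le_rfl, haN, by simp, h0⟩ ?_
  rintro s' hF ⟨k, hak, hkN, hk, hI⟩
  have hF' := htr s' hF
  obtain ⟨hs, hv⟩ := hhi s' hF'
  have hc : (Cond.le (.reg r) hi).cost + 1 = hi.cost + 3 := by simp; omega
  refine ⟨⟨trivial, hs⟩, fun hb => ?_, fun hb => ?_⟩
  · have hkN' : k ≤ N := by simpa [hk, hv] using hb
    rw [hc, wp_seq]
    refine wp_then (hstep k s' hak hkN' hF' hk hI) ?_
    rintro s'' - ⟨hk'', hI''⟩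
    refine ⟨⟨trivial, ?_, ?_⟩, ⟨k + 1, by omega, by omega, ?_, ?_⟩, ?_⟩
    · exact (by omega : 1 ≤ W)
    · change s''.reg r + 1 ≤ W; omega
    · simp [hk'']
    · simpa [hk''] using hI''
    · simp [hk'', hk]; omega
  · have hkN' : k = N + 1 := by
      have : ¬ k ≤ N := by simpa [hk, hv] using hb
      omega
    subst hkN'
    rw [hc]
    exact hend s' hF' hk hI

/-- The rule for descending loops from `N` to `1`; the invariant `I k` holds when the loop condition
is tested with `k` in the loop register. -/
theorem wp_forDown {M W : ℕ} {r : R} {hi : Expr R A} {p : Cmd R A} {Q : State R A → Prop}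
    {s : State R A} (N : ℕ) (I : ℕ → State R A → Prop) (hhi : hi.Safe M W s)
    (hhiv : hi.val s = N) (hW : 1 ≤ W)
    (h0 : I N ((s.tick (hi.cost + 1)).setReg r N))
    (hstep : ∀ k s', k + 1 ≤ N → Frame (.forDown r hi p) s s' → s'.reg r = k + 1 → I (k + 1) s' →
      wp M W p (fun s'' => s''.reg r = k + 1 ∧ I k ((s''.tick 4).setReg r k)) (s'.tick 4))
    (hend : ∀ s', Frame (.forDown r hi p) s s' → s'.reg r = 0 → I 0 s' → Q (s'.tick 4)) :
    wp M W (.forDown r hi p) Q s := by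
  have hr : (Cmd.forDown r hi p).modReg r = true := by simp [Cmd.forDown, Cmd.modReg]
  have htr : ∀ s', Frame (.while (.le 1 (.reg r)) (.seq p (.assign r (.reg r - 1))))
      ((s.tick (hi.cost + 1)).setReg r N) s' → Frame (.forDown r hi p) s s' := by
    intro s' hF
    refine ⟨fun r' h => ?_, fun a' h => ?_, fun h => ?_⟩
    · have h' : Cmd.modReg r' p = false ∧ ¬ r = r' :=
        (by simpa [Cmd.forDown, Cmd.modReg] using h : _ ∧ _ ∧ _).2
      rw [hF.reg r' (by simpa [Cmd.modReg] using h')]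
      have : r' ≠ r := by rintro rfl; simp [hr] at h
      simp [this]
    · exact hF.arr a' (by simpa [Cmd.forDown, Cmd.modArr] using h)
    · exact hF.out (by simpa [Cmd.forDown, Cmd.silent] using h)
  refine ⟨hhi, ?_⟩
  rw [hhiv]
  refine wp_while (fun s' => ∃ k, k ≤ N ∧ s'.reg r = k ∧ I k s')
    (fun s' => s'.reg r) ⟨N, le_rfl, by simp, h0⟩ ?_
  rintro s' hF ⟨k, hkN, hk, hI⟩
  have hF' := htr s' hF
  refine ⟨⟨hW, trivial⟩, fun hb => ?_, fun hb => ?_⟩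
  · have hk1 : 1 ≤ k := by simpa [hk] using hb
    obtain ⟨k, rfl⟩ : ∃ k', k = k' + 1 := ⟨k - 1, by omega⟩
    rw [wp_seq]
    refine wp_then (hstep k s' hkN hF' hk hI) ?_
    rintro s'' - ⟨hk'', hI''⟩
    refine ⟨⟨trivial, hW⟩, ⟨k, by omega, ?_, ?_⟩, ?_⟩
    · simp [hk'']
    · simpa [hk''] using hI''
    · simp [hk'', hk]
  · have hk0 : k = 0 := by
      have : ¬ 1 ≤ k := by simpa [hk] using hb
      omega
    subst hk0
    exact hend s' hF' hk hI

end RAM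

/-! ### Occurrences of characters and greedy embeddings -/

namespace MCS

/-- `next(c, h)` in the string `x 1, …, x m`: the least position after `h` that carries `c`, or the
first position outside the string. -/
noncomputable def nextPos (x : ℕ → ℕ) (m c h : ℕ) : ℕ := sInf {k | h < k ∧ (k ≤ m → x k = c)}

/-- `prev(c, h)`: the greatest position before `h` that carries `c`, or `0`. -/
def prevPos (x : ℕ → ℕ) (c : ℕ) : ℕ → ℕ
  | 0 => 0
  | h + 1 => if x h = c then h else prevPos x c h

variable {x y : ℕ → ℕ} {m l : ℕ}

theorem nextPos_mem (x : ℕ → ℕ) (m c h : ℕ) :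
    h < nextPos x m c h ∧ (nextPos x m c h ≤ m → x (nextPos x m c h) = c) :=
  Nat.sInf_mem (s := {k | h < k ∧ (k ≤ m → x k = c)}) ⟨max h m + 1, by simp⟩

theorem lt_nextPos (x : ℕ → ℕ) (m c h : ℕ) : h < nextPos x m c h := (nextPos_mem x m c h).1

theorem nextPos_le {c h k : ℕ} (hk : h < k) (hc : k ≤ m → x k = c) : nextPos x m c h ≤ k :=
  Nat.sInf_le ⟨hk, hc⟩

theorem nextPos_le_succ {c h : ℕ} (hh : h ≤ m) : nextPos x m c h ≤ m + 1 :=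
  nextPos_le (by omega) (by omega)

theorem nextPos_lt_iff {c h i : ℕ} (hi : i ≤ m + 1) :
    nextPos x m c h < i ↔ ∃ k, h < k ∧ k < i ∧ x k = c :=
  ⟨fun hlt => ⟨_, lt_nextPos x m c h, hlt, (nextPos_mem x m c h).2 (by omega)⟩,
    fun ⟨_, h1, h2, h3⟩ => (nextPos_le h1 fun _ => h3).trans_lt h2⟩

theorem nextPos_top {c : ℕ} : nextPos x m c m = m + 1 :=
  le_antisymm (nextPos_le_succ le_rfl) (lt_nextPos x m c m)

theorem nextPos_step {c h : ℕ} (hh : h + 1 ≤ m) :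
    nextPos x m c h = if x (h + 1) = c then h + 1 else nextPos x m c (h + 1) := by
  split_ifs with hc
  · exact le_antisymm (nextPos_le (by omega) fun _ => hc) (lt_nextPos x m c h)
  · apply le_antisymm
    · exact nextPos_le ((Nat.lt_succ_self h).trans (lt_nextPos ..)) (nextPos_mem x m c (h + 1)).2
    · refine nextPos_le ?_ (nextPos_mem x m c h).2
      refine lt_of_le_of_ne (lt_nextPos x m c h) fun heq => hc ?_
      have := (nextPos_mem x m c h).2
      change h + 1 = _ at heq
      rw [← heq] at this
      exact this hh

theorem lt_prevPos_iff {c h i : ℕ} : h < prevPos x c i ↔ ∃ k, h < k ∧ k < i ∧ x k = c := by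
  induction i with
  | zero => simp [prevPos]
  | succ i ih =>
    rw [prevPos]
    split_ifs with hc
    · exact ⟨fun h' => ⟨i, h', by omega, hc⟩, fun ⟨k, h1, h2, _⟩ => by omega⟩
    · rw [ih]
      refine ⟨fun ⟨k, h1, h2, h3⟩ => ⟨k, h1, by omega, h3⟩, fun ⟨k, h1, h2, h3⟩ => ⟨k, h1, ?_, h3⟩⟩
      have : k ≠ i := by rintro rfl; exact hc h3
      omega

theorem prevPos_le (x : ℕ → ℕ) (c i : ℕ) : prevPos x c i ≤ i - 1 := by
  by_contra h
  obtain ⟨k, h1, h2, -⟩ := lt_prevPos_iff.1 (not_le.1 h)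
  omega

theorem prevPos_mono {c i i' : ℕ} (h : i ≤ i') : prevPos x c i ≤ prevPos x c i' := by
  by_contra h'
  obtain ⟨k, h1, h2, h3⟩ := lt_prevPos_iff.1 (not_le.1 h')
  exact absurd (lt_prevPos_iff.2 ⟨k, h1, by omega, h3⟩) (lt_irrefl _)

theorem prevPos_spec {c i : ℕ} (h : 0 < prevPos x c i) :
    prevPos x c i < i ∧ x (prevPos x c i) = c := by
  obtain ⟨k, h1, h2, h3⟩ := lt_prevPos_iff.1 (Nat.sub_lt h one_pos)
  have : k ≤ prevPos x c i := by
    by_contra h'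
    exact absurd (lt_prevPos_iff.2 ⟨k, not_le.1 h', h2, h3⟩) (lt_irrefl _)
  have : k = prevPos x c i := by omega
  exact this ▸ ⟨h2, h3⟩

/-- The galois connection between `next` and `prev`. -/
theorem nextPos_lt_iff_lt_prevPos {c h i : ℕ} (hi : i ≤ m + 1) :
    nextPos x m c h < i ↔ h < prevPos x c i := by
  rw [nextPos_lt_iff hi, lt_prevPos_iff]

theorem le_nextPos_iff {c h i : ℕ} (hi : i ≤ m + 1) :
    i ≤ nextPos x m c h ↔ prevPos x c i ≤ h := by
  rw [← not_lt, nextPos_lt_iff_lt_prevPos hi, not_lt]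

/-- The end of the shortest prefix of `x 1, …, x m` that contains `Z`; it exceeds `m` if there is
none. -/
noncomputable def pref (x : ℕ → ℕ) (m : ℕ) (Z : List ℕ) : ℕ :=
  Z.foldl (fun p c => nextPos x m c p) 0

/-- The beginning of the shortest suffix of `x 1, …, x m` that contains `Z`, or `0` if there is
none. -/
def suf (x : ℕ → ℕ) (m : ℕ) (Z : List ℕ) : ℕ := Z.foldr (fun c i => prevPos x c i) (m + 1)

@[simp] theorem pref_nil : pref x m [] = 0 := rfl
@[simp] theorem pref_concat (U : List ℕ) (c : ℕ) :
    pref x m (U ++ [c]) = nextPos x m c (pref x m U) := by simp [pref]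
@[simp] theorem suf_nil : suf x m [] = m + 1 := rfl
@[simp] theorem suf_cons (c : ℕ) (V : List ℕ) : suf x m (c :: V) = prevPos x c (suf x m V) := rfl

theorem suf_le (V : List ℕ) : suf x m V ≤ m + 1 := by
  induction V with
  | nil => exact le_rfl
  | cons c V ih => rw [suf_cons]; have := prevPos_le x c (suf x m V); omega

theorem suf_cons_le (c : ℕ) (V : List ℕ) : suf x m (c :: V) ≤ m := by
  have := prevPos_le x c (suf x m V); have := suf_le (x := x) (m := m) V
  rw [suf_cons]; omega

theorem suf_insert_le (U V : List ℕ) (d : ℕ) : suf x m (U ++ d :: V) ≤ suf x m (U ++ V) := by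
  induction U with
  | nil => exact (prevPos_le x d _).trans (Nat.sub_le _ _)
  | cons c U ih => exact prevPos_mono ih

theorem pref_lt_suf_cons {U V : List ℕ} {c : ℕ} :
    pref x m U < suf x m (c :: V) ↔ pref x m (U ++ [c]) < suf x m V := by
  rw [pref_concat, suf_cons, nextPos_lt_iff_lt_prevPos (suf_le V)]

theorem pref_lt_suf_append {U V W : List ℕ} :
    pref x m U < suf x m (V ++ W) ↔ pref x m (U ++ V) < suf x m W := by
  induction V generalizing U with
  | nil => simp
  | cons c V ih => rw [List.cons_append, pref_lt_suf_cons, ih]; simp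

theorem length_le_pref (U : List ℕ) : U.length ≤ pref x m U := by
  induction U using List.reverseRecOn with
  | nil => simp
  | append_singleton U c ih =>
    have := lt_nextPos x m c (pref x m U)
    simp; omega

/-! ### Maximality of common subsequences in terms of greedy embeddings -/

/-- `U ++ V` is a common subsequence: the shortest prefixes that contain `U` end before the shortest
suffixes that contain `V`. -/
def Gap (x y : ℕ → ℕ) (m l : ℕ) (U V : List ℕ) : Prop :=
  pref x m U < suf x m V ∧ pref y l U < suf y l V

theorem gap_append {U V W : List ℕ} : Gap x y m l U (V ++ W) ↔ Gap x y m l (U ++ V) W :=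
  and_congr pref_lt_suf_append pref_lt_suf_append

theorem gap_cons {U W : List ℕ} {c : ℕ} : Gap x y m l U (c :: W) ↔ Gap x y m l (U ++ [c]) W :=
  and_congr pref_lt_suf_cons pref_lt_suf_cons

theorem Gap.erase {U V W : List ℕ} {d : ℕ} (h : Gap x y m l U (V ++ d :: W)) :
    Gap x y m l U (V ++ W) :=
  ⟨h.1.trans_le (suf_insert_le ..), h.2.trans_le (suf_insert_le ..)⟩

/-- Nothing can be inserted between `U` and `V`. -/
def Border (x y : ℕ → ℕ) (m l : ℕ) (U V : List ℕ) : Prop := ∀ d, ¬ Gap x y m l (U ++ [d]) V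

/-- Nothing can be inserted into `U ++ V` before the last character of `U`. -/
def Good (x y : ℕ → ℕ) (m l : ℕ) (U V : List ℕ) : Prop :=
  ∀ U₁ U₂, U = U₁ ++ U₂ → U₂ ≠ [] → Border x y m l U₁ (U₂ ++ V)

/-- `Z` is a maximal common subsequence of `x 1, …, x m` and `y 1, …, y l`. -/
def Maximal (x y : ℕ → ℕ) (m l : ℕ) (Z : List ℕ) : Prop :=
  Gap x y m l Z [] ∧ ∀ U V, Z = U ++ V → Border x y m l U V

/-- `(s, t)` can serve as `safe(U)`: for all `V` for which nothing can be inserted between `U` and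
`V`, insertions before the last character of `U` are impossible if and only if the shortest suffixes
that contain `V` begin at most at `s` and `t`. -/
def IsSafe (x y : ℕ → ℕ) (m l : ℕ) (U : List ℕ) (s t : ℕ) : Prop :=
  ∀ V, Gap x y m l U V → Border x y m l U V →
    (Good x y m l U V ↔ suf x m V ≤ s ∧ suf y l V ≤ t)

theorem Border.erase {U V W : List ℕ} {d : ℕ} (h : Border x y m l U (V ++ W)) :
    Border x y m l U (V ++ d :: W) := fun e he => h e he.erase

theorem Good.erase {U V W : List ℕ} {d : ℕ} (h : Good x y m l U (V ++ W)) :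
    Good x y m l U (V ++ d :: W) := fun U₁ U₂ h1 h2 => by
  have := h U₁ U₂ h1 h2
  rw [← List.append_assoc] at this ⊢
  exact this.erase

theorem good_concat {U V : List ℕ} {c : ℕ} :
    Good x y m l (U ++ [c]) V ↔ Border x y m l U (c :: V) ∧ Good x y m l U (c :: V) := by
  constructor
  · intro h
    refine ⟨h U [c] rfl (by simp), fun U₁ U₂ h1 h2 => ?_⟩
    have := h U₁ (U₂ ++ [c]) (by simp [h1]) (by simp)
    simpa using this
  · rintro ⟨h1, h2⟩ U₁ U₂ h3 h4
    obtain rfl | ⟨U₃, e, rfl⟩ := U₂.eq_nil_or_concat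
    · exact absurd rfl h4
    · rw [List.concat_eq_append, ← List.append_assoc] at h3
      obtain ⟨rfl, he⟩ := List.append_inj' h3 rfl
      obtain rfl : c = e := by simpa using he
      rcases U₃.eq_nil_or_concat with rfl | ⟨U₄, e, rfl⟩
      · simpa using h1
      · simpa using h2 U₁ (U₄ ++ [e]) (by simp) (by simp)

/-- One half of the recursion for `safe`: an insertion in front of the last character `c` that does
not move the end of the shortest prefix of `y` uses a character `y j` skipped by `y`. -/
theorem border_half {U V : List ℕ} {c : ℕ} {p q q' i j : ℕ} (hp : pref x m U = p)
    (hq : pref y l U = q) (hi : suf x m V = i) (hj : suf y l V = j)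
    (hql : q' ≤ l) (hjq : prevPos y c j = q') :
    Border x y m l U (c :: V) ↔ ∀ k, q < k → k < q' → nextPos x m (y k) p ≤ m →
      i ≤ nextPos x m c (nextPos x m (y k) p) := by
  have hi' : i ≤ m + 1 := hi ▸ suf_le V
  have hb : prevPos x c i ≤ m + 1 := by have := prevPos_le x c i; omega
  constructor
  · intro h k h1 h2 h3
    by_contra h4
    refine h (y k) ⟨?_, ?_⟩
    · rw [pref_concat, hp, suf_cons, hi]
      exact (nextPos_lt_iff_lt_prevPos hi').1 (not_le.1 h4)
    · rw [pref_concat, hq, suf_cons, hj, hjq]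
      exact (nextPos_le h1 fun _ => rfl).trans_lt h2
  · rintro h d ⟨h1, h2⟩
    rw [pref_concat, hp, suf_cons, hi] at h1
    rw [pref_concat, hq, suf_cons, hj, hjq] at h2
    have h3 := (nextPos_mem y l d q).2 (by omega)
    have h4 := h _ (lt_nextPos y l d q) h2
    rw [h3] at h4
    have h5 := prevPos_le x c i
    have := h4 (by omega)
    exact absurd ((nextPos_lt_iff_lt_prevPos hi').2 h1) (not_lt.2 this)

theorem border_swap {U V : List ℕ} : Border x y m l U V ↔ Border y x l m U V :=
  forall_congr' fun _ => not_congr and_comm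

/-- The recursion for `safe`. -/
theorem IsSafe.step {U : List ℕ} {c s t s' t' p q p' q' : ℕ} (h : IsSafe x y m l U s t)
    (hp : pref x m U = p) (hq : pref y l U = q)
    (hp' : nextPos x m c p = p') (hq' : nextPos y l c q = q')
    (hs : s ≤ m + 1) (ht : t ≤ l + 1)
    (hs' : ∀ i ≤ m + 1, i ≤ s' ↔ (∀ k, q < k → k < q' → nextPos x m (y k) p ≤ m →
      i ≤ nextPos x m c (nextPos x m (y k) p)) ∧ (s ≤ m → i ≤ nextPos x m c s))
    (ht' : ∀ j ≤ l + 1, j ≤ t' ↔ (∀ k, p < k → k < p' → nextPos y l (x k) q ≤ l →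
      j ≤ nextPos y l c (nextPos y l (x k) q)) ∧ (t ≤ l → j ≤ nextPos y l c t)) :
    IsSafe x y m l (U ++ [c]) s' t' := by
  intro V hG hB
  set i := suf x m V with hi
  set j := suf y l V with hj
  have him : i ≤ m + 1 := suf_le V
  have hjl : j ≤ l + 1 := suf_le V
  have hG' : p' < i ∧ q' < j := by
    simpa only [Gap, pref_concat, hp, hq, hp', hq'] using hG
  have hpc : x p' = c := hp' ▸ (nextPos_mem x m c p).2 (by omega)
  have hqc : y q' = c := hq' ▸ (nextPos_mem y l c q).2 (by omega)
  have h1 : p' ≤ prevPos x c i := by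
    by_contra hlt
    exact absurd (lt_prevPos_iff.2 ⟨p', not_le.1 hlt, hG'.1, hpc⟩) (lt_irrefl _)
  have h2 : q' ≤ prevPos y c j := by
    by_contra hlt
    exact absurd (lt_prevPos_iff.2 ⟨q', not_le.1 hlt, hG'.2, hqc⟩) (lt_irrefl _)
  have hdisj : prevPos x c i = p' ∨ prevPos y c j = q' := by
    by_contra hne
    push Not at hne
    refine hB c ⟨?_, ?_⟩
    · rw [pref_concat, pref_concat, hp, hp', ← hi]
      exact (nextPos_lt_iff_lt_prevPos him).2 (by omega)
    · rw [pref_concat, pref_concat, hq, hq', ← hj]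
      exact (nextPos_lt_iff_lt_prevPos hjl).2 (by omega)
  have hbord : Border x y m l U (c :: V) ↔
      (∀ k, q < k → k < q' → nextPos x m (y k) p ≤ m →
        i ≤ nextPos x m c (nextPos x m (y k) p)) ∧
      (∀ k, p < k → k < p' → nextPos y l (x k) q ≤ l →
        j ≤ nextPos y l c (nextPos y l (x k) q)) := by
    have hsome : ∀ {x y : ℕ → ℕ} {m l p q p' q' i j : ℕ}, j ≤ l + 1 → i ≤ m + 1 → q' < j →
        p' < i → suf x m V = i → suf y l V = j → pref x m U = p → pref y l U = q →
        nextPos x m c p = p' → nextPos y l c q = q' → q' ≤ prevPos y c j → prevPos x c i = p' →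
        Border y x l m U (c :: V) →
        (∀ k, q < k → k < q' → nextPos x m (y k) p ≤ m →
          i ≤ nextPos x m c (nextPos x m (y k) p)) := by
      intro x y m l p q p' q' i j hjl him hqj hpi hi hj hp hq hp' hq' hle hx hb k hk hkq hkm
      by_contra hlt
      refine hb (y k) ⟨?_, ?_⟩
      · rw [pref_concat, hq, suf_cons, hj]
        exact (nextPos_le hk fun _ => rfl).trans_lt (by omega)
      · rw [pref_concat, hp, suf_cons, hi]
        exact (nextPos_lt_iff_lt_prevPos him).1 (not_le.1 hlt)
    rcases hdisj with hd | hd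
    · rw [border_swap, ← border_half hq hp hj.symm hi.symm (by omega) hd]
      exact ⟨fun hb => ⟨hsome hjl him hG'.2 hG'.1 hi.symm hj.symm hp hq hp' hq' h2 hd hb, hb⟩,
        fun hb => hb.2⟩
    · rw [← border_half hp hq hi.symm hj.symm (by omega) hd]
      exact ⟨fun hb => ⟨hb, hsome him hjl hG'.1 hG'.2 hj.symm hi.symm hq hp hq' hp' h1 hd hb⟩,
        fun hb => hb.1⟩
  rw [good_concat, hs' i him, ht' j hjl]
  have hle1 : suf x m (c :: V) ≤ s ↔ (s ≤ m → i ≤ nextPos x m c s) := by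
    rw [suf_cons, ← hi, ← le_nextPos_iff him]
    refine ⟨fun h _ => h, fun h => ?_⟩
    by_cases hsm : s ≤ m
    · exact h hsm
    · exact him.trans (by have := lt_nextPos x m c s; omega)
  have hle2 : suf y l (c :: V) ≤ t ↔ (t ≤ l → j ≤ nextPos y l c t) := by
    rw [suf_cons, ← hj, ← le_nextPos_iff hjl]
    refine ⟨fun h _ => h, fun h => ?_⟩
    by_cases hsm : t ≤ l
    · exact h hsm
    · exact hjl.trans (by have := lt_nextPos y l c t; omega)
  constructor
  · rintro ⟨hb, hg⟩
    have hg' := (h (c :: V) (gap_cons.2 hG) hb).1 hg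
    have hb' := hbord.1 hb
    exact ⟨⟨hb'.1, hle1.1 hg'.1⟩, hb'.2, hle2.1 hg'.2⟩
  · rintro ⟨⟨ha, hb⟩, hc, hd⟩
    have hb' := hbord.2 ⟨ha, hc⟩
    exact ⟨hb', (h (c :: V) (gap_cons.2 hG) hb').2 ⟨hle1.2 hb, hle2.2 hd⟩⟩

/-- A common subsequence to which nothing can be added up to the border after `U` extends to a
maximal one by insertions after the character that follows `U`. -/
theorem exists_maximal_extension {U V : List ℕ} {c : ℕ} (hG : Gap x y m l U (c :: V))
    (hB : Border x y m l U (c :: V)) (hgood : Good x y m l U (c :: V)) :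
    ∃ V', Maximal x y m l (U ++ c :: V') := by
  have hlen : ∀ V, Gap x y m l U (c :: V) → V.length ≤ m := by
    intro V h
    rw [← List.append_nil (c :: V), gap_append] at h
    have := length_le_pref (x := x) (m := m) (U ++ c :: V)
    have := h.1
    simp at *
    omega
  induction hn : m - V.length using Nat.strong_induction_on generalizing V with
  | _ n ih =>
  by_cases hmax : Maximal x y m l (U ++ c :: V)
  · exact ⟨V, hmax⟩
  have hG' : Gap x y m l (U ++ c :: V) [] := by
    rw [← gap_append]; simpa using hG
  rw [Maximal, not_and] at hmax
  have := hmax hG'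
  push Not at this
  obtain ⟨A, B, hAB, hnb⟩ := this
  rw [Border] at hnb
  push Not at hnb
  obtain ⟨d, hd⟩ := hnb
  rcases List.append_eq_append_iff.1 hAB with ⟨U₂, rfl, hcV⟩ | ⟨U₂, rfl, hV⟩
  · rcases U₂ with _ | ⟨e, V₁⟩
    · simp only [List.nil_append, List.append_nil] at hcV hd
      exact absurd hd (hcV ▸ hB d)
    · simp only [List.cons_append, List.cons.injEq] at hcV
      obtain ⟨rfl, rfl⟩ := hcV
      have hd' : Gap x y m l U (c :: (V₁ ++ d :: B)) := by
        have : c :: (V₁ ++ d :: B) = (c :: V₁ ++ [d]) ++ B := by simp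
        rw [this, gap_append]
        simpa using hd
      have h1 := hlen _ hd'
      refine ih (m - (V₁ ++ d :: B).length) ?_ hd' ?_ ?_ rfl
      · simp at *; omega
      · exact Border.erase (V := c :: V₁) hB
      · exact Good.erase (V := c :: V₁) hgood
  · rcases eq_or_ne U₂ [] with rfl | hne
    · simp only [List.nil_append, List.append_nil] at *
      subst hV
      exact absurd hd (hB d)
    · subst hV
      exact absurd hd (hgood A U₂ rfl hne d)

end MCS

namespace MCS

variable {x y : ℕ → ℕ} {m l σ : ℕ}

/-! ### Suff-matches and the children of a node of the trie -/

/-- `(i, j)` is the pair of the beginnings of the shortest suffixes that contain some nonempty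
string. -/
def SuffMatch (x y : ℕ → ℕ) (m l i j : ℕ) : Prop :=
  ∃ c V, 0 < i ∧ 0 < j ∧ i = suf x m (c :: V) ∧ j = suf y l (c :: V)

theorem SuffMatch.bounds {i j : ℕ} (h : SuffMatch x y m l i j) :
    1 ≤ i ∧ i ≤ m ∧ 1 ≤ j ∧ j ≤ l ∧ x i = y j := by
  obtain ⟨c, V, hi, hj, rfl, rfl⟩ := h
  exact ⟨hi, suf_cons_le c V, hj, suf_cons_le c V,
    (prevPos_spec hi).2.trans (prevPos_spec hj).2.symm⟩

/-- Prepending `d` to a string with the suff-match `(i, j)`. -/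
theorem SuffMatch.prev {i j d : ℕ} (h : SuffMatch x y m l i j) (hi : 0 < prevPos x d i)
    (hj : 0 < prevPos y d j) : SuffMatch x y m l (prevPos x d i) (prevPos y d j) := by
  obtain ⟨c, V, -, -, rfl, rfl⟩ := h
  exact ⟨d, c :: V, hi, hj, rfl, rfl⟩

/-- The entry `Suff_i[j]`. -/
noncomputable def sf (x y : ℕ → ℕ) (m l i j : ℕ) : ℕ :=
  sInf ({i' | i ≤ i' ∧ i' ≤ m ∧ SuffMatch x y m l i' j} ∪ {m + 1})

theorem isLeast_sf (x y : ℕ → ℕ) (m l i j : ℕ) :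
    IsLeast ({i' | i ≤ i' ∧ i' ≤ m ∧ SuffMatch x y m l i' j} ∪ {m + 1}) (sf x y m l i j) :=
  ⟨Nat.sInf_mem ⟨m + 1, Or.inr rfl⟩, fun _ h => Nat.sInf_le h⟩

theorem sf_le_succ (i j : ℕ) : sf x y m l i j ≤ m + 1 := (isLeast_sf x y m l i j).2 (Or.inr rfl)

theorem sf_le {i i' j : ℕ} (h : SuffMatch x y m l i' j) (hi : i ≤ i') : sf x y m l i j ≤ i' :=
  (isLeast_sf x y m l i j).2 (Or.inl ⟨hi, h.bounds.2.1, h⟩)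

theorem sf_spec {i j : ℕ} (h : sf x y m l i j ≤ m) :
    i ≤ sf x y m l i j ∧ SuffMatch x y m l (sf x y m l i j) j := by
  rcases (isLeast_sf x y m l i j).1 with h' | h'
  · exact ⟨h'.1, h'.2.2⟩
  · rw [Set.mem_singleton_iff] at h'; omega

/-- `j` is a strict prefix minimum, with a value of at most `lim`, of the sequence `S` on the
interval from `q + 1` to `h`. -/
def Wit (S : ℕ → ℕ) (q lim h j : ℕ) : Prop :=
  q < j ∧ j ≤ h ∧ S j ≤ lim ∧ ∀ j', q < j' → j' < j → S j < S j'

/-- No character can be put in front of a witness: this would give a smaller suff-match. -/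
theorem Wit.not_prev {p q lim h j d : ℕ} (hw : Wit (sf x y m l (p + 1)) q lim h j) (hlim : lim ≤ m)
    (hi : p < prevPos x d (sf x y m l (p + 1) j)) (hj : q < prevPos y d j) : False := by
  obtain ⟨h1, h2, h3, h4⟩ := hw
  obtain ⟨h5, h6⟩ := sf_spec (h3.trans hlim)
  have h7 := h6.prev (d := d) (by omega) (by omega)
  have h8 := h4 _ hj (prevPos_spec (by omega)).1
  have h9 := sf_le (i := p + 1) h7 hi
  have := prevPos_le x d (sf x y m l (p + 1) j)
  omega

theorem exists_wit_le (S : ℕ → ℕ) {q lim h j : ℕ} (hq : q < j) (hj : j ≤ h) (hS : S j ≤ lim) :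
    ∃ j₀, Wit S q lim h j₀ ∧ j₀ ≤ j ∧ S j₀ ≤ S j := by
  induction hn : j using Nat.strong_induction_on generalizing j with
  | _ n ih =>
  subst hn
  by_cases h' : ∀ j', q < j' → j' < j → S j < S j'
  · exact ⟨j, ⟨hq, hj, hS, h'⟩, le_rfl, le_rfl⟩
  · push Not at h'
    obtain ⟨k, h1, h2, h3⟩ := h'
    obtain ⟨j₀, h4, h5, h6⟩ := ih k h2 h1 (by omega) (h3.trans hS) rfl
    exact ⟨j₀, h4, by omega, by omega⟩

/-- The characters that continue the prefix `U` to a maximal common subsequence are the characters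
of the witnesses. -/
theorem exists_maximal_iff_wit {U : List ℕ} {s t p q c : ℕ} (hsafe : IsSafe x y m l U s t)
    (hp : pref x m U = p) (hq : pref y l U = q) :
    (∃ V, Maximal x y m l (U ++ c :: V)) ↔
      ∃ j, Wit (sf x y m l (p + 1)) q (min s m) (min t l) j ∧ y j = c := by
  constructor
  · rintro ⟨V, hG, hmax⟩
    have hG' : Gap x y m l U (c :: V) := by rw [← gap_append] at hG; simpa using hG
    have hB := hmax U (c :: V) rfl
    have hgood : Good x y m l U (c :: V) := fun U₁ U₂ h1 _ => hmax U₁ _ (by simp [h1])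
    obtain ⟨hs, ht⟩ := (hsafe _ hG' hB).1 hgood
    set i := suf x m (c :: V) with hi
    set j := suf y l (c :: V) with hj
    have hpi : p < i := hp ▸ hG'.1
    have hqj : q < j := hq ▸ hG'.2
    have hM : SuffMatch x y m l i j := ⟨c, V, by omega, by omega, rfl, rfl⟩
    have hb := hM.bounds
    have hle := sf_le (i := p + 1) hM hpi
    have hyj : y j = c :=
      (prevPos_spec (x := y) (c := c) (i := suf y l V) (by rw [← suf_cons, ← hj]; omega)).2
    obtain ⟨j₀, hw, h1, h2⟩ := exists_wit_le (sf x y m l (p + 1)) (lim := min s m) (h := min t l)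
      hqj (by omega) (by omega)
    refine ⟨j₀, hw, ?_⟩
    obtain ⟨h3, h4⟩ := sf_spec (i := p + 1) (j := j₀) (x := x) (y := y) (m := m) (l := l) (by omega)
    have hb' := h4.bounds
    by_cases hij : sf x y m l (p + 1) j₀ < i ∧ j₀ < j
    · refine absurd ?_ (hB (y j₀))
      have := hw.1
      refine ⟨?_, ?_⟩
      · rw [pref_concat, hp]
        exact (nextPos_le h3 fun _ => hb'.2.2.2.2).trans_lt hij.1
      · rw [pref_concat, hq]
        exact (nextPos_le this fun _ => rfl).trans_lt hij.2
    · rcases not_and_or.1 hij with h | h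
      · have : sf x y m l (p + 1) j₀ = i := by omega
        rw [← hb'.2.2.2.2, this, hb.2.2.2.2, hyj]
      · have : j₀ = j := by omega
        rw [this, hyj]
  · rintro ⟨j, hw, rfl⟩
    have hlim : min s m ≤ m := min_le_right _ _
    obtain ⟨h3, h4⟩ := sf_spec (hw.2.2.1.trans hlim)
    have hb := h4.bounds
    obtain ⟨c, V, hi0, hj0, hi, hj⟩ := h4
    have hc : y j = c := by
      have := (prevPos_spec (x := y) (c := c) (i := suf y l V) (by rw [← suf_cons, ← hj]; omega)).2
      rwa [← suf_cons, ← hj] at this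
    have hG : Gap x y m l U (c :: V) := ⟨by rw [← hi, hp]; omega, by rw [← hj, hq]; exact hw.1⟩
    have hB : Border x y m l U (c :: V) := by
      rintro d ⟨h1, h2⟩
      rw [pref_concat, nextPos_lt_iff_lt_prevPos (suf_le _), hp, ← hi] at h1
      rw [pref_concat, nextPos_lt_iff_lt_prevPos (suf_le _), hq, ← hj] at h2
      exact hw.not_prev hlim h1 h2
    rw [hc]
    refine exists_maximal_extension hG hB ((hsafe _ hG hB).2 ?_)
    rw [← hi, ← hj]
    have := hw.2.1
    have := hw.2.2.1
    omega

/-- The delay bound rests on this: the number of witnesses found after `U` is at most the distance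
that the ends of the shortest prefixes move when `c` is appended. A witness right of both new ends
would have an occurrence of `c` in front of it, in contradiction to its minimality. -/
theorem card_wit_le {p q p' q' lim h c : ℕ} {F : Finset ℕ} (hlim : lim ≤ m)
    (hp' : p' = nextPos x m c p) (hq' : q' = nextPos y l c q) (hpm : p' ≤ m) (hql : q' ≤ l)
    (hF : ∀ j ∈ F, Wit (sf x y m l (p + 1)) q lim h j) :
    F.card ≤ (p' - p) + (q' - q) := by
  have hpc : x p' = c := hp' ▸ (nextPos_mem x m c p).2 (by omega)
  have hqc : y q' = c := hq' ▸ (nextPos_mem y l c q).2 (by omega)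
  have hlt : p < p' := hp' ▸ lt_nextPos ..
  have hlt' : q < q' := hq' ▸ lt_nextPos ..
  have hsplit := F.card_filter_add_card_filter_not (fun j => j ≤ q')
  have h1 : (F.filter fun j => j ≤ q').card ≤ q' - q := by
    rw [← Nat.card_Ioc]
    refine Finset.card_le_card fun j hj => ?_
    rw [Finset.mem_filter] at hj
    exact Finset.mem_Ioc.2 ⟨(hF j hj.1).1, hj.2⟩
  have h2 : (F.filter fun j => ¬ j ≤ q').card ≤ p' - p := by
    rw [← Nat.card_Ioc]
    refine Finset.card_le_card_of_injOn (sf x y m l (p + 1)) (fun j hj => ?_) ?_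
    · rw [Finset.mem_coe, Finset.mem_filter] at hj
      have hw := hF j hj.1
      have h3 := (sf_spec (hw.2.2.1.trans hlim)).1
      refine Finset.mem_coe.2 (Finset.mem_Ioc.2 ⟨h3, ?_⟩)
      by_contra h4
      refine hw.not_prev (d := c) hlim ?_ ?_
      · exact lt_prevPos_iff.2 ⟨p', hlt, not_le.1 h4, hpc⟩
      · exact lt_prevPos_iff.2 ⟨q', hlt', not_le.1 hj.2, hqc⟩
    · intro j hj k hk hjk
      rw [Finset.mem_coe, Finset.mem_filter] at hj hk
      rcases lt_trichotomy j k with h | h | h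
      · have := (hF k hk.1).2.2.2 j (hF j hj.1).1 h; omega
      · exact h
      · have := (hF j hj.1).2.2.2 k (hF k hk.1).1 h; omega
  omega

/-! ### Strings with end characters -/

/-- The character `1` is at the first position of `x 1, …, x m` and `σ` is at the last one, and
both are nowhere else. -/
structure Ends (x : ℕ → ℕ) (m σ : ℕ) : Prop where
  two_le : 2 ≤ m
  first : ∀ k, 1 ≤ k → k ≤ m → (x k = 1 ↔ k = 1)
  last : ∀ k, 1 ≤ k → k ≤ m → (x k = σ ↔ k = m)

theorem prevPos_eq_of_le {c i k k' : ℕ} (h : prevPos x c k = i) (hi : 0 < i) (hk : i < k')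
    (hk' : k' ≤ k) : prevPos x c k' = i := by
  subst h
  refine le_antisymm (prevPos_mono hk') ?_
  by_contra hlt
  exact absurd (lt_prevPos_iff.2 ⟨_, not_le.1 hlt, hk, (prevPos_spec hi).2⟩) (lt_irrefl _)

theorem prevPos_last (hx : Ends x m σ) : prevPos x σ (m + 1) = m := by
  have := hx.two_le
  rw [prevPos, if_pos ((hx.last m (by omega) le_rfl).2 rfl)]

theorem suffMatch_last (hx : Ends x m σ) (hy : Ends y l σ) : SuffMatch x y m l m l := by
  have := hx.two_le; have := hy.two_le
  exact ⟨σ, [], by omega, by omega, (prevPos_last hx).symm, (prevPos_last hy).symm⟩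

theorem sf_top (hx : Ends x m σ) (hy : Ends y l σ) {j : ℕ} :
    sf x y m l m j = if j = l then m else m + 1 := by
  have h2 := hx.two_le
  have := sf_le_succ (x := x) (y := y) (m := m) (l := l) m j
  split_ifs with hj
  · subst hj
    have h3 := sf_le (suffMatch_last hx hy) le_rfl
    exact le_antisymm h3 (sf_spec h3).1
  · by_contra hne
    obtain ⟨h3, c, V, h4, h5, h6, h7⟩ := sf_spec (x := x) (y := y) (m := m) (l := l) (i := m)
      (j := j) (by omega)
    have h8 : sf x y m l m j = m := by omega
    rw [h8] at h6
    cases V with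
    | cons d V =>
      have := prevPos_le x c (suf x m (d :: V))
      have := suf_cons_le (x := x) (m := m) d V
      rw [suf_cons] at h6
      omega
    | nil =>
      rw [suf_cons, suf_nil] at h6 h7
      have hc := (prevPos_spec (x := x) (c := c) (i := m + 1) (by omega)).2
      rw [← h6, (hx.last m (by omega) le_rfl).2 rfl] at hc
      subst hc
      rw [prevPos_last hy] at h7
      exact hj h7

/-- The correctness of the update of `Suff_{i+1}` to `Suff_i`. -/
theorem sf_step (hx : Ends x m σ) (hy : Ends y l σ) {i u : ℕ} (hi : 1 ≤ i) (him : i < m)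
    (hu : 1 ≤ u) :
    ((∃ j, 1 ≤ j ∧ j ≤ l ∧ sf x y m l (i + 1) j ≠ m + 1 ∧ prevPos y (x i) j = u ∧
      prevPos x (x i) (sf x y m l (i + 1) j) = i) → sf x y m l i u = i) ∧
    ((¬ ∃ j, 1 ≤ j ∧ j ≤ l ∧ sf x y m l (i + 1) j ≠ m + 1 ∧ prevPos y (x i) j = u ∧
      prevPos x (x i) (sf x y m l (i + 1) j) = i) → sf x y m l i u = sf x y m l (i + 1) u) := by
  constructor
  · rintro ⟨j, h1, h2, h3, h4, h5⟩
    have := sf_le_succ (x := x) (y := y) (m := m) (l := l) (i + 1) j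
    have h6 := (sf_spec (i := i + 1) (by omega : sf x y m l (i + 1) j ≤ m)).2
    have h7 := h6.prev (d := x i) (by omega) (by omega)
    rw [h4, h5] at h7
    have h8 := sf_le h7 le_rfl
    exact le_antisymm h8 (sf_spec (by omega)).1
  · intro h
    have hno : ¬ SuffMatch x y m l i u := by
      rintro ⟨c, V, h1, h2, h3, h4⟩
      have hc : x i = c := by
        have := (prevPos_spec (x := x) (c := c) (i := suf x m V)
          (by rw [← suf_cons, ← h3]; omega)).2
        rwa [← suf_cons, ← h3] at this
      apply h
      rw [hc]
      rw [suf_cons] at h3 h4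
      cases V with
      | nil =>
        have h5 := sf_le (i := i + 1) (suffMatch_last hx hy) him
        have h6 := (sf_spec (h5.trans le_rfl)).1
        refine ⟨l, by have := hy.two_le; omega, le_rfl, by omega, ?_, ?_⟩
        · rw [suf_nil, prevPos, if_neg] at h4
          · exact h4.symm
          · rw [(hy.last l (by have := hy.two_le; omega) le_rfl).2 rfl, ← hc]
            exact fun he => absurd ((hx.last i hi him.le).1 he.symm) (by omega)
        · exact prevPos_eq_of_le h3.symm h1 h6 (by rw [suf_nil]; omega)
      | cons d V =>
        have hpos : 0 < suf x m (d :: V) := by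
          have := prevPos_spec (x := x) (c := c) (i := suf x m (d :: V)) (by omega); omega
        have hpos' : 0 < suf y l (d :: V) := by
          have := prevPos_spec (x := y) (c := c) (i := suf y l (d :: V)) (by omega); omega
        have hM : SuffMatch x y m l (suf x m (d :: V)) (suf y l (d :: V)) :=
          ⟨d, V, hpos, hpos', rfl, rfl⟩
        have h5 : i < suf x m (d :: V) := by
          have := prevPos_spec (x := x) (c := c) (i := suf x m (d :: V)) (by omega); omega
        have h6 := sf_le (i := i + 1) hM h5
        have hb := hM.bounds
        have h7 := (sf_spec (h6.trans hb.2.1)).1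
        exact ⟨_, hb.2.2.1, hb.2.2.2.1, by omega, h4.symm,
          prevPos_eq_of_le h3.symm h1 h7 h6⟩
    have h9 := sf_le_succ (x := x) (y := y) (m := m) (l := l) i u
    apply le_antisymm
    · rcases (isLeast_sf x y m l (i + 1) u).1 with h' | h'
      · exact sf_le h'.2.2 (by have := h'.1; omega)
      · rw [Set.mem_singleton_iff] at h'; omega
    · rcases (isLeast_sf x y m l i u).1 with h' | h'
      · refine sf_le h'.2.2 (lt_of_le_of_ne h'.1 fun he => hno ?_)
        have := h'.2.2
        rwa [← he] at this
      · rw [Set.mem_singleton_iff] at h'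
        rw [h']; exact sf_le_succ _ _

theorem pref_one (hx : Ends x m σ) : pref x m [1] = 1 := by
  have := hx.two_le
  rw [show [1] = ([] : List ℕ) ++ [1] from rfl, pref_concat, pref_nil, nextPos_step (by omega),
    if_pos ((hx.first 1 le_rfl (by omega)).2 rfl)]

theorem pref_concat_last (hx : Ends x m σ) {U : List ℕ} (h : pref x m (U ++ [σ]) ≤ m) :
    pref x m (U ++ [σ]) = m := by
  rw [pref_concat] at *
  exact (hx.last _ (by have := lt_nextPos x m σ (pref x m U); omega) h).1 ((nextPos_mem ..).2 h)

theorem Maximal.exists_cons (hx : Ends x m σ) (hy : Ends y l σ) {Z : List ℕ}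
    (h : Maximal x y m l Z) : ∃ V, Z = 1 :: V := by
  have hb := h.2 [] Z rfl 1
  have hG : Gap x y m l [] Z := by
    rw [← List.append_nil Z, gap_append]; exact h.1
  have h0 : 0 < suf x m Z := hG.1
  have h0' : 0 < suf y l Z := hG.2
  rw [List.nil_append, Gap, pref_one hx, pref_one hy, not_and_or, not_lt, not_lt] at hb
  have := hx.two_le; have := hy.two_le
  cases Z with
  | nil => simp at hb; omega
  | cons c V =>
    refine ⟨V, ?_⟩
    rw [suf_cons] at h0 h0'
    rw [suf_cons, suf_cons] at hb
    rcases hb with hb | hb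
    · have h1 := (prevPos_spec h0).2
      rw [show prevPos x c (suf x m V) = 1 by omega,
        (hx.first 1 le_rfl (by omega)).2 rfl] at h1
      rw [h1]
    · have h1 := (prevPos_spec h0').2
      rw [show prevPos y c (suf y l V) = 1 by omega,
        (hy.first 1 le_rfl (by omega)).2 rfl] at h1
      rw [h1]

theorem Maximal.exists_concat (hx : Ends x m σ) (hy : Ends y l σ) {Z : List ℕ}
    (h : Maximal x y m l Z) : ∃ U, Z = U ++ [σ] := by
  have hb := h.2 Z [] (by simp) σ
  have h0 : pref x m Z < m + 1 := h.1.1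
  have h0' : pref y l Z < l + 1 := h.1.2
  have := hx.two_le; have := hy.two_le
  rcases Z.eq_nil_or_concat with rfl | ⟨U, c, rfl⟩
  · obtain ⟨V, hV⟩ := h.exists_cons hx hy; simp at hV
  · rw [List.concat_eq_append] at *
    refine ⟨U, ?_⟩
    have hor : pref x m (U ++ [c]) = m ∨ pref y l (U ++ [c]) = l := by
      by_contra hne
      push Not at hne
      refine hb ⟨?_, ?_⟩
      · rw [pref_concat]
        exact (nextPos_le (k := m) (by omega)
          fun _ => (hx.last m (by omega) le_rfl).2 rfl).trans_lt (Nat.lt_succ_self m)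
      · rw [pref_concat]
        exact (nextPos_le (k := l) (by omega)
          fun _ => (hy.last l (by omega) le_rfl).2 rfl).trans_lt (Nat.lt_succ_self l)
    rw [pref_concat] at hor h0
    rw [pref_concat] at hor h0'
    rcases hor with ho | ho
    · have := (nextPos_mem x m c (pref x m U)).2 (by omega)
      rw [ho, (hx.last m (by omega) le_rfl).2 rfl] at this
      rw [this]
    · have := (nextPos_mem y l c (pref y l U)).2 (by omega)
      rw [ho, (hy.last l (by omega) le_rfl).2 rfl] at this
      rw [this]

/-- A prefix of a maximal common subsequence that ends with `σ` is the whole string. -/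
theorem Maximal.eq_nil_of_last (hx : Ends x m σ) {U V : List ℕ}
    (h : Maximal x y m l (U ++ [σ] ++ V)) : V = [] := by
  have h1 : pref x m (U ++ [σ]) < suf x m V := (gap_append.2 h.1).1.trans_le (by simp)
  have h2 := suf_le (x := x) (m := m) V
  have h3 := pref_concat_last hx (by omega : pref x m (U ++ [σ]) ≤ m)
  cases V with
  | nil => rfl
  | cons c V => have := suf_cons_le (x := x) (m := m) c V; omega

theorem exists_maximal (hx : Ends x m σ) (hy : Ends y l σ) : ∃ V, Maximal x y m l (1 :: V) := by
  have key : ∀ n Z, Gap x y m l Z [] → m - Z.length = n → ∃ Z', Maximal x y m l Z' := by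
    intro n
    induction n using Nat.strong_induction_on with
    | _ n ih =>
    intro Z hZ hn
    by_cases hmax : Maximal x y m l Z
    · exact ⟨Z, hmax⟩
    rw [Maximal, not_and] at hmax
    have := hmax hZ
    push Not at this
    obtain ⟨A, B, rfl, hnb⟩ := this
    rw [Border] at hnb
    push Not at hnb
    obtain ⟨d, hd⟩ := hnb
    rw [← List.append_nil B, gap_append] at hd
    have h1 := length_le_pref (x := x) (m := m) (A ++ [d] ++ B)
    have h2 := hd.1
    rw [suf_nil] at h2
    refine ih _ ?_ _ hd rfl
    simp at *; omega
  obtain ⟨Z, hZ⟩ := key _ [] ⟨by simp, by simp⟩ rfl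
  obtain ⟨V, rfl⟩ := hZ.exists_cons hx hy
  exact ⟨V, hZ⟩

theorem isSafe_one (hx : Ends x m σ) : IsSafe x y m l [1] (m + 1) (l + 1) := by
  refine fun V hG hB => ⟨fun _ => ⟨suf_le V, suf_le V⟩, fun _ U₁ U₂ h1 h2 d => ?_⟩
  have := hx.two_le
  obtain ⟨rfl, rfl⟩ : U₁ = [] ∧ U₂ = [1] := by
    cases U₁ with
    | nil => exact ⟨rfl, h1.symm⟩
    | cons a U => simp at h1; exact absurd h1.2.2 h2
  intro hG'
  have h3 : pref x m ([] ++ [d]) < prevPos x 1 (suf x m V) := hG'.1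
  rw [pref_concat] at h3
  have h4 := lt_nextPos x m d (pref x m [])
  have h5 := prevPos_spec (x := x) (c := 1) (i := suf x m V) (by omega)
  have := suf_le (x := x) (m := m) V
  have := (hx.first _ (by omega) (by omega)).1 h5.2
  omega

end MCS

namespace MCS

/-! ### Strings as lists, and the reduction to strings with end characters -/

/-- The characters of the list `S` at the positions `1, 2, …`. -/
def chars (S : List ℕ) (k : ℕ) : ℕ := S.getD (k - 1) 0

theorem sublist_drop_iff (S : List ℕ) (Z : List ℕ) :
    ∀ k ≤ S.length, Z.Sublist (S.drop k) ↔ k < suf (chars S) S.length Z := by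
  induction Z with
  | nil => intro k hk; simp; omega
  | cons c Z ih =>
    intro k hk
    induction hn : S.length - k generalizing k with
    | zero =>
      have := suf_cons_le (x := chars S) (m := S.length) c Z
      rw [List.drop_eq_nil_of_le (by omega)]
      simp only [List.sublist_nil, reduceCtorEq, false_iff]
      omega
    | succ n ihn =>
      have hlt : k < S.length := by omega
      have hx : chars S (k + 1) = S[k] := by simp [chars, List.getD_eq_getElem?_getD, hlt]
      rw [List.drop_eq_getElem_cons hlt]
      have ih' := ih (k + 1) (by omega)
      have ihn' := ihn (k + 1) (by omega) (by omega)
      rw [suf_cons, lt_prevPos_iff] at *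
      by_cases hc : S[k] = c
      · rw [hc, List.cons_sublist_cons, ih']
        exact ⟨fun h => ⟨k + 1, by omega, h, by rw [hx, hc]⟩, fun ⟨k', h1, h2, _⟩ => by omega⟩
      · rw [List.sublist_cons_iff]
        have : ¬ ∃ r, c :: Z = S[k] :: r ∧ r.Sublist (S.drop (k + 1)) := by
          rintro ⟨r, h, -⟩
          simp only [List.cons.injEq] at h
          exact hc h.1.symm
        rw [or_iff_left this, ihn']
        refine ⟨fun ⟨k', h1, h2, h3⟩ => ⟨k', by omega, h2, h3⟩,
          fun ⟨k', h1, h2, h3⟩ => ⟨k', lt_of_le_of_ne h1 ?_, h2, h3⟩⟩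
        rintro rfl
        exact hc (hx ▸ h3)

theorem isCommonSubseq_iff {S T U V : List ℕ} :
    IsCommonSubseq S T (U ++ V) ↔ Gap (chars S) (chars T) S.length T.length U V := by
  have h1 := sublist_drop_iff S (U ++ V) 0 (Nat.zero_le _)
  have h2 := sublist_drop_iff T (U ++ V) 0 (Nat.zero_le _)
  rw [List.drop_zero] at h1 h2
  rw [IsCommonSubseq, h1, h2]
  exact gap_append (U := [])

theorem isMCS_iff {S T Z : List ℕ} :
    IsMCS S T Z ↔ Maximal (chars S) (chars T) S.length T.length Z := by
  rw [IsMCS, Maximal]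
  refine and_congr ?_ ?_
  · rw [← isCommonSubseq_iff, List.append_nil]
  · refine ⟨fun h U V hZ d hd => h U V d hZ ?_, fun h U V d hZ hd => h U V hZ d ?_⟩
    · rwa [← isCommonSubseq_iff, ← List.append_cons] at hd
    · rwa [List.append_cons, isCommonSubseq_iff] at hd

theorem isShortestSuffix_iff {S Z : List ℕ} {i : ℕ} :
    IsShortestSuffix S Z i ↔ 1 ≤ i ∧ i = suf (chars S) S.length Z := by
  have hmem : ∀ k, k ∈ {k : ℕ | 1 ≤ k ∧ k ≤ S.length + 1 ∧ Z.Sublist (S.drop (k - 1))} ↔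
      1 ≤ k ∧ k ≤ suf (chars S) S.length Z := by
    intro k
    have := suf_le (x := chars S) (m := S.length) Z
    rw [Set.mem_ofPred_eq]
    constructor
    · rintro ⟨h1, h2, h3⟩
      have := (sublist_drop_iff S Z (k - 1) (by omega)).1 h3
      omega
    · rintro ⟨h1, h2⟩
      exact ⟨h1, by omega, (sublist_drop_iff S Z (k - 1) (by omega)).2 (by omega)⟩
  rw [IsShortestSuffix]
  constructor
  · rintro ⟨h1, h2⟩
    have h3 := (hmem i).1 h1
    exact ⟨h3.1, le_antisymm h3.2 (h2 ((hmem _).2 ⟨by omega, le_rfl⟩))⟩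
  · rintro ⟨h1, rfl⟩
    exact ⟨(hmem _).2 ⟨h1, le_rfl⟩, fun k hk => ((hmem k).1 hk).2⟩

theorem isSuffMatch_iff {S T : List ℕ} {i j : ℕ} :
    IsSuffMatch S T i j ↔ SuffMatch (chars S) (chars T) S.length T.length i j := by
  constructor
  · rintro ⟨Z, hZ, h1, h2⟩
    rw [isShortestSuffix_iff] at h1 h2
    cases Z with
    | nil => exact absurd rfl hZ
    | cons c V => exact ⟨c, V, h1.1, h2.1, h1.2, h2.2⟩
  · rintro ⟨c, V, h1, h2, h3, h4⟩
    exact ⟨c :: V, by simp, isShortestSuffix_iff.2 ⟨h1, h3⟩, isShortestSuffix_iff.2 ⟨h2, h4⟩⟩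

theorem isSuff_sf (S T : List ℕ) (i j : ℕ) :
    IsSuff S T i j (sf (chars S) (chars T) S.length T.length i j) := by
  rw [IsSuff]
  simp only [isSuffMatch_iff]
  exact isLeast_sf ..

variable {X Y S : List ℕ}

theorem encode_bounds {c : ℕ} (h : c ∈ X ++ Y) :
    2 ≤ encode X Y c ∧ encode X Y c < X.length + Y.length + 2 := by
  have := List.idxOf_lt_length_iff.2 h
  rw [List.length_append] at this
  simp only [encode]
  omega

theorem normalForm_length : (normalForm X Y S).length = S.length + 2 := by simp [normalForm]

theorem chars_normalForm_one : chars (normalForm X Y S) 1 = 1 := by simp [chars, normalForm]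

theorem chars_normalForm_mid {k : ℕ} (hk : k < S.length) :
    chars (normalForm X Y S) (k + 2) = encode X Y S[k] := by
  simp [chars, normalForm, List.getD_eq_getElem?_getD, List.getElem?_append, hk]

theorem chars_normalForm_last :
    chars (normalForm X Y S) (S.length + 2) = X.length + Y.length + 2 := by
  simp [chars, normalForm, List.getD_eq_getElem?_getD]

theorem ends_normalForm (hS : S ⊆ X ++ Y) :
    Ends (chars (normalForm X Y S)) (normalForm X Y S).length (X.length + Y.length + 2) := by
  have hmid : ∀ k, k < S.length → 2 ≤ chars (normalForm X Y S) (k + 2) ∧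
      chars (normalForm X Y S) (k + 2) < X.length + Y.length + 2 := by
    intro k hk
    rw [chars_normalForm_mid hk]
    exact encode_bounds (hS (List.getElem_mem hk))
  rw [normalForm_length]
  have hcase : ∀ k, 1 ≤ k → k ≤ S.length + 2 → k = 1 ∨ k = S.length + 2 ∨
      ∃ k', k' < S.length ∧ k = k' + 2 := by
    intro k h1 h2
    by_cases h3 : k = 1
    · exact Or.inl h3
    · by_cases h4 : k = S.length + 2
      · exact Or.inr (Or.inl h4)
      · exact Or.inr (Or.inr ⟨k - 2, by omega, by omega⟩)
  refine ⟨by omega, fun k h1 h2 => ?_, fun k h1 h2 => ?_⟩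
  all_goals
    rcases hcase k h1 h2 with rfl | rfl | ⟨k, hk, rfl⟩
  · simp [chars_normalForm_one]
  · rw [chars_normalForm_last]; omega
  · have := hmid k hk; omega
  · rw [chars_normalForm_one]; omega
  · simp [chars_normalForm_last]
  · have := hmid k hk; omega

/-- The character of the input strings with the given code. -/
def decode (X Y : List ℕ) (u : ℕ) : ℕ := (X ++ Y).getD (u - 2) 0

theorem decode_encode {c : ℕ} (h : c ∈ X ++ Y) : decode X Y (encode X Y c) = c := by
  have := List.idxOf_lt_length_iff.2 h
  rw [decode, encode, Nat.add_sub_cancel, List.getD_eq_getElem _ _ this, List.getElem_idxOf]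

theorem map_decode_map_encode {Z : List ℕ} (h : Z ⊆ X ++ Y) :
    (Z.map (encode X Y)).map (decode X Y) = Z := by
  rw [List.map_map]
  exact (List.map_congr_left fun c hc => decode_encode (h hc)).trans (List.map_id Z)

/-- The normal form of a string over the characters of the input. -/
def wrap (X Y Z : List ℕ) : List ℕ := 1 :: (Z.map (encode X Y) ++ [X.length + Y.length + 2])

theorem one_cons_sublist_normalForm {A : List ℕ} :
    (1 :: (A ++ [X.length + Y.length + 2])).Sublist (normalForm X Y S) ↔
      A.Sublist (S.map (encode X Y)) := by
  rw [normalForm, List.cons_sublist_cons, List.append_sublist_append_right]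

theorem not_cons_wrap_sublist {Z : List ℕ} {d : ℕ} (hS : S ⊆ X ++ Y) :
    ¬ (d :: wrap X Y Z).Sublist (normalForm X Y S) := by
  intro h
  rw [normalForm, List.cons_sublist_cons'] at h
  have h' : (wrap X Y Z).Sublist (S.map (encode X Y) ++ [X.length + Y.length + 2]) :=
    h.elim (fun h => (List.sublist_cons_self _ _).trans h) fun h => h.2
  have h1 : 1 ∈ S.map (encode X Y) ++ [X.length + Y.length + 2] := h'.subset (by simp [wrap])
  simp only [List.mem_append, List.mem_map, List.mem_singleton] at h1
  rcases h1 with ⟨c, hc, h1⟩ | h1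
  · have := encode_bounds (hS hc); omega
  · omega

theorem not_wrap_concat_sublist {Z : List ℕ} {d : ℕ} (hS : S ⊆ X ++ Y) :
    ¬ (wrap X Y Z ++ [d]).Sublist (normalForm X Y S) := by
  intro h
  rw [← List.reverse_sublist] at h
  simp only [normalForm, wrap, List.reverse_append, List.reverse_cons, List.reverse_nil,
    List.nil_append, List.cons_append, List.cons_sublist_cons'] at h
  have h1 : X.length + Y.length + 2 ∈ (S.map (encode X Y)).reverse ++ [1] := by
    rcases h with h | h
    · exact h.subset (by simp)
    · exact h.2.subset (by simp)
  simp only [List.mem_append, List.mem_reverse, List.mem_map, List.mem_singleton] at h1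
  rcases h1 with ⟨c, hc, h1⟩ | h1
  · have := encode_bounds (hS hc); omega
  · omega

/-- The maximal common subsequences of the normal forms are the normal forms of those of the input
strings. -/
theorem isMCS_normalForm_iff {Z : List ℕ} :
    IsMCS (normalForm X Y X) (normalForm X Y Y) Z ↔ ∃ Z₀, IsMCS X Y Z₀ ∧ Z = wrap X Y Z₀ := by
  have hX : X ⊆ X ++ Y := by simp
  have hY : Y ⊆ X ++ Y := by simp
  have hcommon : ∀ A, IsCommonSubseq (normalForm X Y X) (normalForm X Y Y)
      (1 :: (A ++ [X.length + Y.length + 2])) ↔ ∃ Z₀, IsCommonSubseq X Y Z₀ ∧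
        A = Z₀.map (encode X Y) := by
    intro A
    rw [IsCommonSubseq, one_cons_sublist_normalForm, one_cons_sublist_normalForm]
    constructor
    · rintro ⟨h1, h2⟩
      obtain ⟨Z₁, h5, rfl⟩ := List.sublist_map_iff.1 h1
      obtain ⟨Z₂, h6, h3⟩ := List.sublist_map_iff.1 h2
      have h4 := congrArg (List.map (decode X Y)) h3
      rw [map_decode_map_encode fun c hc => hX (h5.subset hc),
        map_decode_map_encode fun c hc => hY (h6.subset hc)] at h4
      exact ⟨Z₁, ⟨h5, h4 ▸ h6⟩, rfl⟩
    · rintro ⟨Z₀, h, rfl⟩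
      exact ⟨h.1.map _, h.2.map _⟩
  constructor
  · intro h
    have hm := isMCS_iff.1 h
    obtain ⟨V, rfl⟩ := hm.exists_cons (ends_normalForm hX) (ends_normalForm hY)
    obtain ⟨U, hU⟩ := hm.exists_concat (ends_normalForm hX) (ends_normalForm hY)
    cases U with
    | nil => simp at hU
    | cons a A =>
      simp only [List.cons_append, List.cons.injEq] at hU
      obtain ⟨rfl, rfl⟩ := hU
      obtain ⟨Z₀, h1, rfl⟩ := (hcommon A).1 h.1
      refine ⟨Z₀, ⟨h1, fun U V c hZ hc => ?_⟩, rfl⟩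
      subst hZ
      have h2 := (hcommon _).2 ⟨_, hc, rfl⟩
      refine h.2 (1 :: U.map (encode X Y)) (V.map (encode X Y) ++ [X.length + Y.length + 2])
        (encode X Y c) (by simp) (by simpa using h2)
  · rintro ⟨Z₀, h, rfl⟩
    refine ⟨(hcommon _).2 ⟨Z₀, h.1, rfl⟩, fun U V d hUV hd => ?_⟩
    rcases U with _ | ⟨a, U⟩
    · rw [List.nil_append] at hUV hd
      subst hUV
      exact not_cons_wrap_sublist hX hd.1
    rcases V.eq_nil_or_concat with rfl | ⟨V, b, rfl⟩
    · rw [List.append_nil] at hUV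
      rw [← hUV] at hd
      exact not_wrap_concat_sublist hX hd.1
    rw [List.concat_eq_append, wrap, List.cons_append, List.cons.injEq, ← List.append_assoc] at hUV
    obtain ⟨rfl, hUV⟩ := hUV
    obtain ⟨hUV', hb⟩ := List.append_inj' hUV rfl
    simp only [List.cons.injEq, and_true] at hb
    subst hb
    clear hUV
    have hd' : IsCommonSubseq (normalForm X Y X) (normalForm X Y Y)
        (1 :: ((U ++ d :: V) ++ [X.length + Y.length + 2])) := by simpa using hd
    obtain ⟨Z₁, h1, h2⟩ := (hcommon _).1 hd'
    obtain ⟨U₁, W₁, rfl, rfl, h3⟩ := List.append_eq_map_iff.1 h2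
    obtain ⟨c, V₁, rfl, rfl, rfl⟩ := List.map_eq_cons_iff.1 h3
    rw [← List.map_append] at hUV'
    have h4 := congrArg (List.map (decode X Y)) hUV'
    rw [map_decode_map_encode fun c hc => hX (h.1.1.subset hc),
      map_decode_map_encode fun c hc => hX (h1.1.subset (by simp at hc ⊢; tauto))] at h4
    exact h.2 U₁ V₁ c h4 h1

end MCS

namespace Enum221

/-! ### Preprocessing: the strings in normal form -/

/-- The machine is large enough for strings of lengths `m` and `l`, in the form with end
characters, over the characters `1, …, σ`. -/
structure Sizes (M W m l σ : ℕ) : Prop where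
  two_le_m : 2 ≤ m
  two_le_l : 2 ≤ l
  sigma : σ + 2 = m + l
  memory : 16 * (m + l + 1) ^ 2 ≤ M
  word : M ≤ W

section

variable {M W m l σ : ℕ}

theorem Sizes.addr (sz : Sizes M W m l σ) {a b c : ℕ} (ha : a ≤ m + l + 1) (hb : b ≤ m + l + 1)
    (hc : c ≤ m + l + 1) : a * b + c < M ∧ a * b + c ≤ W ∧ a * b ≤ W := by
  have h1 : a * b ≤ (m + l + 1) * (m + l + 1) := Nat.mul_le_mul ha hb
  have h2 := sz.memory
  have h3 := sz.word
  have h4 : (m + l + 1) * 1 ≤ (m + l + 1) * (m + l + 1) := Nat.mul_le_mul_left _ (by omega)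
  rw [sq] at h2
  have := sz.two_le_m
  generalize (m + l + 1) * (m + l + 1) = D at *
  omega

theorem Sizes.small (sz : Sizes M W m l σ) : 80 * (m + l + 1) ≤ M ∧ M ≤ W := by
  have h2 := sz.memory
  have h4 : (m + l + 1) * 5 ≤ (m + l + 1) * (m + l + 1) :=
    Nat.mul_le_mul_left _ (by have := sz.two_le_m; have := sz.two_le_l; omega)
  rw [sq] at h2
  exact ⟨by generalize (m + l + 1) * (m + l + 1) = D at *; omega, sz.word⟩

end

/-- The input in memory. -/
structure Input (X Y : List ℕ) (s : State Reg Arr) : Prop where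
  lenX0 : s.reg .lenX0 = X.length
  lenY0 : s.reg .lenY0 = Y.length
  inX : ∀ k, s.arr .inX k = X.getD k 0
  inY : ∀ k, s.arr .inY k = Y.getD k 0

theorem Input.mono {X Y : List ℕ} {s s' : State Reg Arr} (h : Input X Y s)
    (h1 : s'.reg .lenX0 = s.reg .lenX0) (h2 : s'.reg .lenY0 = s.reg .lenY0)
    (h3 : s'.arr .inX = s.arr .inX) (h4 : s'.arr .inY = s.arr .inY) : Input X Y s' :=
  ⟨h1.trans h.lenX0, h2.trans h.lenY0, h3 ▸ h.inX, h4 ▸ h.inY⟩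

theorem Input.frame {X Y : List ℕ} {s s' : State Reg Arr} {c : Cmd Reg Arr} (h : Input X Y s)
    (hF : Frame c s s') (h1 : c.modReg .lenX0 = false := by rfl)
    (h2 : c.modReg .lenY0 = false := by rfl)
    (h3 : c.modArr .inX = false := by rfl) (h4 : c.modArr .inY = false := by rfl) : Input X Y s' :=
  h.mono (hF.reg _ h1) (hF.reg _ h2) (hF.arr _ h3) (hF.arr _ h4)

/-- The constant registers with the sizes of the strings. -/
structure Lens (m l σ : ℕ) (s : State Reg Arr) : Prop where
  reg_m : s.reg .m = m
  reg_l : s.reg .l = l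
  reg_σ : s.reg .σ = σ
  wX : s.reg .wX = m + 1
  wY : s.reg .wY = l + 1

theorem Lens.frame {m l σ : ℕ} {s s' : State Reg Arr} {c : Cmd Reg Arr} (h : Lens m l σ s)
    (hF : Frame c s s') (h1 : c.modReg .m = false := by rfl) (h2 : c.modReg .l = false := by rfl)
    (h3 : c.modReg .σ = false := by rfl) (h4 : c.modReg .wX = false := by rfl)
    (h5 : c.modReg .wY = false := by rfl) : Lens m l σ s' :=
  ⟨(hF.reg _ h1).trans h.reg_m, (hF.reg _ h2).trans h.reg_l, (hF.reg _ h3).trans h.reg_σ,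
    (hF.reg _ h4).trans h.wX, (hF.reg _ h5).trans h.wY⟩

variable {M W m l σ : ℕ} {x y : ℕ → ℕ}

theorem wp_initLengths {X Y : List ℕ} {s : State Reg Arr}
    (sz : Sizes M W (X.length + 2) (Y.length + 2) (X.length + Y.length + 2)) (hs : Input X Y s) :
    wp M W initLengths (fun s' => Lens (X.length + 2) (Y.length + 2) (X.length + Y.length + 2) s' ∧
      s'.time ≤ s.time + 30) s := by
  have h1 := sz.small
  simp [initLengths, v, hs.lenX0, hs.lenY0]
  exact ⟨by omega, by omega, by omega, by omega, by omega,
    ⟨by simp, by simp, by simp, by simp, by simp⟩⟩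

/-- The register `u` after the search for `c` in a string, from the end to the position `k + 1`:
`r` plus the first position of `c` found, plus `1`, or the old value `u`. -/
def firstFrom (S : List ℕ) (c r u k : ℕ) : ℕ :=
  if c ∈ S.drop k then r + k + (S.drop k).idxOf c + 2 else u

theorem firstFrom_step {S : List ℕ} {c r u k : ℕ} (hk : k < S.length) :
    firstFrom S c r u k = if S.getD k 0 = c then r + (k + 1) + 1
      else firstFrom S c r u (k + 1) := by
  rw [firstFrom, firstFrom, List.drop_eq_getElem_cons hk, List.getD_eq_getElem _ _ hk]
  by_cases hc : S[k] = c
  · simp [hc]; omega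
  · have : ¬ c = S[k] := fun h => hc h.symm
    simp only [List.mem_cons, this, false_or, hc, if_false, List.idxOf_cons_ne _ hc]
    split_ifs <;> omega

theorem wp_encodeChar {X Y : List ℕ} {s : State Reg Arr} {c : ℕ}
    (sz : Sizes M W (X.length + 2) (Y.length + 2) (X.length + Y.length + 2)) (hs : Input X Y s)
    (hc : s.reg .c = c) (hmem : c ∈ X ++ Y) :
    wp M W encodeChar (fun s' => s'.reg .u = encode X Y c ∧
      s'.time ≤ s.time + 30 * (X.length + Y.length + 1)) s := by
  have h1 := sz.small
  rw [encodeChar, wp_seq]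
  simp only [v, wp_assign, wp_seq, safe_ofNat, cost_ofNat, val_ofNat]
  refine ⟨by simp, ?_⟩
  refine wp_forDown Y.length (fun k s' => s'.reg .u = firstFrom Y c X.length 0 k ∧
      s'.time + 30 * k ≤ s.time + 10 + 30 * Y.length) trivial (by simp [hs.lenY0])
    (by omega) (by simp [firstFrom]) ?_ ?_
  · rintro k s' hk hF hq ⟨hu, ht⟩
    have e0 := (hs.mono (s' := s.tick 2 |>.setReg .u 0) (by simp) (by simp) rfl rfl).frame hF
    have e2 : s'.reg .c = c := (hF.reg _ (by rfl)).trans (by simp [hc])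
    rw [firstFrom_step (by omega)]
    simp [e0.lenX0, e2, hq, hu, e0.inY]
    grind
  · intro s₁ hF _ ⟨hu, ht⟩
    have e0 := (hs.mono (s' := s.tick 2 |>.setReg .u 0) (by simp) (by simp) rfl rfl).frame hF
    have e2 : s₁.reg .c = c := (hF.reg _ (by rfl)).trans (by simp [hc])
    refine wp_forDown X.length (fun k s' => s'.reg .u =
      firstFrom X c 0 (firstFrom Y c X.length 0 0) k ∧
      s'.time + 30 * k ≤ s.time + 20 + 30 * Y.length + 30 * X.length) trivial (by simp [e0.lenX0])
      (by omega) (by simp [firstFrom] at *; omega) ?_ ?_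
    · rintro k s' hk hF hq ⟨hu, ht⟩
      have e0 := (e0.mono (s' := s₁.tick 4) rfl rfl rfl rfl).frame hF
      have e2 : s'.reg .c = c := (hF.reg _ (by rfl)).trans (by simp [e2])
      rw [firstFrom_step (by omega)]
      simp [e2, hq, hu, e0.inX]
      grind
    · intro s₁ hF _ ⟨hu, ht⟩
      refine ⟨?_, by simp; omega⟩
      simp only [tick_reg, hu, firstFrom, encode, List.drop_zero, List.idxOf_append]
      rw [List.mem_append] at hmem
      split_ifs <;> first | omega | tauto

/-- The codes of the input are in `X` and `Y`. -/
structure Strings (x y : ℕ → ℕ) (m l : ℕ) (s : State Reg Arr) : Prop where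
  X : ∀ k, 1 ≤ k → k ≤ m → s.arr .X k = x k
  Y : ∀ k, 1 ≤ k → k ≤ l → s.arr .Y k = y k

theorem Strings.frame {s s' : State Reg Arr} {c : Cmd Reg Arr} (h : Strings x y m l s)
    (hF : Frame c s s') (h1 : c.modArr .X = false := by rfl) (h2 : c.modArr .Y = false := by rfl) :
    Strings x y m l s' :=
  ⟨hF.arr _ h1 ▸ h.X, hF.arr _ h2 ▸ h.Y⟩

open MCS in
theorem wp_buildStrings {X Y : List ℕ} {s : State Reg Arr}
    (sz : Sizes M W (X.length + 2) (Y.length + 2) (X.length + Y.length + 2)) (hs : Input X Y s)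
    (hL : Lens (X.length + 2) (Y.length + 2) (X.length + Y.length + 2) s) :
    wp M W buildStrings (fun s' => Strings (chars (normalForm X Y X)) (chars (normalForm X Y Y))
      (X.length + 2) (Y.length + 2) s' ∧
      s'.time ≤ s.time + 200 * (X.length + Y.length + 1) ^ 2) s := by
  have h1 := sz.small
  set T := 30 * (X.length + Y.length + 1) with hT
  rw [buildStrings, wp_seq]
  simp only [v, wp_store, wp_seq, safe_ofNat, cost_ofNat, val_ofNat]
  refine ⟨by omega, by omega, by omega, ?_⟩
  refine wp_forUp 1 X.length (fun k s' => s'.arr .X 1 = 1 ∧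
      (∀ j, j < k - 1 → s'.arr .X (j + 2) = chars (normalForm X Y X) (j + 2)) ∧
      s'.time ≤ s.time + k * (T + 40)) (by simp; omega) (by simp) (by omega) (by omega)
    (by simp; omega) ?_ ?_ ?_
  · intro s' hF
    have e0 := (hs.mono (s' := ((s.tick 3).setArr .X 1 1)) rfl rfl (by simp) (by simp)).frame hF
    simp [e0.lenX0]
  · rintro k s' hk hkX hF hp ⟨h1, h2, h3⟩
    have e0 := (hs.mono (s' := ((s.tick 3).setArr .X 1 1)) rfl rfl (by simp) (by simp)).frame hF
    simp [hp, e0.inX]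
    refine ⟨⟨by omega, by omega⟩, ?_⟩
    refine wp_then (wp_encodeChar (c := X[k - 1]) sz (e0.mono (by simp) (by simp) rfl rfl) ?_ ?_) ?_
    · simp; grind
    · simp
    · rintro s'' hF ⟨hu, ht⟩
      have e1 : s''.reg .p = k := (hF.reg _ (by rfl)).trans (by simp [hp])
      have e2 : s''.arr .X = s'.arr .X := (hF.arr _ (by rfl)).trans (by simp)
      simp at ht
      simp [hu, e1, e2]
      have := encode_bounds (X := X) (Y := Y) (c := X[k - 1]) (by simp)
      refine ⟨by omega, by omega, ?_, fun j hj => ?_, ?_⟩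
      · grind
      · by_cases hjk : j + 2 = k + 1
        · obtain rfl : k = j + 1 := by omega
          simp [chars_normalForm_mid (X := X) (Y := Y) (S := X) (k := j) (by omega)]
        · rw [Function.update_of_ne hjk, h2 j (by omega)]
      · rw [add_mul]; omega
  · intro s₁ hF _ ⟨h2, h3, h4⟩
    have e0 := (hs.mono (s' := ((s.tick 3).setArr .X 1 1)) rfl rfl (by simp) (by simp)).frame hF
    have eL : Lens (X.length + 2) (Y.length + 2) (X.length + Y.length + 2) s₁ :=
      Lens.frame (s := (s.tick 3).setArr .X 1 1) ⟨hL.1, hL.2, hL.3, hL.4, hL.5⟩ hF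
    simp only [wp_store, wp_seq]
    simp [eL.reg_m, eL.reg_σ]
    refine ⟨by omega, by omega, by omega, ?_⟩
    set s₂ := (((s₁.tick 4).tick 3).setArr .X (X.length + 2) (X.length + Y.length + 2)).tick 3
      |>.setArr .Y 1 1 with hs₂
    have hX : ∀ k, 1 ≤ k → k ≤ X.length + 2 → s₂.arr .X k = chars (normalForm X Y X) k := by
      intro k hk1 hk2
      simp only [hs₂, setArr_arr, tick_arr]
      simp
      by_cases hk3 : k = X.length + 2
      · subst hk3; simp [chars_normalForm_last]
      · rw [Function.update_of_ne hk3]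
        obtain rfl | ⟨k, rfl⟩ : k = 1 ∨ ∃ k', k = k' + 2 := by
          by_cases h : k = 1
          · exact Or.inl h
          · exact Or.inr ⟨k - 2, by omega⟩
        · rw [h2, chars_normalForm_one]
        · exact h3 k (by omega)
    have ht₂ : s₂.time = s₁.time + 10 := by rw [hs₂]; simp
    have hY1 : s₂.arr .Y 1 = 1 := by simp [hs₂]
    have e0 : Input X Y s₂ := e0.mono rfl rfl (by simp [hs₂]) (by simp [hs₂])
    have eL : Lens (X.length + 2) (Y.length + 2) (X.length + Y.length + 2) s₂ :=
      ⟨eL.1, eL.2, eL.3, eL.4, eL.5⟩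
    clear_value s₂
    refine wp_forUp 1 Y.length (fun k s' => s'.arr .Y 1 = 1 ∧
      (∀ j, j < k - 1 → s'.arr .Y (j + 2) = chars (normalForm X Y Y) (j + 2)) ∧
      s'.time ≤ s₂.time + k * (T + 40)) (by simp; omega) (by simp) (by omega) (by omega)
      (by simp [hY1]) ?_ ?_ ?_
    · intro s' hF
      have e0 := e0.frame hF
      simp [e0.lenY0]
    · rintro k s' hk hkX hF hp ⟨h1, h2, h3⟩
      have e0 := e0.frame hF
      simp [hp, e0.inY]
      refine ⟨⟨by omega, by omega⟩, ?_⟩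
      refine wp_then (wp_encodeChar (c := Y[k - 1]) sz (e0.mono (by simp) (by simp) rfl rfl) ?_ ?_)
        ?_
      · simp; grind
      · simp
      · rintro s'' hF ⟨hu, ht⟩
        have e1 : s''.reg .p = k := (hF.reg _ (by rfl)).trans (by simp [hp])
        have e2 : s''.arr .Y = s'.arr .Y := (hF.arr _ (by rfl)).trans (by simp)
        simp at ht
        simp [hu, e1, e2]
        have := encode_bounds (X := X) (Y := Y) (c := Y[k - 1]) (by simp)
        refine ⟨by omega, by omega, ?_, fun j hj => ?_, ?_⟩
        · grind
        · by_cases hjk : j + 2 = k + 1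
          · obtain rfl : k = j + 1 := by omega
            simp [chars_normalForm_mid (X := X) (Y := Y) (S := Y) (k := j) (by omega)]
          · rw [Function.update_of_ne hjk, h2 j (by omega)]
        · rw [add_mul]; omega
    · intro s₃ hF₃ _ ⟨h5, h6, h7⟩
      have eL := eL.frame hF₃
      simp [eL.reg_l, eL.reg_σ]
      refine ⟨by omega, ⟨fun k hk1 hk2 => ?_, fun k hk1 hk2 => ?_⟩, ?_⟩
      · simp [hF₃.arr .X (by rfl), hX k hk1 hk2]
      · simp
        by_cases hk3 : k = Y.length + 2
        · subst hk3; simp [chars_normalForm_last]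
        · rw [Function.update_of_ne hk3]
          obtain rfl | ⟨k, rfl⟩ : k = 1 ∨ ∃ k', k = k' + 2 := by
            by_cases h : k = 1
            · exact Or.inl h
            · exact Or.inr ⟨k - 2, by omega⟩
          · rw [h5, chars_normalForm_one]
          · exact h6 k (by omega)
      · rw [hT] at h4 h7
        nlinarith

/-! ### Preprocessing: the tables of `next` and `prev` -/

/-- The tables for the string `x 1, …, x m`. -/
structure Table (x : ℕ → ℕ) (m σ : ℕ) (next prev : Arr) (s : State Reg Arr) : Prop where
  next : ∀ c h, 1 ≤ c → c ≤ σ → 1 ≤ h → h ≤ m →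
    s.arr next (c * (m + 1) + h) = MCS.nextPos x m c h
  prev : ∀ c h, 1 ≤ c → c ≤ σ → 1 ≤ h → h ≤ m →
    s.arr prev (c * (m + 1) + h) = MCS.prevPos x c h

theorem Table.frame {next prev : Arr} {s s' : State Reg Arr} {c : Cmd Reg Arr}
    (h : Table x m σ next prev s) (hF : Frame c s s') (h1 : c.modArr next = false := by rfl)
    (h2 : c.modArr prev = false := by rfl) : Table x m σ next prev s' :=
  ⟨hF.arr _ h1 ▸ h.next, hF.arr _ h2 ▸ h.prev⟩

theorem row_inj {w c h c' h' : ℕ} (h1 : h < w) (h2 : h' < w) :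
    c * w + h = c' * w + h' ↔ c = c' ∧ h = h' := by
  constructor
  · intro he
    have hc : c = c' := by
      have := congrArg (· / w) he
      simpa [Nat.add_div_of_dvd_right, Nat.mul_div_cancel _ (by omega : 0 < w), Nat.mul_add_div,
        mul_comm _ w, Nat.div_eq_of_lt h1, Nat.div_eq_of_lt h2, (by omega : 0 < w)] using this
    subst hc
    exact ⟨rfl, by omega⟩
  · rintro ⟨rfl, rfl⟩; rfl

theorem wp_buildTable {S next prev : Arr} {lenS w : Reg} {z : ℕ → ℕ} {n : ℕ} {s : State Reg Arr}
    (hcase : (S = .X ∧ next = .nextX ∧ prev = .prevX ∧ lenS = .m ∧ w = .wX) ∨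
      (S = .Y ∧ next = .nextY ∧ prev = .prevY ∧ lenS = .l ∧ w = .wY))
    (sz : Sizes M W m l σ) (hn : s.reg lenS = n) (hw : s.reg w = n + 1) (hσ : s.reg .σ = σ)
    (hS : ∀ k, 1 ≤ k → k ≤ n → s.arr S k = z k) (hnm : n ≤ m + l) :
    wp M W (buildTable S next prev lenS w) (fun s' => Table z n σ next prev s' ∧
      s'.time ≤ s.time + 60 * ((σ + 1) * (n + 1))) s := by
  have h1 := sz.small
  have h2 := sz.sigma
  set B := 60 * (n + 1) with hB
  -- what holds for both instances holds in general
  have both : ∀ {P : Arr → Arr → Arr → Reg → Reg → Prop}, P .X .nextX .prevX .m .wX →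
      P .Y .nextY .prevY .l .wY → P S next prev lenS w := by
    rcases hcase with ⟨rfl, rfl, rfl, rfl, rfl⟩ | ⟨rfl, rfl, rfl, rfl, rfl⟩
    exacts [fun h _ => h, fun _ h => h]
  obtain ⟨hwt, hlt, hSn⟩ : (w ≠ .t ∧ w ≠ .h) ∧ (lenS ≠ .t ∧ lenS ≠ .h) ∧
      S ≠ next ∧ S ≠ prev ∧ next ≠ prev := by
    rcases hcase with ⟨rfl, rfl, rfl, rfl, rfl⟩ | ⟨rfl, rfl, rfl, rfl, rfl⟩ <;> decide
  rw [buildTable]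
  refine wp_forUp 1 σ (fun c s' => Table z n (c - 1) next prev s' ∧
    s'.time ≤ s.time + 10 + (c - 1) * B) (by simp; omega) (by simp) (by omega) (by omega)
    ⟨⟨fun c h _ _ => by omega, fun c h _ _ => by omega⟩, by simp⟩ ?_ ?_ ?_
  · intro s' hF
    simp [v, hF.reg .σ (by apply both <;> rfl), hσ]
  · rintro c s' hc1 hcσ hF hc ⟨hT, ht⟩
    have en := (hF.reg lenS (by apply both <;> rfl)).trans hn
    have ew := (hF.reg w (by apply both <;> rfl)).trans hw
    have eS := hF.arr S (by apply both <;> rfl) ▸ hS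
    simp only [v, wp_seq, wp_assign]
    simp only [tick_reg, val_add, val_reg, val_ofNat, en, safe_add, safe_reg, safe_ofNat]
    refine ⟨⟨trivial, by omega, by omega⟩, ?_⟩
    refine wp_forDown n (fun k s'' => s''.reg .t = MCS.nextPos z n c k ∧
      (∀ c' h, 1 ≤ c' → c' ≤ c → 1 ≤ h → h ≤ n → (c' < c ∨ k < h) →
        s''.arr next (c' * (n + 1) + h) = MCS.nextPos z n c' h) ∧
      s''.time + 30 * k ≤ s'.time + 20 + 30 * n) trivial (by simp [en, hlt]) (by omega) ?_ ?_ ?_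
    · refine ⟨by simp [MCS.nextPos_top], ?_, by simp⟩
      intro c' h h3 h4 h5 h6 h7
      exact hT.next c' h h3 (by omega) h5 h6
    · rintro k s₁ hk hF₁ hh ⟨h3, h4, h5⟩
      have ew₁ := (hF₁.reg w (by apply both <;> rfl)).trans (by simpa [hwt] using ew)
      have ec₁ : s₁.reg .c = c := (hF₁.reg .c (by apply both <;> rfl)).trans hc
      have eS₁ := (congrFun (hF₁.arr S (by apply both <;> rfl)) (k + 1)).trans (eS _ (by omega) hk)
      have ha := sz.addr (a := c) (b := n + 1) (c := k + 1) (by omega) (by omega) (by omega)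
      have hupd : ∀ c' h, 1 ≤ c' → c' ≤ c → 1 ≤ h → h ≤ n → (c' < c ∨ k < h) →
          Function.update (s₁.arr next) (c * (n + 1) + (k + 1)) (MCS.nextPos z n c (k + 1))
            (c' * (n + 1) + h) = MCS.nextPos z n c' h := by
        intro c' h h6 h7 h8 h9 h10
        rw [Function.update_apply]
        split_ifs with he
        · rw [row_inj (by omega) (by omega)] at he
          rw [he.1, he.2]
        · refine h4 c' h h6 h7 h8 h9 ?_
          by_contra hne
          exact he (by rw [(by omega : c' = c), (by omega : h = k + 1)])
      simp [ew₁, ec₁, hh, eS₁, h3, hSn]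
      exact ⟨⟨by omega, by omega⟩, by omega, by omega,
        fun hz => ⟨by rw [MCS.nextPos_step hk, if_pos hz], hupd, by omega⟩,
        fun hz => ⟨by rw [MCS.nextPos_step hk, if_neg hz], hupd, by omega⟩⟩
    · rintro s₁ hF₁ - ⟨-, h4, h5⟩
      have en₁ := (hF₁.reg lenS (by apply both <;> rfl)).trans (by simpa [hlt] using en)
      have ew₁ := (hF₁.reg w (by apply both <;> rfl)).trans (by simpa [hwt] using ew)
      have ec₁ : s₁.reg .c = c := (hF₁.reg .c (by apply both <;> rfl)).trans hc
      have eS₁ := hF₁.arr S (by apply both <;> rfl) ▸ eS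
      have eP := hF₁.arr prev (by apply both <;> rfl) ▸ hT.prev
      refine ⟨by simp, ?_⟩
      refine wp_forUp 1 n (fun k s'' => s''.reg .t = MCS.prevPos z c k ∧
        (∀ c' h, 1 ≤ c' → c' ≤ c → 1 ≤ h → h ≤ n → (c' < c ∨ h < k) →
          s''.arr prev (c' * (n + 1) + h) = MCS.prevPos z c' h) ∧
        s''.time ≤ s₁.time + 30 * k) (by simp; omega) (by simp) (by omega) (by omega) ?_ ?_ ?_ ?_
      · refine ⟨by simp [MCS.prevPos], ?_, by simp⟩
        intro c' h h3 h6 h7 h8 h9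
        exact eP c' h h3 (by omega) h7 h8
      · intro s₂ hF₂
        simp [hF₂.reg lenS (by apply both <;> rfl), hlt, en₁]
      · rintro k s₂ hk1 hk hF₂ hh ⟨h3, h6, h7⟩
        have ew₂ := (hF₂.reg w (by apply both <;> rfl)).trans (by simpa [hwt] using ew₁)
        have ec₂ : s₂.reg .c = c := (hF₂.reg .c (by apply both <;> rfl)).trans ec₁
        have eS₂ := (congrFun (hF₂.arr S (by apply both <;> rfl)) k).trans (eS₁ _ hk1 hk)
        have ha := sz.addr (a := c) (b := n + 1) (c := k) (by omega) (by omega) (by omega)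
        have hupd : ∀ c' h, 1 ≤ c' → c' ≤ c → 1 ≤ h → h ≤ n → (c' < c ∨ h ≤ k) →
            Function.update (s₂.arr prev) (c * (n + 1) + k) (MCS.prevPos z c k)
              (c' * (n + 1) + h) = MCS.prevPos z c' h := by
          intro c' h h6' h7 h8 h9 h10
          rw [Function.update_apply]
          split_ifs with he
          · rw [row_inj (by omega) (by omega)] at he
            rw [he.1, he.2]
          · refine h6 c' h h6' h7 h8 h9 ?_
            by_contra hne
            exact he (by rw [(by omega : c' = c), (by omega : h = k)])
        simp [ew₂, ec₂, hh, eS₂, h3, hSn]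
        exact ⟨⟨by omega, by omega⟩, by omega, by omega,
          fun hz => ⟨by rw [MCS.prevPos, if_pos hz], hupd, by omega⟩,
          fun hz => ⟨by rw [MCS.prevPos, if_neg hz], hupd, by omega⟩⟩
      · rintro s₂ hF₂ - ⟨-, h6, h7⟩
        have ec₂ := (hF₂.reg .c (by apply both <;> rfl)).trans ec₁
        have eN := hF₂.arr next (by apply both <;> rfl)
        refine ⟨ec₂, ⟨fun c' h h8 h9 h10 h11 => ?_, fun c' h h8 h9 h10 h11 => ?_⟩, ?_⟩
        · simp only [setReg_arr, tick_arr, eN]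
          exact h4 c' h h8 (by omega) h10 h11 (Or.inr h10)
        · exact h6 c' h h8 (by omega) h10 h11 (Or.inr (by omega))
        · have : c * B = (c - 1) * B + B := by
            obtain ⟨c, rfl⟩ : ∃ c', c = c' + 1 := ⟨c - 1, by omega⟩
            rw [Nat.add_sub_cancel, add_mul, one_mul]
          simp
          omega
  · rintro s' hF - ⟨hT, ht⟩
    refine ⟨⟨hT.next, hT.prev⟩, ?_⟩
    have : 60 * ((σ + 1) * (n + 1)) = σ * B + B := by rw [hB]; ring
    have hv : (v .σ).cost = 1 := rfl
    rw [Nat.add_sub_cancel] at ht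
    simp only [tick_time, hv]
    omega

end Enum221

namespace Enum221

variable {M W m l σ : ℕ} {x y : ℕ → ℕ}

/-! ### Preprocessing: the sequences `Suff_i` -/

/-- The rows `i ≥ i₀` of the table of `Suff` are filled. -/
def SuffRows (x y : ℕ → ℕ) (m l i₀ : ℕ) (s : State Reg Arr) : Prop :=
  ∀ i j, i₀ ≤ i → i ≤ m → 1 ≤ j → j ≤ l → s.arr .suff (i * (l + 1) + j) = MCS.sf x y m l i j

theorem SuffRows.frame {s s' : State Reg Arr} {c : Cmd Reg Arr} {i₀ : ℕ}
    (h : SuffRows x y m l i₀ s) (hF : Frame c s s') (h1 : c.modArr .suff = false := by rfl) :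
    SuffRows x y m l i₀ s' := by
  unfold SuffRows; rw [hF.arr _ h1]; exact h

theorem wp_initSuff {s : State Reg Arr} (sz : Sizes M W m l σ) (hL : Lens m l σ s)
    (hx : MCS.Ends x m σ) (hy : MCS.Ends y l σ) :
    wp M W initSuff (fun s' => SuffRows x y m l m s' ∧ s'.time ≤ s.time + 40 * (l + 1)) s := by
  have h1 := sz.small
  rw [initSuff, wp_seq]
  refine wp_forUp 1 l (fun k s' => (∀ j, 1 ≤ j → j < k → s'.arr .suff (m * (l + 1) + j) = m + 1) ∧
    s'.time ≤ s.time + 20 * k) (by simp; omega) (by simp) (by omega) (by omega)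
    ⟨by omega, by simp⟩ ?_ ?_ ?_
  · intro s' hF
    simp [v, (hL.frame hF).reg_l]
  · rintro k s' hk1 hk hF hj ⟨h2, h3⟩
    have eL := hL.frame hF
    have ha := sz.addr (a := m) (b := l + 1) (c := k) (by omega) (by omega) (by omega)
    simp [v, eL.reg_m, eL.wY, hj]
    refine ⟨⟨by omega, by omega⟩, ⟨by omega, by omega⟩, by omega, fun j hj1 hj2 => ?_, by omega⟩
    rw [Function.update_apply]
    split_ifs with he
    · rfl
    · exact h2 j hj1 (by omega)
  · rintro s' hF - ⟨h2, h3⟩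
    have eL := hL.frame hF
    have ha := sz.addr (a := m) (b := l + 1) (c := l) (by omega) (by omega) (by omega)
    simp [v, eL.reg_m, eL.reg_l, eL.wY]
    refine ⟨by omega, by omega, ?_, by omega⟩
    intro i j hi him hj hjl
    obtain rfl : i = m := by omega
    rw [MCS.sf_top hx hy]
    simp only [setArr_arr, tick_arr, if_true, Function.update_apply, Nat.add_left_cancel_iff]
    split_ifs with he
    · rfl
    · exact h2 j hj (by omega)

theorem wp_updateSuff {s : State Reg Arr} {i : ℕ} (sz : Sizes M W m l σ) (hL : Lens m l σ s)
    (hS : Strings x y m l s) (hTx : Table x m σ .nextX .prevX s) (hTy : Table y l σ .nextY .prevY s)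
    (hR : SuffRows x y m l (i + 1) s) (hi : s.reg .i = i) (hi1 : 1 ≤ i) (him : i < m)
    (hx : MCS.Ends x m σ) (hy : MCS.Ends y l σ) (hxσ : ∀ k, 1 ≤ k → k ≤ m → 1 ≤ x k ∧ x k ≤ σ) :
    wp M W updateSuff (fun s' => SuffRows x y m l i s' ∧ s'.time ≤ s.time + 150 * (l + 1)) s := by
  have h1 := sz.small
  have h2 := sz.sigma
  have hc := hxσ i hi1 him.le
  rw [updateSuff, wp_seq]
  refine wp_forUp 1 l (fun k s' => SuffRows x y m l (i + 1) s' ∧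
    (∀ j, 1 ≤ j → j < k → s'.arr .suff (i * (l + 1) + j) = MCS.sf x y m l (i + 1) j) ∧
    s'.time ≤ s.time + 40 * k) (by simp; omega) (by simp) (by omega) (by omega)
    ⟨hR, by omega, by simp⟩ ?_ ?_ ?_
  · intro s' hF
    simp [v, (hL.frame hF).reg_l]
  · rintro k s' hk1 hk hF hj ⟨h3, h4, h5⟩
    have eL := hL.frame hF
    have ei := (hF.reg .i rfl).trans hi
    have ha := sz.addr (a := i) (b := l + 1) (c := k) (by omega) (by omega) (by omega)
    have hb := sz.addr (a := i + 1) (b := l + 1) (c := k) (by omega) (by omega) (by omega)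
    simp [v, ei, eL.wY, hj]
    refine ⟨by omega, by omega, by omega, ?_, fun j hj1 hj2 => ?_, by omega⟩
    · intro i' j hi' him' hj1 hjl
      simp only [setArr_arr, setReg_arr, tick_arr, if_true]
      rw [Function.update_of_ne, h3 i' j hi' him' hj1 hjl]
      rw [Ne, row_inj (by omega) (by omega)]
      omega
    · rw [Function.update_apply]
      split_ifs with he
      · obtain rfl : j = k := by omega
        exact h3 _ _ le_rfl him hj1 (by omega)
      · exact h4 j hj1 (by omega)
  · rintro s₁ hF₁ - ⟨h3, h4, h5⟩
    have eL := hL.frame hF₁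
    have eS := hS.frame hF₁
    have ei := (hF₁.reg .i rfl).trans hi
    have ex := eS.X i hi1 him.le
    simp only [v, wp_seq, wp_assign]
    simp only [tick_reg, tick_arr, val_get, val_reg, ei, ex, safe_get, safe_reg]
    refine ⟨⟨trivial, by omega⟩, ?_⟩
    obtain ⟨Upd, hUpd⟩ : ∃ Upd : ℕ → ℕ → Prop, ∀ k u, Upd k u ↔ ∃ j, 1 ≤ j ∧ j < k ∧
        MCS.sf x y m l (i + 1) j ≠ m + 1 ∧ MCS.prevPos y (x i) j = u ∧
        MCS.prevPos x (x i) (MCS.sf x y m l (i + 1) j) = i := ⟨_, fun _ _ => Iff.rfl⟩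
    refine wp_forUp 1 l (fun k s' => SuffRows x y m l (i + 1) s' ∧
      (∀ u, 1 ≤ u → u ≤ l → (Upd k u → s'.arr .suff (i * (l + 1) + u) = i) ∧
        (¬ Upd k u → s'.arr .suff (i * (l + 1) + u) = MCS.sf x y m l (i + 1) u)) ∧
      s'.time ≤ s₁.time + 20 + 70 * k) (by simp; omega) (by simp) (by omega) (by omega)
      ⟨h3, fun u hu1 hul => ⟨fun h => by obtain ⟨j, h6, h7, _⟩ := (hUpd _ _).1 h; omega,
        fun _ => h4 u hu1 (by omega)⟩,
        by simp⟩ ?_ ?_ ?_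
    · intro s' hF
      simp [(hF.reg .l rfl), eL.reg_l]
    · rintro k s' hk1 hk hF hj ⟨h6, h7, h8⟩
      have el : s'.reg .m = m := (hF.reg .m rfl).trans eL.reg_m
      have ewX : s'.reg .wX = m + 1 := (hF.reg .wX rfl).trans eL.wX
      have ewY : s'.reg .wY = l + 1 := (hF.reg .wY rfl).trans eL.wY
      have ei : s'.reg .i = i := (hF.reg .i rfl).trans ei
      have ec : s'.reg .c = x i := (hF.reg .c rfl).trans (by simp)
      have eY : s'.arr .prevY (x i * (l + 1) + k) = MCS.prevPos y (x i) k :=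
        (congrFun ((hF.arr .prevY rfl).trans (hF₁.arr .prevY rfl)) _).trans
          (hTy.prev _ _ hc.1 hc.2 hk1 hk)
      have eX : ∀ h, 1 ≤ h → h ≤ m → s'.arr .prevX (x i * (m + 1) + h) = MCS.prevPos x (x i) h :=
        fun h hh1 hh2 => (congrFun ((hF.arr .prevX rfl).trans (hF₁.arr .prevX rfl)) _).trans
          (hTx.prev _ _ hc.1 hc.2 hh1 hh2)
      have ha := sz.addr (a := i + 1) (b := l + 1) (c := k) (by omega) (by omega) (by omega)
      have hb := sz.addr (a := x i) (b := l + 1) (c := k) (by omega) (by omega) (by omega)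
      have eT := h6 (i + 1) k le_rfl him hk1 hk
      have hsf := MCS.sf_le_succ (x := x) (y := y) (m := m) (l := l) (i + 1) k
      have hpv := MCS.prevPos_le y (x i) k
      set t := MCS.sf x y m l (i + 1) k with ht
      set u := MCS.prevPos y (x i) k with hu
      have hcc := sz.addr (a := x i) (b := m + 1) (c := t) (by omega) (by omega) (by omega)
      have hd := sz.addr (a := i) (b := l + 1) (c := u) (by omega) (by omega) (by omega)
      simp [ei, ewY, ewX, hj, el, ec, eY, eT]
      have hstep : ∀ u', Upd (k + 1) u' ↔ Upd k u' ∨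
          (t ≠ m + 1 ∧ u = u' ∧ MCS.prevPos x (x i) t = i) := by
        intro u'
        rw [hUpd, hUpd]
        constructor
        · rintro ⟨j, h9, h10, h11⟩
          rcases Nat.lt_succ_iff_lt_or_eq.1 h10 with h | rfl
          · exact Or.inl ⟨j, h9, h, h11⟩
          · exact Or.inr h11
        · rintro (⟨j, h9, h10, h11⟩ | h)
          · exact ⟨j, h9, by omega, h11⟩
          · exact ⟨k, hk1, by omega, h⟩
      have htm : t ≠ m + 1 → s'.arr .prevX (x i * (m + 1) + t) = MCS.prevPos x (x i) t := by
        intro h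
        have h' := (MCS.sf_spec (by omega : MCS.sf x y m l (i + 1) k ≤ m)).1
        exact eX t (by omega) (by omega)
      refine ⟨⟨⟨⟨by omega, by omega⟩, by omega⟩, by omega⟩, ⟨by omega, by omega⟩, by omega,
        fun hne hu1 => ⟨by omega, fun hp => ⟨by omega, by omega, ?_, ?_, by omega⟩,
          fun hp => ⟨h6, ?_, by omega⟩⟩, fun hne => ⟨h6, ?_, by omega⟩⟩
      · intro i' j hi' him' hj1 hjl
        simp only [setArr_arr, setReg_arr, tick_arr, if_true]
        rw [Function.update_of_ne, h6 i' j hi' him' hj1 hjl]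
        rw [Ne, row_inj (by omega) (by omega)]
        omega
      · intro u' hu1' hul'
        simp only [hstep, Function.update_apply, Nat.add_left_cancel_iff]
        rw [htm hne] at hp
        have := h7 u' hu1' hul'
        grind
      · intro u' hu1' hul'
        rw [hstep]
        rw [htm hne] at hp
        have := h7 u' hu1' hul'
        grind
      · intro u' hu1' hul'
        rw [hstep]
        have := h7 u' hu1' hul'
        grind
    · rintro s₂ hF₂ - ⟨h6, h7, h8⟩
      refine ⟨?_, by simp; omega⟩
      intro i' j hi' him' hj1 hjl
      simp only [tick_arr]
      rcases Nat.eq_or_lt_of_le hi' with rfl | hlt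
      · have h9 := MCS.sf_step hx hy (u := j) hi1 him hj1
        have h10 := h7 j hj1 hjl
        rw [hUpd] at h10
        simp only [Nat.lt_succ_iff] at h10
        by_cases he : ∃ k, 1 ≤ k ∧ k ≤ l ∧ MCS.sf x y m l (i + 1) k ≠ m + 1 ∧
          MCS.prevPos y (x i) k = j ∧ MCS.prevPos x (x i) (MCS.sf x y m l (i + 1) k) = i
        · rw [h10.1 he, h9.1 he]
        · rw [h10.2 he, h9.2 he]
      · exact h6 i' j hlt him' hj1 hjl

end Enum221

/-! ### Range minimum queries: combinatorics -/

namespace RMQ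

/-- `k` is the leftmost position of the minimum of `S` on the interval from `a` to `c`. -/
structure LeftMin (S : ℕ → ℕ) (a c k : ℕ) : Prop where
  le : a ≤ k
  le' : k ≤ c
  left : ∀ p, a ≤ p → p < k → S k < S p
  right : ∀ p, k < p → p ≤ c → S k ≤ S p

theorem LeftMin.congr {S S' : ℕ → ℕ} {a c k : ℕ} (h : LeftMin S a c k)
    (hS : ∀ j, a ≤ j → j ≤ c → S' j = S j) : LeftMin S' a c k := by
  have h1 := h.le
  have h2 := h.le'
  refine ⟨h1, h2, fun p h3 h4 => ?_, fun p h3 h4 => ?_⟩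
  · rw [hS p h3 (by omega), hS k h1 h2]
    exact h.left p h3 h4
  · rw [hS p (by omega) h4, hS k h1 h2]
    exact h.right p h3 h4

theorem LeftMin.isRMQ {S : ℕ → ℕ} {a c k : ℕ} (h : LeftMin S a c k) : IsRMQ S a c k := by
  refine ⟨⟨h.le, h.le', h.left⟩, fun k' ⟨h1, h2, h3⟩ => ?_⟩
  by_contra hlt
  have := h.right k' (not_le.1 hlt) h2
  have := h3 k h.le (not_le.1 hlt)
  omega

theorem LeftMin.self (S : ℕ → ℕ) (a : ℕ) : LeftMin S a a a :=
  ⟨le_rfl, le_rfl, fun _ _ _ => by omega, fun _ _ _ => by omega⟩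

/-- The combination of the minima of two intervals that touch or overlap. -/
theorem LeftMin.combine {S : ℕ → ℕ} {a c a' c' k k' : ℕ} (h : LeftMin S a c k)
    (h' : LeftMin S a' c' k') (h1 : a ≤ a') (h2 : a' ≤ c + 1) (h3 : c ≤ c') :
    LeftMin S a c' (if S k' < S k then k' else k) := by
  have hk := h.le; have hk' := h.le'; have hl := h'.le; have hl' := h'.le'
  have hmin : ∀ p, a ≤ p → p ≤ c → S k ≤ S p := by
    intro p hp1 hp2
    rcases lt_trichotomy p k with hlt | rfl | hlt
    · exact (h.left p hp1 hlt).le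
    · exact le_rfl
    · exact h.right p hlt hp2
  have hmin' : ∀ p, a' ≤ p → p ≤ c' → S k' ≤ S p := by
    intro p hp1 hp2
    rcases lt_trichotomy p k' with hlt | rfl | hlt
    · exact (h'.left p hp1 hlt).le
    · exact le_rfl
    · exact h'.right p hlt hp2
  split_ifs with hlt
  · refine ⟨by omega, by omega, fun p hp1 hp2 => ?_, fun p hp1 hp2 => hmin' p (by omega) hp2⟩
    by_cases hp : p ≤ c
    · exact hlt.trans_le (hmin p hp1 hp)
    · exact h'.left p (by omega) hp2
  · refine ⟨by omega, by omega, h.left, fun p hp1 hp2 => ?_⟩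
    by_cases hp : p ≤ c
    · exact hmin p (by omega) hp
    · exact (not_lt.1 hlt).trans (hmin' p (by omega) hp2)

/-- The positions of the set bits of a bit mask below the bit `a` are removed by a division, and the
lowest remaining set bit becomes the `2`-adic valuation of the quotient. -/
theorem sum_two_pow_div (E : Finset ℕ) {a e₀ : ℕ} (he₀ : e₀ ∈ E) (ha : a ≤ e₀)
    (hmin : ∀ e ∈ E, a ≤ e → e₀ ≤ e) :
    ∃ r, (∑ e ∈ E, 2 ^ e) / 2 ^ a = 2 ^ (e₀ - a) * (2 * r + 1) := by
  have h1 : ∑ e ∈ E with e < a, 2 ^ e < 2 ^ a :=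
    Nat.geomSum_lt le_rfl fun k hk => (Finset.mem_filter.1 hk).2
  refine ⟨∑ e ∈ (E.filter fun e => ¬ e < a).erase e₀, 2 ^ (e - e₀ - 1), ?_⟩
  have hmem : e₀ ∈ E.filter fun e => ¬ e < a := Finset.mem_filter.2 ⟨he₀, by omega⟩
  have h2 : ∑ e ∈ E with ¬ e < a, 2 ^ e = 2 ^ a * (2 ^ (e₀ - a) *
      (2 * ∑ e ∈ (E.filter fun e => ¬ e < a).erase e₀, 2 ^ (e - e₀ - 1) + 1)) := by
    rw [← Finset.add_sum_erase _ _ hmem, ← mul_assoc, ← pow_add, Nat.add_sub_cancel' ha, mul_add,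
      mul_one, add_comm, Finset.mul_sum, Finset.mul_sum]
    congr 1
    refine Finset.sum_congr rfl fun e he => ?_
    rw [Finset.mem_erase, Finset.mem_filter] at he
    have := hmin e he.2.1 (not_lt.1 he.2.2)
    have : e₀ < e := by omega
    rw [← mul_assoc, ← pow_succ, ← pow_add]
    congr 1
    omega
  rw [← Finset.sum_filter_add_sum_filter_not E (fun e => e < a), h2,
    Nat.add_mul_div_left _ _ (by positivity), Nat.div_eq_of_lt h1, zero_add]

/-- The stack and the bit mask after the positions `B + 1, …, n` of a block: the stack has the
positions of the suffix minima (ties included) in ascending order, and the mask has their offsets in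
the block. -/
structure StackInv (S : ℕ → ℕ) (B n b cur sp : ℕ) (st : ℕ → ℕ) : Prop where
  mono : ∀ a a', a < a' → a' < sp → st a < st a'
  mem : ∀ j, (∃ a < sp, st a = j) ↔ B < j ∧ j ≤ n ∧ ∀ q, j < q → q ≤ n → S j ≤ S q
  cur : cur = ∑ a ∈ Finset.range sp, 2 ^ ((st a - 1) % b)

variable {S st : ℕ → ℕ} {B n b cur sp : ℕ}

theorem StackInv.nil : StackInv S B B b 0 0 st :=
  ⟨fun _ _ _ h => absurd h (Nat.not_lt_zero _), fun j => by
    constructor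
    · rintro ⟨a, h, -⟩; omega
    · rintro ⟨h1, h2, -⟩; omega, by simp⟩

theorem StackInv.val_mono (h : StackInv S B n b cur sp st) {a a' : ℕ} (h1 : a ≤ a')
    (h2 : a' < sp) : S (st a) ≤ S (st a') := by
  rcases h1.eq_or_lt with rfl | h1
  · exact le_rfl
  · have h3 := (h.mem (st a)).1 ⟨a, by omega, rfl⟩
    have h4 := (h.mem (st a')).1 ⟨a', h2, rfl⟩
    exact h3.2.2 _ (h.mono a a' h1 h2) h4.2.1

theorem StackInv.push (h : StackInv S B n b cur sp st) {sp' cur' : ℕ} (hBn : B ≤ n)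
    (hsp : sp' ≤ sp) (hpop : ∀ a, sp' ≤ a → a < sp → S (n + 1) < S (st a))
    (htop : 0 < sp' → S (st (sp' - 1)) ≤ S (n + 1))
    (hcur : cur' = ∑ a ∈ Finset.range sp', 2 ^ ((st a - 1) % b)) :
    StackInv S B (n + 1) b (cur' + 2 ^ (n % b)) (sp' + 1) (Function.update st sp' (n + 1)) := by
  have hlt : ∀ a, a < sp' → Function.update st sp' (n + 1) a = st a := fun a ha =>
    Function.update_of_ne (by omega) _ _
  refine ⟨fun a a' h1 h2 => ?_, fun j => ?_, ?_⟩
  · rw [hlt a (by omega)]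
    rcases Nat.lt_succ_iff_lt_or_eq.1 h2 with h3 | rfl
    · rw [hlt a' h3]; exact h.mono a a' h1 (by omega)
    · rw [Function.update_self]
      have := (h.mem (st a)).1 ⟨a, by omega, rfl⟩
      omega
  · constructor
    · rintro ⟨a, ha, rfl⟩
      rcases Nat.lt_succ_iff_lt_or_eq.1 ha with h3 | rfl
      · rw [hlt a h3]
        obtain ⟨h4, h5, h6⟩ := (h.mem (st a)).1 ⟨a, by omega, rfl⟩
        refine ⟨h4, by omega, fun q hq1 hq2 => ?_⟩
        rcases Nat.lt_succ_iff_lt_or_eq.1 (Nat.lt_succ_of_le hq2) with h7 | rfl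
        · exact h6 q hq1 (by omega)
        · exact (h.val_mono (by omega : a ≤ sp' - 1) (by omega)).trans (htop (by omega))
      · rw [Function.update_self]
        exact ⟨by omega, le_rfl, fun q _ _ => by omega⟩
    · rintro ⟨h1, h2, h3⟩
      rcases Nat.lt_succ_iff_lt_or_eq.1 (Nat.lt_succ_of_le h2) with h4 | rfl
      · obtain ⟨a, ha, rfl⟩ := (h.mem j).2 ⟨h1, by omega, fun q hq1 hq2 => h3 q hq1 (by omega)⟩
        have : a < sp' := by
          by_contra hge
          have := hpop a (not_lt.1 hge) ha
          have := h3 (n + 1) (by omega) le_rfl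
          omega
        exact ⟨a, by omega, hlt a this⟩
      · exact ⟨sp', by omega, Function.update_self ..⟩
  · rw [Finset.sum_range_succ, Function.update_self, Nat.add_sub_cancel, hcur]
    congr 1
    exact Finset.sum_congr rfl fun a ha => by rw [hlt a (Finset.mem_range.1 ha)]

/-- `w` is the mask at the position `j`: the set bits are the offsets of the positions in the block
of `j` up to `j` whose values are at most all later values up to `j`. -/
def IsMask (S : ℕ → ℕ) (b j w : ℕ) : Prop :=
  ∃ E : Finset ℕ, w = ∑ e ∈ E, 2 ^ e ∧ ∀ e, e ∈ E ↔ e ≤ (j - 1) % b ∧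
    ∀ q, (j - 1) / b * b + 1 + e < q → q ≤ j → S ((j - 1) / b * b + 1 + e) ≤ S q

theorem StackInv.isMask {j : ℕ} (hj : 1 ≤ j) (hb : 0 < b)
    (h : StackInv S ((j - 1) / b * b) j b cur sp st) : IsMask S b j cur := by
  have hdm := Nat.div_add_mod' (j - 1) b
  have hmod := Nat.mod_lt (j - 1) hb
  have hoff : ∀ a < sp, (st a - 1) % b = st a - 1 - (j - 1) / b * b := by
    intro a ha
    obtain ⟨h1, h2, -⟩ := (h.mem (st a)).1 ⟨a, ha, rfl⟩
    have : st a - 1 = (st a - 1 - (j - 1) / b * b) + (j - 1) / b * b := by omega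
    rw [this, Nat.add_mul_mod_self_right, Nat.mod_eq_of_lt (by omega)]
    omega
  refine ⟨(Finset.range sp).image fun a => (st a - 1) % b, ?_, fun e => ?_⟩
  · rw [Finset.sum_image, h.cur]
    intro a ha a' ha' heq
    rw [Finset.mem_coe, Finset.mem_range] at ha ha'
    have h1 := (h.mem (st a)).1 ⟨a, ha, rfl⟩
    have h2 := (h.mem (st a')).1 ⟨a', ha', rfl⟩
    simp only [hoff a ha, hoff a' ha'] at heq
    rcases lt_trichotomy a a' with hlt | rfl | hlt
    · have := h.mono a a' hlt ha'; omega
    · rfl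
    · have := h.mono a' a hlt ha; omega
  · simp only [Finset.mem_image, Finset.mem_range]
    constructor
    · rintro ⟨a, ha, rfl⟩
      have h1 := (h.mem (st a)).1 ⟨a, ha, rfl⟩
      rw [hoff a ha]
      rw [show (j - 1) / b * b + 1 + (st a - 1 - (j - 1) / b * b) = st a by omega]
      exact ⟨by omega, h1.2.2⟩
    · rintro ⟨h1, h2⟩
      obtain ⟨a, ha, he⟩ := (h.mem ((j - 1) / b * b + 1 + e)).2 ⟨by omega, by omega, h2⟩
      exact ⟨a, ha, by rw [hoff a ha]; omega⟩

theorem IsMask.lt {j w : ℕ} (hb : 0 < b) (h : IsMask S b j w) : w < 2 ^ b := by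
  obtain ⟨E, rfl, h2⟩ := h
  exact Nat.geomSum_lt le_rfl fun e he =>
    (((h2 e).1 he).1).trans_lt (Nat.mod_lt _ hb)

/-- A query within a block: the quotient of the mask at the right end by the power for the left end
has the position of the leftmost minimum as its lowest set bit. -/
theorem IsMask.query {a c w : ℕ} (h : IsMask S b c w) (ha : 1 ≤ a) (hac : a ≤ c)
    (hblk : (a - 1) / b = (c - 1) / b) :
    ∃ k r, w / 2 ^ ((a - 1) % b) = 2 ^ k * (2 * r + 1) ∧ LeftMin S a c (a + k) := by
  obtain ⟨E, rfl, hE⟩ := h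
  have hda := Nat.div_add_mod' (a - 1) b
  have hdc := Nat.div_add_mod' (c - 1) b
  have hex : ∃ k, LeftMin S a c k := by
    clear hE hblk hda hdc
    induction c with
    | zero => omega
    | succ c ih =>
      rcases hac.eq_or_lt with rfl | hlt
      · exact ⟨_, .self S _⟩
      · obtain ⟨k, hk⟩ := ih (by omega)
        exact ⟨_, hk.combine (.self S (c + 1)) (by omega) le_rfl (by omega)⟩
  obtain ⟨k, hk⟩ := hex
  have h1 := hk.le
  have h2 := hk.le'
  rw [← hblk] at hE hdc
  have hmem : (a - 1) % b + (k - a) ∈ E := by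
    refine (hE _).2 ⟨by omega, fun q hq1 hq2 => ?_⟩
    rw [show (a - 1) / b * b + 1 + ((a - 1) % b + (k - a)) = k by omega] at hq1 ⊢
    exact hk.right q hq1 hq2
  have hmin : ∀ e ∈ E, (a - 1) % b ≤ e → (a - 1) % b + (k - a) ≤ e := by
    intro e he hae
    by_contra hlt
    obtain ⟨h3, h4⟩ := (hE e).1 he
    have h5 := h4 k (by omega) h2
    have h6 := hk.left ((a - 1) / b * b + 1 + e) (by omega) (by omega)
    omega
  obtain ⟨r, hr⟩ := sum_two_pow_div E hmem (by omega) hmin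
  exact ⟨k - a, r, by rw [hr, Nat.add_sub_cancel_left], by rwa [Nat.add_sub_cancel' h1]⟩

end RMQ

open RMQ

namespace Enum221

variable {M W m l σ : ℕ} {x y : ℕ → ℕ}

/-! ### Preprocessing: structures for range minimum queries -/

/-- The block length. -/
def blk (l : ℕ) : ℕ := Nat.log 2 l

/-- The number of blocks. -/
def nblk (l : ℕ) : ℕ := (l - 1) / blk l + 1

theorem blk_pos {l : ℕ} (hl : 2 ≤ l) : 0 < blk l := Nat.log_pos one_lt_two hl

theorem two_pow_blk_le {l : ℕ} (hl : 2 ≤ l) : 2 ^ blk l ≤ l := Nat.pow_log_le_self 2 (by omega)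

theorem blk_lt {l : ℕ} (hl : 2 ≤ l) : blk l < l := Nat.log_lt_self 2 (by omega)

theorem nblk_le (l : ℕ) (hl : 2 ≤ l) : nblk l ≤ l := by
  have := Nat.div_le_self (l - 1) (blk l)
  simp only [nblk]; omega

theorem blk_mul_nblk_le {l : ℕ} (hl : 2 ≤ l) : (blk l + 1) * nblk l ≤ 3 * l := by
  have h1 := Nat.div_mul_le_self (l - 1) (blk l)
  have h2 := nblk_le l hl
  have h3 := blk_lt hl
  have : (blk l + 1) * nblk l = (l - 1) / blk l * blk l + blk l + nblk l := by
    simp only [nblk]; ring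
  omega

theorem log_nblk_le {l : ℕ} (hl : 2 ≤ l) : Nat.log 2 (nblk l) ≤ blk l :=
  Nat.log_mono_right (nblk_le l hl)

/-- The position in the sparse table for row `i`, level `t` and block `p`. -/
def spos (l i t p : ℕ) : ℕ := (i * (blk l + 1) + t) * nblk l + p

theorem spos_bounds (sz : Sizes M W m l σ) {i t p : ℕ} (hi : i ≤ m) (ht : t ≤ blk l)
    (hp : p < nblk l) : i * (blk l + 1) ≤ W ∧ i * (blk l + 1) + t ≤ W ∧
      (i * (blk l + 1) + t) * nblk l ≤ W ∧ spos l i t p ≤ W ∧ spos l i t p < M := by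
  have h1 := blk_mul_nblk_le sz.two_le_l
  have h2 := sz.memory
  have h3 := sz.word
  have h4 : (i + 1) * ((blk l + 1) * nblk l) ≤ (m + 1) * (3 * l) := Nat.mul_le_mul (by omega) h1
  have h5 : (m + 1) * (3 * l) ≤ 16 * (m + l + 1) ^ 2 := by nlinarith
  have h6 : (i * (blk l + 1) + t + 1) * nblk l ≤ (i + 1) * ((blk l + 1) * nblk l) := by
    rw [← mul_assoc]
    exact Nat.mul_le_mul_right _ (by rw [add_mul]; omega)
  have h7 : (i * (blk l + 1) + t) * 1 ≤ (i * (blk l + 1) + t) * nblk l :=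
    Nat.mul_le_mul_left _ (by simp [nblk])
  rw [add_mul, one_mul] at h6
  simp only [spos]
  omega

/-- The tables shared by all structures for range minimum queries. -/
structure Lookup (l : ℕ) (s : State Reg Arr) : Prop where
  reg_b : s.reg .b = blk l
  reg_nb : s.reg .nb = nblk l
  reg_lev : s.reg .lev = blk l + 1
  lg : ∀ p, 1 ≤ p → p ≤ l → s.arr .lg p = Nat.log 2 p
  lsb : ∀ k r, 2 ^ k * (2 * r + 1) ≤ l → s.arr .lsb (2 ^ k * (2 * r + 1)) = k
  pow : ∀ k ≤ blk l, s.arr .pow k = 2 ^ k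

theorem Lookup.frame {s s' : State Reg Arr} {c : Cmd Reg Arr} (h : Lookup l s)
    (hF : Frame c s s') (h1 : c.modReg .b = false := by rfl) (h2 : c.modReg .nb = false := by rfl)
    (h3 : c.modReg .lev = false := by rfl) (h4 : c.modArr .lg = false := by rfl)
    (h5 : c.modArr .lsb = false := by rfl) (h6 : c.modArr .pow = false := by rfl) : Lookup l s' :=
  ⟨(hF.reg _ h1).trans h.reg_b, (hF.reg _ h2).trans h.reg_nb, (hF.reg _ h3).trans h.reg_lev,
    hF.arr _ h4 ▸ h.lg, hF.arr _ h5 ▸ h.lsb, hF.arr _ h6 ▸ h.pow⟩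

theorem wp_buildLookup {s : State Reg Arr} (sz : Sizes M W m l σ) (hL : Lens m l σ s) :
    wp M W buildLookup (fun s' => Lookup l s' ∧ s'.time ≤ s.time + 100 * (l + 1)) s := by
  have h1 := sz.small
  have h2 := sz.two_le_l
  simp only [buildLookup, v, wp_seq, wp_store]
  refine ⟨by simp; omega, by simp, by simp; omega, by simp; omega, by simp, by simp; omega, ?_⟩
  refine wp_forUp 2 l (fun n s' => (∀ p, 1 ≤ p → p < n → s'.arr .lg p = Nat.log 2 p) ∧
    (∀ k r, 2 ^ k * (2 * r + 1) < n → s'.arr .lsb (2 ^ k * (2 * r + 1)) = k) ∧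
    s'.time ≤ s.time + 50 * n) (by simp; omega) (by simp) (by omega) (by omega) ?_ ?_ ?_ ?_
  · refine ⟨fun p hp1 hp2 => ?_, fun k r hkr => ?_, by simp⟩
    · obtain rfl : p = 1 := by omega
      simp
    · have h3 : 2 ^ k * (2 * r + 1) = 1 := by
        have : 0 < 2 ^ k * (2 * r + 1) := by positivity
        omega
      rw [h3]
      have h4 := Nat.eq_one_of_mul_eq_one_right h3
      have : k = 0 := by
        by_contra hk
        exact absurd h4 (Nat.one_lt_two_pow hk).ne'
      simp [this]
  · intro s' hF
    simp [(hF.reg .l rfl), hL.reg_l]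
  · rintro p s' hp2 hpl hF hp ⟨h3, h4, h5⟩
    have h6 := h3 (p / 2) (by omega) (by omega)
    have h7 : Nat.log 2 p = Nat.log 2 (p / 2) + 1 := Nat.log_of_one_lt_of_le one_lt_two hp2
    have h8 := Nat.log_le_self 2 p
    have hlg : ∀ q, 1 ≤ q → q < p + 1 →
        Function.update (s'.arr .lg) p (Nat.log 2 (p / 2) + 1) q = Nat.log 2 q := by
      intro q hq1 hq2
      rw [Function.update_apply]
      split_ifs with hqp
      · rw [hqp, h7]
      · exact h3 q hq1 (by omega)
    have hodd : ∀ k r, 2 ^ (k + 1) * (2 * r + 1) = p → p % 2 = 0 ∧ p / 2 = 2 ^ k * (2 * r + 1) := by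
      intro k r h
      have : p = 2 * (2 ^ k * (2 * r + 1)) := by rw [← h]; ring
      omega
    simp [hp, h6, -Nat.log_div_base]
    refine ⟨⟨⟨by omega, by omega⟩, by omega, by omega⟩, by omega, by omega,
      fun hz => ⟨⟨⟨by omega, by omega⟩, by omega, ?_⟩, by omega, ?_, ?_, by omega⟩,
      fun hz => ⟨by omega, ?_, ?_, by omega⟩⟩
    · have hlsb : s'.arr .lsb (p / 2) < p := by
        obtain ⟨k, r, hkr⟩ : ∃ k r, p / 2 = 2 ^ k * (2 * r + 1) := by
          obtain ⟨k, q, hq, hp⟩ := Nat.exists_eq_two_pow_mul_odd (n := p / 2) (by omega)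
          obtain ⟨r, rfl⟩ := hq
          exact ⟨k, r, hp⟩
        rw [hkr, h4 k r (by omega)]
        have : k < 2 ^ k := Nat.lt_two_pow_self
        have : 2 ^ k * 1 ≤ 2 ^ k * (2 * r + 1) := Nat.mul_le_mul_left _ (by omega)
        omega
      omega
    · intro q hq1 hq2
      exact hlg q hq1 (by omega)
    · intro k r hkr
      rw [Function.update_apply]
      split_ifs with he
      · cases k with
        | zero => omega
        | succ k =>
          rw [(hodd k r he).2, h4 k r]
          have := (hodd k r he).2
          omega
      · exact h4 k r (by omega)
    · intro q hq1 hq2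
      exact hlg q hq1 (by omega)
    · intro k r hkr
      rw [Function.update_apply]
      split_ifs with he
      · cases k with
        | zero => rfl
        | succ k => have := (hodd k r he).1; omega
      · exact h4 k r (by omega)
  · rintro s₁ hF₁ - ⟨h3, h4, h5⟩
    have el : s₁.reg .l = l := (hF₁.reg .l rfl).trans hL.reg_l
    have h6 := h3 l (by omega) (by omega)
    have h7 := blk_pos h2
    have h8 := nblk_le l h2
    have h9 := blk_lt h2
    have h10 := two_pow_blk_le h2
    have hblk : Nat.log 2 l = blk l := rfl
    have hnblk : (l - 1) / blk l + 1 = nblk l := rfl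
    have hnblk' : (l - 1) / blk l + 1 ≤ W := by rw [hnblk]; omega
    simp [el, h6, hblk, hnblk, -Nat.log_eq_zero_iff]
    refine ⟨by omega, ⟨by omega, by omega, by omega⟩, by omega, by omega, by omega, ?_⟩
    refine wp_forUp 1 (blk l) (fun n s' => (∀ p, p < n → s'.arr .pow p = 2 ^ p) ∧
      s'.time ≤ s₁.time + 40 + 30 * n) (by simp; omega) (by simp) (by omega) (by omega) ?_ ?_ ?_ ?_
    · refine ⟨fun p hp => ?_, by simp⟩
      obtain rfl : p = 0 := by omega
      simp
    · intro s' hF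
      simp [hF.reg .b rfl]
    · rintro n s' hn1 hn2 hF hp ⟨h11, h12⟩
      have h13 := h11 (n - 1) (by omega)
      have h14 : 2 * 2 ^ (n - 1) = 2 ^ n := by
        rw [← pow_succ', Nat.sub_add_cancel hn1]
      have h15 : 2 ^ n ≤ 2 ^ blk l := Nat.pow_le_pow_right (by omega) hn2
      simp [hp, h13, h14]
      refine ⟨by omega, by omega, fun q hq => ?_, by omega⟩
      rw [Function.update_apply]
      split_ifs with he
      · rw [he]
      · exact h11 q (by omega)
    · rintro s' hF - ⟨h11, h12⟩
      have elg := hF.arr .lg rfl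
      have elsb := hF.arr .lsb rfl
      simp at elg elsb
      refine ⟨⟨?_, ?_, ?_, ?_, ?_, ?_⟩, by simp; omega⟩
      · simp [hF.reg .b rfl]
      · simp [hF.reg .nb rfl]
      · simp [hF.reg .lev rfl]
      · intro p hp1 hp2
        simp [elg, h3 p hp1 (by omega)]
      · intro k r hkr
        simp [elsb, h4 k r (by omega)]
      · intro k hk
        simp [h11 k (by omega)]

end Enum221

namespace Enum221

variable {M W m l σ : ℕ} {x y : ℕ → ℕ}

/-- The bit masks and the sparse table in row `i` are those of the sequence `S`. -/
structure RMQRow (S : ℕ → ℕ) (l i : ℕ) (s : State Reg Arr) : Prop where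
  mask : ∀ j, 1 ≤ j → j ≤ l → IsMask S (blk l) j (s.arr .mask (i * (l + 1) + j))
  sparse : ∀ t p, p + 2 ^ t ≤ nblk l →
    LeftMin S (p * blk l + 1) (min ((p + 2 ^ t) * blk l) l) (s.arr .sparse (spos l i t p))

/-- The first loop of the construction, which fills the bit masks and the level `0` of the sparse
table. -/
def maskLoop : Cmd Reg Arr :=
  .forUp .j 1 (v .l)
    (.assign .q ((v .j - 1) % v .b) ;;
     .ite (.eq (v .q) 0)
      (.assign .cur 0 ;; .assign .sp 0 ;; .assign .u (v .j))
      (.ite (.lt (suffI (v .j)) (suffI (v .u))) (.assign .u (v .j)) .skip) ;;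
     .while (.and (.lt 0 (v .sp)) (.lt (suffI (v .j)) (suffI (.get .stack (v .sp - 1)))))
      (.assign .sp (v .sp - 1) ;;
       .assign .cur (v .cur - .get .pow ((.get .stack (v .sp) - 1) % v .b))) ;;
     .store .stack (v .sp) (v .j) ;;
     .assign .sp (v .sp + 1) ;;
     .assign .cur (v .cur + .get .pow (v .q)) ;;
     .store .mask (v .i * v .wY + v .j) (v .cur) ;;
     .store .sparse (sparseAt (v .i) 0 ((v .j - 1) / v .b)) (v .u))

/-- The second loop of the construction, which fills the higher levels of the sparse table. -/
def sparseLoop : Cmd Reg Arr :=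
  .forUp .t 1 (.get .lg (v .nb))
    (.forUp .p 0 (v .nb - .get .pow (v .t))
      (.assign .q (.get .sparse (sparseAt (v .i) (v .t - 1) (v .p))) ;;
       .assign .u (.get .sparse (sparseAt (v .i) (v .t - 1) (v .p + .get .pow (v .t - 1)))) ;;
       .ite (.lt (suffI (v .u)) (suffI (v .q)))
        (.store .sparse (sparseAt (v .i) (v .t) (v .p)) (v .u))
        (.store .sparse (sparseAt (v .i) (v .t) (v .p)) (v .q))))

theorem spos_inj {i t p i' t' p' : ℕ} (ht : t ≤ blk l) (ht' : t' ≤ blk l) (hp : p < nblk l)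
    (hp' : p' < nblk l) : spos l i t p = spos l i' t' p' ↔ i = i' ∧ t = t' ∧ p = p' := by
  rw [spos, spos, row_inj hp hp', row_inj (by omega) (by omega), and_assoc]

theorem spos_lt {i t p : ℕ} (ht : t ≤ blk l) (hp : p < nblk l) :
    spos l i t p < spos l (i + 1) 0 0 := by
  have h1 : (i * (blk l + 1) + t + 1) * nblk l ≤ ((i + 1) * (blk l + 1) + 0) * nblk l :=
    Nat.mul_le_mul_right _ (by rw [add_mul, one_mul]; omega)
  rw [add_mul _ 1, one_mul] at h1
  simp only [spos]
  omega

theorem sub_one_mul_blk_le (hl : 1 ≤ l) {p : ℕ} (hp : p < nblk l) : p * blk l + 1 ≤ l := by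
  have h1 : p * blk l ≤ (l - 1) / blk l * blk l :=
    Nat.mul_le_mul_right _ (by simp only [nblk] at hp; omega)
  have h2 := Nat.div_mul_le_self (l - 1) (blk l)
  omega

/-- The pop loop for the element at `j`: the elements of the stack with larger values are
removed. -/
theorem wp_popLoop {S : ℕ → ℕ} {i j B : ℕ} {s : State Reg Arr} (sz : Sizes M W m l σ)
    (hL : Lens m l σ s) (hK : Lookup l s) (hi : s.reg .i = i) (him : i ≤ m) (hj : s.reg .j = j)
    (hj1 : 1 ≤ j) (hjl : j ≤ l) (hS : ∀ j, 1 ≤ j → j ≤ l → s.arr .suff (i * (l + 1) + j) = S j)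
    (hst : ∀ a, s.arr .stack a ≤ l) (hsp : s.reg .sp ≤ j)
    (hI : StackInv S B (j - 1) (blk l) (s.reg .cur) (s.reg .sp) (s.arr .stack)) (hB : B ≤ j - 1) :
    wp M W (.while (.and (.lt 0 (v .sp)) (.lt (suffI (v .j)) (suffI (.get .stack (v .sp - 1)))))
      (.assign .sp (v .sp - 1) ;;
       .assign .cur (v .cur - .get .pow ((.get .stack (v .sp) - 1) % v .b))))
      (fun s' => s'.time + 60 * s'.reg .sp ≤ s.time + 60 * s.reg .sp + 60 ∧
        s'.reg .sp ≤ s.reg .sp ∧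
        StackInv S B j (blk l) (s'.reg .cur + 2 ^ ((j - 1) % blk l)) (s'.reg .sp + 1)
          (Function.update (s.arr .stack) (s'.reg .sp) j)) s := by
  have h1 := sz.small
  have h2 := sz.two_le_l
  have h3 := blk_pos h2
  have h4 := blk_lt h2
  refine wp_while (fun s' => s'.time + 60 * s'.reg .sp ≤ s.time + 60 * s.reg .sp ∧
    s'.reg .sp ≤ s.reg .sp ∧
    (∀ a, s'.reg .sp ≤ a → a < s.reg .sp → S j < S (s.arr .stack a)) ∧
    s'.reg .cur = ∑ a ∈ Finset.range (s'.reg .sp), 2 ^ ((s.arr .stack a - 1) % blk l))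
    (fun s' => s'.reg .sp) ⟨le_rfl, le_rfl, fun a _ _ => by omega, hI.cur⟩ ?_
  rintro s' hF ⟨h5, h6, h7, h8⟩
  have eL := hL.frame hF
  have eK := hK.frame hF
  have ei := (hF.reg .i rfl).trans hi
  have ej := (hF.reg .j rfl).trans hj
  have est := hF.arr .stack rfl
  have eS : ∀ j, 1 ≤ j → j ≤ l → s'.arr .suff (i * (l + 1) + j) = S j := hF.arr .suff rfl ▸ hS
  have ha := sz.addr (a := i) (b := l + 1) (c := j) (by omega) (by omega) (by omega)
  have hst' := hst (s'.reg .sp - 1)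
  have hb := sz.addr (a := i) (b := l + 1) (c := s.arr .stack (s'.reg .sp - 1)) (by omega)
    (by omega) (by omega)
  have eSj := eS j hj1 hjl
  have htop : 0 < s'.reg .sp → 1 ≤ s.arr .stack (s'.reg .sp - 1) := by
    intro h
    have := (hI.mem _).1 ⟨s'.reg .sp - 1, by omega, rfl⟩
    omega
  have hmod := Nat.mod_lt (s.arr .stack (s'.reg .sp - 1) - 1) h3
  simp [suffI, v, eL.wY, ei, ej, est, eSj, eK.reg_b]
  refine ⟨⟨⟨⟨by omega, by omega⟩, by omega⟩, ⟨by omega, by omega, by omega⟩, by omega⟩, ?_, ?_⟩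
  · intro hpos hlt
    rw [eS _ (htop hpos) hst'] at hlt
    refine ⟨by omega, ⟨⟨⟨by omega, by omega⟩, by omega⟩, by omega⟩,
      ⟨by omega, by omega, ?_, ?_⟩, hpos⟩
    · intro a ha1 ha2
      by_cases he : s'.reg .sp = a + 1
      · rwa [he, Nat.add_sub_cancel] at hlt
      · exact h7 a (by omega) ha2
    · rw [h8, eK.pow _ hmod.le]
      obtain ⟨k, hk⟩ : ∃ k, s'.reg .sp = k + 1 := ⟨s'.reg .sp - 1, by omega⟩
      rw [hk, Finset.sum_range_succ]
      simp
  · intro hdone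
    refine ⟨by omega, h6, ?_⟩
    have := hI.push (sp' := s'.reg .sp) hB h6 (fun a ha1 ha2 => ?_) (fun hpos => ?_) h8
    · rwa [Nat.sub_add_cancel hj1] at this
    · rw [Nat.sub_add_cancel hj1]
      exact h7 a ha1 ha2
    · rw [Nat.sub_add_cancel hj1, ← eS _ (htop hpos) hst']
      exact hdone hpos

theorem wp_maskLoop {S : ℕ → ℕ} {i : ℕ} {s : State Reg Arr} (sz : Sizes M W m l σ)
    (hL : Lens m l σ s) (hK : Lookup l s) (hi : s.reg .i = i) (him : i ≤ m)
    (hS : ∀ j, 1 ≤ j → j ≤ l → s.arr .suff (i * (l + 1) + j) = S j)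
    (hst : ∀ a, s.arr .stack a ≤ l) :
    wp M W maskLoop (fun s' =>
      (∀ j, 1 ≤ j → j ≤ l → IsMask S (blk l) j (s'.arr .mask (i * (l + 1) + j))) ∧
      (∀ p, p < nblk l →
        LeftMin S (p * blk l + 1) (min ((p + 1) * blk l) l) (s'.arr .sparse (spos l i 0 p))) ∧
      (∀ a, s'.arr .stack a ≤ l) ∧
      (∀ a, (i + 1) * (l + 1) ≤ a → s'.arr .mask a = s.arr .mask a) ∧
      (∀ a, spos l (i + 1) 0 0 ≤ a → s'.arr .sparse a = s.arr .sparse a) ∧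
      s'.time ≤ s.time + 300 * (l + 1) + 10) s := by
  have h1 := sz.small
  have h2 := sz.two_le_l
  have hb0 := blk_pos h2
  have h4 := blk_lt h2
  refine wp_forUp 1 l (fun j s' =>
    (∀ j', 1 ≤ j' → j' < j → IsMask S (blk l) j' (s'.arr .mask (i * (l + 1) + j'))) ∧
    (∀ p, p * blk l + 1 < j →
        LeftMin S (p * blk l + 1) (min ((p + 1) * blk l) (j - 1)) (s'.arr .sparse (spos l i 0 p))) ∧
    (∀ a, s'.arr .stack a ≤ l) ∧
    (∀ a, (i + 1) * (l + 1) ≤ a → s'.arr .mask a = s.arr .mask a) ∧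
    (∀ a, spos l (i + 1) 0 0 ≤ a → s'.arr .sparse a = s.arr .sparse a) ∧
    s'.time ≤ s.time + 300 * j ∧
    ((j - 1) % blk l ≠ 0 → s'.reg .sp ≤ j - 1 ∧ s'.time + 60 * s'.reg .sp ≤ s.time + 300 * j ∧
      StackInv S ((j - 1) / blk l * blk l) (j - 1) (blk l) (s'.reg .cur) (s'.reg .sp)
        (s'.arr .stack) ∧ LeftMin S ((j - 1) / blk l * blk l + 1) (j - 1) (s'.reg .u)))
    (by simp; omega) (by simp) (by omega) (by omega) ?_ ?_ ?_ ?_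
  · exact ⟨fun j' _ _ => by omega, fun p hp => by omega, hst, fun a _ => rfl, fun a _ => rfl,
      by simp, fun h => by simp at h⟩
  · intro s' hF
    simp [v, (hL.frame hF).reg_l]
  · rintro j s' hj1 hjl hF hj ⟨h5, h6, h7, h8, h9, h10, h11⟩
    have eL := hL.frame hF
    have eK := hK.frame hF
    have ei := (hF.reg .i rfl).trans hi
    have eS : ∀ j, 1 ≤ j → j ≤ l → s'.arr .suff (i * (l + 1) + j) = S j := hF.arr .suff rfl ▸ hS
    have hdm := Nat.div_add_mod' (j - 1) (blk l)
    have hmod := Nat.mod_lt (j - 1) hb0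
    set B := (j - 1) / blk l * blk l with hB
    simp only [wp_seq, wp_assign]
    refine ⟨by simp [v, eK.reg_b]; omega, ?_⟩
    refine wp_then (Q := fun s₂ => s₂.reg .sp ≤ j - 1 ∧
      s₂.time + 60 * s₂.reg .sp ≤ s.time + 300 * j + 40 ∧ s₂.arr = s'.arr ∧
      StackInv S B (j - 1) (blk l) (s₂.reg .cur) (s₂.reg .sp) (s'.arr .stack) ∧
      LeftMin S (B + 1) j (s₂.reg .u)) ?_ ?_
    · by_cases hq : (j - 1) % blk l = 0
      · have hBj : B = j - 1 := by omega
        simp [v, hj, eK.reg_b, hq]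
        refine ⟨by omega, ?_, ?_⟩
        · rw [hBj]; exact .nil
        · rw [hBj, Nat.sub_add_cancel hj1]; exact .self S j
      · obtain ⟨h12, h13, h14, h15⟩ := h11 hq
        have h16 := h15.le
        have h17 := h15.le'
        have ha := sz.addr (a := i) (b := l + 1) (c := j) (by omega) (by omega) (by omega)
        have hb := sz.addr (a := i) (b := l + 1) (c := s'.reg .u) (by omega) (by omega) (by omega)
        have h18 := h15.combine (.self S j) (by omega) (by omega) (by omega)
        simp [suffI, v, hj, eK.reg_b, hq, ei, eL.wY, eS j hj1 hjl,
          eS (s'.reg .u) (by omega) (by omega)]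
        refine ⟨⟨by omega, by omega⟩, fun hlt => ⟨h12, by omega, h14, ?_⟩,
          fun hlt => ⟨h12, by omega, h14, ?_⟩⟩
        · rwa [if_pos hlt] at h18
        · rwa [if_neg (by omega)] at h18
    · rintro s₂ hF₂ ⟨h12, h13, h14, h15, h16⟩
      have eL₂ : Lens m l σ s₂ := ⟨by simp [hF₂.reg .m rfl, eL.reg_m],
        by simp [hF₂.reg .l rfl, eL.reg_l], by simp [hF₂.reg .σ rfl, eL.reg_σ],
        by simp [hF₂.reg .wX rfl, eL.wX], by simp [hF₂.reg .wY rfl, eL.wY]⟩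
      have eK₂ : Lookup l s₂ := ⟨by simp [hF₂.reg .b rfl, eK.reg_b],
        by simp [hF₂.reg .nb rfl, eK.reg_nb], by simp [hF₂.reg .lev rfl, eK.reg_lev],
        h14 ▸ eK.lg, h14 ▸ eK.lsb, h14 ▸ eK.pow⟩
      have ei₂ : s₂.reg .i = i := by simp [hF₂.reg .i rfl, ei]
      have ej₂ : s₂.reg .j = j := by simp [hF₂.reg .j rfl, hj]
      have eq₂ : s₂.reg .q = (j - 1) % blk l := by simp [hF₂.reg .q rfl, hj, v, eK.reg_b]
      rw [wp_seq]
      refine wp_then (wp_popLoop sz eL₂ eK₂ ei₂ him ej₂ hj1 hjl (h14 ▸ eS) (h14 ▸ h7) (by omega)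
        (h14 ▸ h15) (by omega)) ?_
      rintro s₃ hF₃ ⟨h17, h18, h19⟩
      have eL₃ := eL₂.frame hF₃
      have eK₃ := eK₂.frame hF₃
      have ei₃ := (hF₃.reg .i rfl).trans ei₂
      have ej₃ := (hF₃.reg .j rfl).trans ej₂
      have eq₃ := (hF₃.reg .q rfl).trans eq₂
      have eu₃ := hF₃.reg .u rfl
      have emask := hF₃.arr .mask rfl
      have esparse := hF₃.arr .sparse rfl
      have estack := hF₃.arr .stack rfl
      rw [h14] at emask esparse estack h19
      have ha := sz.addr (a := i) (b := l + 1) (c := j) (by omega) (by omega) (by omega)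
      have hmask := h19.isMask hj1 hb0
      have hlt := (hmask.lt hb0).trans_le (two_pow_blk_le h2)
      have hp : (j - 1) / blk l < nblk l := by
        have := Nat.div_le_div_right (c := blk l) (by omega : j - 1 ≤ l - 1)
        simp only [nblk]; omega
      have hspos := spos_bounds sz him (Nat.zero_le _) hp
      simp [sparseAt, v, eL₃.wY, ei₃, ej₃, eq₃, eu₃, emask, esparse, estack, eK₃.reg_b, eK₃.reg_lev,
        eK₃.reg_nb, eK₃.pow _ hmod.le]
      have hadr : i * (blk l + 1) * nblk l + (j - 1) / blk l = spos l i 0 ((j - 1) / blk l) := by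
        simp [spos]
      have hlast := spos_lt (i := i) (Nat.zero_le _) hp
      rw [hadr]
      simp only [spos.eq_1 l i 0 ((j - 1) / blk l), add_zero] at hspos
      rw [hadr] at hspos
      refine ⟨by omega, by omega, by omega, by omega, by omega, ⟨by omega, by omega, by omega⟩,
        by omega, fun j' hj' hj'' => ?_, fun p hp1 => ?_, fun a => ?_, fun a hle => ?_,
        fun a hle => ?_, by omega, fun hne => ?_⟩
      · rw [Function.update_apply]
        split_ifs with he
        · obtain rfl : j' = j := by omega
          exact hmask
        · exact h5 j' hj' (by omega)
      · by_cases he : p = (j - 1) / blk l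
        · have h20 : (p + 1) * blk l = B + blk l := by rw [he, add_mul, one_mul]
          rw [he, Function.update_self, ← he, min_eq_right (by omega), he]
          exact h16
        · have h20 : p ≤ (j - 1) / blk l := (Nat.le_div_iff_mul_le hb0).2 (by omega)
          have h21 : (p + 1) * blk l ≤ B := Nat.mul_le_mul_right _ (by omega)
          have h22 := h6 p (by rw [add_mul, one_mul] at h21; omega)
          rw [Function.update_of_ne, min_eq_left (by omega)]
          · rwa [min_eq_left (by omega)] at h22
          · rw [Ne, spos_inj (Nat.zero_le _) (Nat.zero_le _) (by omega) hp]
            tauto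
      · rw [Function.update_apply]
        split_ifs
        exacts [hjl, h7 a]
      · rw [Function.update_of_ne, h8 a hle]
        rw [add_mul, one_mul] at hle
        omega
      · rw [Function.update_of_ne (by omega), h9 a hle]
      · have h20 : j / blk l = (j - 1) / blk l := by
          have h21 := Nat.succ_div (a := j - 1) (b := blk l)
          rwa [Nat.sub_add_cancel hj1, if_neg (by rwa [Nat.dvd_iff_mod_eq_zero]), add_zero] at h21
        rw [h20]
        exact ⟨by omega, by omega, h19, h16⟩
  · rintro s' hF - ⟨h5, h6, h7, h8, h9, h10, h11⟩
    refine ⟨fun j hj1 hjl => h5 j hj1 (by omega), fun p hp => h6 p ?_, h7, h8, h9, ?_⟩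
    · have := sub_one_mul_blk_le (by omega) hp
      omega
    · simp only [tick_time, v, cost_reg]; omega

theorem wp_sparseLoop {S : ℕ → ℕ} {i : ℕ} {s : State Reg Arr} (sz : Sizes M W m l σ)
    (hL : Lens m l σ s) (hK : Lookup l s) (hi : s.reg .i = i) (him : i ≤ m)
    (hS : ∀ j, 1 ≤ j → j ≤ l → s.arr .suff (i * (l + 1) + j) = S j)
    (h0 : ∀ p, p < nblk l →
        LeftMin S (p * blk l + 1) (min ((p + 1) * blk l) l) (s.arr .sparse (spos l i 0 p))) :
    wp M W sparseLoop (fun s' =>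
      (∀ t p, p + 2 ^ t ≤ nblk l →
        LeftMin S (p * blk l + 1) (min ((p + 2 ^ t) * blk l) l) (s'.arr .sparse (spos l i t p))) ∧
      (∀ a, spos l (i + 1) 0 0 ≤ a → s'.arr .sparse a = s.arr .sparse a) ∧
      s'.time ≤ s.time + 600 * (l + 1)) s := by
  have h1 := sz.small
  have h2 := sz.two_le_l
  have hb0 := blk_pos h2
  have h4 := blk_lt h2
  have h5 := nblk_le l h2
  have hn0 : 0 < nblk l := Nat.succ_pos _
  have hlog := log_nblk_le h2
  have hlev : ∀ {p t}, p + 2 ^ t ≤ nblk l → t ≤ Nat.log 2 (nblk l) := fun {p t} h =>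
    Nat.le_log_of_pow_le one_lt_two (by omega)
  refine wp_forUp 1 (Nat.log 2 (nblk l)) (fun t s' =>
    (∀ t' p, t' < t → p + 2 ^ t' ≤ nblk l →
      LeftMin S (p * blk l + 1) (min ((p + 2 ^ t') * blk l) l) (s'.arr .sparse (spos l i t' p))) ∧
    (∀ a, spos l (i + 1) 0 0 ≤ a → s'.arr .sparse a = s.arr .sparse a) ∧
    s'.time ≤ s.time + t * (180 * nblk l))
    (by simp; omega) (by simp) (by omega) (by omega) ?_ ?_ ?_ ?_
  · refine ⟨fun t' p ht hp => ?_, fun a _ => rfl, by simp; omega⟩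
    obtain rfl : t' = 0 := by omega
    exact h0 p hp
  · intro s' hF
    have eK := hK.frame hF
    simp [v, eK.reg_nb, eK.lg _ hn0 h5]
    omega
  · rintro t s' ht1 htl hF ht ⟨h6, h7, h8⟩
    have eL := hL.frame hF
    have eK := hK.frame hF
    have ei := (hF.reg .i rfl).trans hi
    have eS : ∀ j, 1 ≤ j → j ≤ l → s'.arr .suff (i * (l + 1) + j) = S j := hF.arr .suff rfl ▸ hS
    have hpow : 2 ^ t ≤ nblk l := Nat.pow_le_of_le_log hn0.ne' htl
    have hpow1 : 2 ^ t = 2 ^ (t - 1) + 2 ^ (t - 1) := by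
      rw [← two_mul, ← pow_succ', Nat.sub_add_cancel ht1]
    have hpos : 0 < 2 ^ (t - 1) := by positivity
    refine wp_forUp 0 (nblk l - 2 ^ t) (fun p s'' =>
      (∀ t' p, t' < t → p + 2 ^ t' ≤ nblk l →
        LeftMin S (p * blk l + 1) (min ((p + 2 ^ t') * blk l) l)
          (s''.arr .sparse (spos l i t' p))) ∧
      (∀ p', p' < p →
        LeftMin S (p' * blk l + 1) (min ((p' + 2 ^ t) * blk l) l)
          (s''.arr .sparse (spos l i t p'))) ∧
      (∀ a, spos l (i + 1) 0 0 ≤ a → s''.arr .sparse a = s.arr .sparse a) ∧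
      s''.time ≤ s'.time + 20 + p * 120)
      (by simp) (by simp) (by omega) (by omega) ?_ ?_ ?_ ?_
    · exact ⟨h6, fun p' _ => by omega, h7, by simp [v]⟩
    · intro s₂ hF₂
      have eK₂ : Lookup l s₂ := Lookup.frame (s := s') eK ⟨hF₂.reg, hF₂.arr, hF₂.out⟩
      have et₂ : s₂.reg .t = t := (hF₂.reg .t rfl).trans ht
      simp [v, eK₂.reg_nb, et₂, eK₂.pow t (by omega)]
      omega
    · rintro p s₂ - hpl hF₂ hp ⟨h9, h10, h11, h12⟩
      have eL₂ : Lens m l σ s₂ := Lens.frame (s := s') eL ⟨hF₂.reg, hF₂.arr, hF₂.out⟩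
      have eK₂ : Lookup l s₂ := Lookup.frame (s := s') eK ⟨hF₂.reg, hF₂.arr, hF₂.out⟩
      have et₂ : s₂.reg .t = t := (hF₂.reg .t rfl).trans ht
      have ei₂ : s₂.reg .i = i := (hF₂.reg .i rfl).trans ei
      have eS₂ : ∀ j, 1 ≤ j → j ≤ l → s₂.arr .suff (i * (l + 1) + j) = S j :=
        hF₂.arr .suff rfl ▸ eS
      have hA := h9 (t - 1) p (by omega) (by omega)
      have hB := h9 (t - 1) (p + 2 ^ (t - 1)) (by omega) (by omega)
      rw [add_assoc, ← hpow1] at hB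
      have hle : (p + 2 ^ (t - 1)) * blk l + 1 ≤ l := sub_one_mul_blk_le (by omega) (by omega)
      have hle' : p * blk l ≤ (p + 2 ^ (t - 1)) * blk l := Nat.mul_le_mul_right _ (by omega)
      have hle'' : (p + 2 ^ (t - 1)) * blk l ≤ (p + 2 ^ t) * blk l :=
        Nat.mul_le_mul_right _ (by omega)
      have hC := hA.combine hB (by omega) (by omega) (by omega)
      have a1 := spos_bounds sz him (by omega : t - 1 ≤ blk l) (by omega : p < nblk l)
      have a2 := spos_bounds sz him (by omega : t - 1 ≤ blk l)
        (by omega : p + 2 ^ (t - 1) < nblk l)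
      have a3 := spos_bounds sz him (by omega : t ≤ blk l) (by omega : p < nblk l)
      have a4 := spos_lt (i := i) (by omega : t ≤ blk l) (by omega : p < nblk l)
      have hq := hA.le; have hq' := hA.le'; have hu := hB.le; have hu' := hB.le'
      have e1 := eS₂ (s₂.arr .sparse (spos l i (t - 1) p)) (by omega) (by omega)
      have e2 := eS₂ (s₂.arr .sparse (spos l i (t - 1) (p + 2 ^ (t - 1)))) (by omega) (by omega)
      have a5 := sz.addr (a := i) (b := l + 1) (c := s₂.arr .sparse (spos l i (t - 1) p))
        (by omega) (by omega) (by omega)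
      have a6 := sz.addr (a := i) (b := l + 1)
        (c := s₂.arr .sparse (spos l i (t - 1) (p + 2 ^ (t - 1)))) (by omega) (by omega) (by omega)
      have hupd : ∀ r, LeftMin S (p * blk l + 1) (min ((p + 2 ^ t) * blk l) l) r →
          (∀ t' p', t' < t → p' + 2 ^ t' ≤ nblk l →
            LeftMin S (p' * blk l + 1) (min ((p' + 2 ^ t') * blk l) l)
              (Function.update (s₂.arr .sparse) (spos l i t p) r (spos l i t' p'))) ∧
          (∀ p', p' ≤ p →
            LeftMin S (p' * blk l + 1) (min ((p' + 2 ^ t) * blk l) l)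
              (Function.update (s₂.arr .sparse) (spos l i t p) r (spos l i t p'))) ∧
          (∀ a, spos l (i + 1) 0 0 ≤ a →
            Function.update (s₂.arr .sparse) (spos l i t p) r a = s.arr .sparse a) := by
        refine fun r hr => ⟨fun t' p' ht' hp' => ?_, fun p' hp' => ?_, fun a hle => ?_⟩
        · have : 0 < 2 ^ t' := by positivity
          rw [Function.update_of_ne]
          · exact h9 t' p' ht' hp'
          · rw [Ne, spos_inj (by omega) (by omega) (by omega) (by omega)]
            omega
        · rcases hp'.eq_or_lt with rfl | hlt
          · rwa [Function.update_self]
          · rw [Function.update_of_ne]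
            · exact h10 p' hlt
            · rw [Ne, spos_inj (by omega) (by omega) (by omega) (by omega)]
              omega
        · rw [Function.update_of_ne (by omega), h11 a hle]
      have hfold : ∀ t p, (i * (blk l + 1) + t) * nblk l + p = spos l i t p := fun _ _ => rfl
      simp [sparseAt, suffI, v, eL₂.wY, ei₂, et₂, hp, eK₂.reg_lev, eK₂.reg_nb,
        eK₂.pow (t - 1) (by omega), hfold, e1, e2]
      refine ⟨by omega, by omega, by omega, fun hlt => ?_, fun hle => ?_⟩
      · rw [if_pos hlt] at hC
        obtain ⟨h13, h14, h15⟩ := hupd _ hC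
        exact ⟨by omega, by omega, h13, h14, h15, by omega⟩
      · rw [if_neg hle.not_gt] at hC
        obtain ⟨h13, h14, h15⟩ := hupd _ hC
        exact ⟨by omega, by omega, h13, h14, h15, by omega⟩
    · rintro s₂ hF₂ - ⟨h9, h10, h11, h12⟩
      have et₂ : s₂.reg .t = t := (hF₂.reg .t rfl).trans ht
      refine ⟨by simp [et₂], fun t' p ht' hp => ?_, h11, ?_⟩
      · rcases Nat.lt_succ_iff_lt_or_eq.1 ht' with h | rfl
        · exact h9 t' p h hp
        · exact h10 p (by omega)
      · simp [v, add_mul]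
        omega
  · rintro s' hF - ⟨h6, h7, h8⟩
    refine ⟨fun t p hp => h6 t p (by have := hlev hp; omega) hp, h7, ?_⟩
    have h9 := blk_mul_nblk_le h2
    have h10 : (Nat.log 2 (nblk l) + 1) * nblk l ≤ (blk l + 1) * nblk l :=
      Nat.mul_le_mul_right _ (by omega)
    have h11 : (Nat.log 2 (nblk l) + 1) * (180 * nblk l) =
        180 * ((Nat.log 2 (nblk l) + 1) * nblk l) := by
      ring
    simp [v]
    omega

theorem wp_buildRMQ {i : ℕ} {s : State Reg Arr} (sz : Sizes M W m l σ)
    (hL : Lens m l σ s) (hK : Lookup l s) (hi : s.reg .i = i) (him : i ≤ m)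
    (hS : SuffRows x y m l i s) (hst : ∀ a, s.arr .stack a ≤ l)
    (hR : ∀ i', i < i' → i' ≤ m → RMQRow (MCS.sf x y m l i') l i' s) :
    wp M W buildRMQ (fun s' =>
      (∀ i', i ≤ i' → i' ≤ m → RMQRow (MCS.sf x y m l i') l i' s') ∧
      (∀ a, s'.arr .stack a ≤ l) ∧ s'.time ≤ s.time + 1000 * (l + 1)) s := by
  have hS' := fun j h1 h2 => hS i j le_rfl him h1 h2
  change wp M W maskLoop (wp M W sparseLoop _) s
  refine wp_then (wp_maskLoop sz hL hK hi him hS' hst) ?_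
  rintro s₁ hF₁ ⟨h1, h2, h3, h4, h5, h6⟩
  refine wp_then (wp_sparseLoop sz (hL.frame hF₁) (hK.frame hF₁) ((hF₁.reg .i rfl).trans hi) him
    (hF₁.arr .suff rfl ▸ hS') h2) ?_
  rintro s₂ hF₂ ⟨h7, h8, h9⟩
  have h10 := hF₂.arr .mask rfl
  have h11 := hF₂.arr .stack rfl
  have h12 : s₂.time ≤ s.time + 1000 * (l + 1) := by linarith
  refine ⟨fun i' hi' him' => ?_, h11 ▸ h3, h12⟩
  rcases hi'.eq_or_lt with rfl | hlt
  · exact ⟨h10 ▸ h1, h7⟩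
  · refine ⟨fun j hj1 hjl => ?_, fun t p hp => ?_⟩
    · rw [h10, h4]
      · exact (hR i' hlt him').mask j hj1 hjl
      · have : (i + 1) * (l + 1) ≤ i' * (l + 1) := Nat.mul_le_mul_right _ hlt
        omega
    · have h12 : spos l (i + 1) 0 0 ≤ spos l i' t p := by
        have h13 : (i + 1) * (blk l + 1) ≤ i' * (blk l + 1) := Nat.mul_le_mul_right _ hlt
        have h14 : ((i + 1) * (blk l + 1) + 0) * nblk l ≤ (i' * (blk l + 1) + t) * nblk l :=
          Nat.mul_le_mul_right _ (by omega)
        simp only [spos]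
        omega
      rw [h8 _ h12, h5 _ h12]
      exact (hR i' hlt him').sparse t p hp

end Enum221

namespace Enum221

variable {M W m l σ : ℕ} {x y : ℕ → ℕ}

/-- The registers that are constant after the preprocessing. -/
def tableRegs : List Reg := [.m, .l, .σ, .wX, .wY, .b, .nb, .lev]

/-- The arrays that are constant after the preprocessing. -/
def tableArrs : List Arr :=
  [.X, .Y, .nextX, .nextY, .prevX, .prevY, .suff, .pow, .lg, .lsb, .mask, .sparse]

/-- The result of the preprocessing, for strings in normal form. -/
structure Tables (x y : ℕ → ℕ) (m l σ : ℕ) (s : State Reg Arr) : Prop where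
  lens : Lens m l σ s
  strings : Strings x y m l s
  tabX : Table x m σ .nextX .prevX s
  tabY : Table y l σ .nextY .prevY s
  lookup : Lookup l s
  suff : SuffRows x y m l 1 s
  rmq : ∀ i, 1 ≤ i → i ≤ m → RMQRow (MCS.sf x y m l i) l i s

theorem Tables.congr {s s' : State Reg Arr} (h : Tables x y m l σ s)
    (hr : ∀ r ∈ tableRegs, s'.reg r = s.reg r) (ha : ∀ a ∈ tableArrs, s'.arr a = s.arr a) :
    Tables x y m l σ s' := by
  simp only [tableRegs, tableArrs, List.forall_mem_cons, List.not_mem_nil, false_imp_iff,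
    implies_true, and_true] at hr ha
  obtain ⟨⟨h1, h2, h3, h4, h5⟩, ⟨h6, h7⟩, ⟨h8, h9⟩, ⟨h10, h11⟩, ⟨h12, h13, h14, h15, h16, h17⟩,
    h18, h19⟩ := h
  obtain ⟨r1, r2, r3, r4, r5, r6, r7, r8⟩ := hr
  obtain ⟨a1, a2, a3, a4, a5, a6, a7, a8, a9, a10, a11, a12⟩ := ha
  refine ⟨⟨r1.trans h1, r2.trans h2, r3.trans h3, r4.trans h4, r5.trans h5⟩, ⟨a1 ▸ h6, a2 ▸ h7⟩,
    ⟨a3 ▸ h8, a5 ▸ h9⟩, ⟨a4 ▸ h10, a6 ▸ h11⟩, ⟨r6.trans h12, r7.trans h13, r8.trans h14, a9 ▸ h15,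
    a10 ▸ h16, a8 ▸ h17⟩, ?_,
    fun i hi him => ⟨a11 ▸ (h19 i hi him).mask, a12 ▸ (h19 i hi him).sparse⟩⟩
  unfold SuffRows
  rw [a7]
  exact h18

/-- The program has no assignment to what is constant after the preprocessing. -/
def keepsTables (c : Cmd Reg Arr) : Bool :=
  tableRegs.all (fun r => !c.modReg r) && tableArrs.all (fun a => !c.modArr a)

theorem Tables.frame {s s' : State Reg Arr} {c : Cmd Reg Arr} (h : Tables x y m l σ s)
    (hF : Frame c s s') (hc : keepsTables c = true := by rfl) : Tables x y m l σ s' := by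
  simp only [keepsTables, Bool.and_eq_true, List.all_eq_true, Bool.not_eq_true'] at hc
  exact h.congr (fun r hr => hF.reg r (hc.1 r hr)) (fun a ha => hF.arr a (hc.2 a ha))

/-! ### Range minimum queries: the program -/

theorem wp_assign_of {r : Reg} {e : Expr Reg Arr} {Q : State Reg Arr → Prop} {s : State Reg Arr}
    {x : ℕ} (he : e.Safe M W s) (hx : e.val s = x)
    (h : ∀ s', Frame (.assign r e) s s' → s'.reg r = x → s'.time = s.time + (e.cost + 1) → Q s') :
    wp M W (.assign r e) Q s := by
  refine wp_then (Q := fun s' => s'.reg r = x ∧ s'.time = s.time + (e.cost + 1))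
    ⟨he, by simp [hx], by simp⟩ fun s' hF h' => h s' hF h'.1 h'.2

theorem wp_inBlock {dst : Reg} {lo r : Expr Reg Arr} {a c i : ℕ} {s : State Reg Arr}
    (sz : Sizes M W m l σ) (T : Tables x y m l σ s) (hi : s.reg .qi = i) (hi1 : 1 ≤ i)
    (him : i ≤ m) (hlo : lo.Safe M W s) (hr : r.Safe M W s) (hlov : lo.val s = a)
    (hrv : r.val s = c) (ha : 1 ≤ a) (hac : a ≤ c) (hcl : c ≤ l)
    (hblk : (a - 1) / blk l = (c - 1) / blk l) (hcost : lo.cost ≤ 5) (hcost' : r.cost ≤ 5) :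
    wp M W (inBlock dst lo r) (fun s' => LeftMin (MCS.sf x y m l i) a c (s'.reg dst) ∧
      s'.time ≤ s.time + 40) s := by
  have h1 := sz.small
  have h2 := sz.two_le_l
  have h3 := blk_pos h2
  have h4 := blk_lt h2
  have hmod := Nat.mod_lt (a - 1) h3
  have hM := (T.rmq i hi1 him).mask c (by omega) hcl
  obtain ⟨k, q, h5, h6⟩ := hM.query ha hac hblk
  have h7 := (hM.lt h3).trans_le (two_pow_blk_le h2)
  have h8 := Nat.div_le_self (s.arr .mask (i * (l + 1) + c)) (2 ^ ((a - 1) % blk l))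
  have h9 := T.lookup.lsb k q (by omega)
  have h10 := h6.le'
  have h11 := sz.addr (a := i) (b := l + 1) (c := c) (by omega) (by omega) (by omega)
  simp [inBlock, v, hlov, hrv, hi, T.lens.wY, T.lookup.reg_b, T.lookup.pow _ hmod.le, hlo, hr]
  simp only [h5, h9]
  refine ⟨by omega, h6, by omega⟩

theorem wp_improve {a c a' c' i k k' : ℕ} {s : State Reg Arr}
    (sz : Sizes M W m l σ) (T : Tables x y m l σ s) (hi : s.reg .qi = i) (hi1 : 1 ≤ i)
    (him : i ≤ m) (hk : s.reg .res = k) (hk' : s.reg .cand = k')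
    (h : LeftMin (MCS.sf x y m l i) a c k) (h' : LeftMin (MCS.sf x y m l i) a' c' k') (ha : 1 ≤ a)
    (hcl : c' ≤ l) (h1 : a ≤ a') (h2 : a' ≤ c + 1) (h3 : c ≤ c') :
    wp M W improve (fun s' => LeftMin (MCS.sf x y m l i) a c' (s'.reg .res) ∧
      s'.time ≤ s.time + 30) s := by
  have h4 := h.combine h' h1 h2 h3
  have h5 := h.le; have h6 := h.le'; have h7 := h'.le; have h8 := h'.le'
  have h9 := sz.small
  have a1 := sz.addr (a := i) (b := l + 1) (c := k) (by omega) (by omega) (by omega)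
  have a2 := sz.addr (a := i) (b := l + 1) (c := k') (by omega) (by omega) (by omega)
  simp [improve, v, hi, hk, hk', T.lens.wY, T.suff i k hi1 him (by omega) (by omega),
    T.suff i k' hi1 him (by omega) (by omega)]
  refine ⟨by omega, fun hlt => ?_, fun hle => ?_⟩
  · rwa [if_pos hlt] at h4
  · rwa [if_neg hle.not_gt] at h4

theorem wp_rmq {i a c : ℕ} {s : State Reg Arr}
    (sz : Sizes M W m l σ) (T : Tables x y m l σ s) (hi : s.reg .qi = i) (hi1 : 1 ≤ i)
    (him : i ≤ m) (hql : s.reg .ql = a) (hqr : s.reg .qr = c) (ha : 1 ≤ a) (hac : a ≤ c)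
    (hcl : c ≤ l) :
    wp M W rmq (fun s' => LeftMin (MCS.sf x y m l i) a c (s'.reg .res) ∧
      s'.time ≤ s.time + 300) s := by
  have h1 := sz.small
  have h2 := sz.two_le_l
  have h3 := blk_pos h2
  have h4 := blk_lt h2
  have hda := Nat.div_add_mod' (a - 1) (blk l)
  have hdc := Nat.div_add_mod' (c - 1) (blk l)
  have hma := Nat.mod_lt (a - 1) h3
  have hmc := Nat.mod_lt (c - 1) h3
  have hle := Nat.div_le_div_right (c := blk l) (by omega : a - 1 ≤ c - 1)
  have hnb : (c - 1) / blk l < nblk l := by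
    have := Nat.div_le_div_right (c := blk l) (by omega : c - 1 ≤ l - 1)
    simp only [nblk]; omega
  have hnb' := nblk_le l h2
  set bl := (a - 1) / blk l with hbl
  set br := (c - 1) / blk l with hbr
  rw [rmq, wp_seq]
  refine wp_assign_of (x := bl) (by simp [v, T.lookup.reg_b]; omega)
    (by simp [v, T.lookup.reg_b, hql, hbl]) fun s₁ hF₁ hbl₁ ht₁ => ?_
  have T₁ := T.frame hF₁
  have hqr₁ := (hF₁.reg .qr rfl).trans hqr
  rw [wp_seq]
  refine wp_assign_of (x := br) (by simp [v, T₁.lookup.reg_b]; omega)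
    (by simp [v, T₁.lookup.reg_b, hqr₁, hbr]) fun s₂ hF₂ hbr₂ ht₂ => ?_
  have T₂ := T₁.frame hF₂
  have hqr₂ := (hF₂.reg .qr rfl).trans hqr₁
  have hql₂ := (hF₂.reg .ql rfl).trans ((hF₁.reg .ql rfl).trans hql)
  have hqi₂ := (hF₂.reg .qi rfl).trans ((hF₁.reg .qi rfl).trans hi)
  have hbl₂ := (hF₂.reg .bl rfl).trans hbl₁
  simp only [v, cost_div, cost_sub, cost_reg, cost_ofNat] at ht₁ ht₂
  clear hF₁ hF₂ hbl₁ hqr₁ T₁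
  rw [wp_ite]
  simp only [v, safe_eq, safe_reg, holds_eq, val_reg, hbl₂, hbr₂, cost_eq, cost_reg]
  refine ⟨⟨trivial, trivial⟩, fun heq => ?_, fun hne => ?_⟩
  · refine wp_then (wp_inBlock (a := a) (c := c) sz (T₂.congr (fun _ _ => rfl) (fun _ _ => rfl))
      hqi₂ hi1 him trivial trivial hql₂ hqr₂ ha hac hcl heq (by simp) (by simp)) ?_
    rintro s' - ⟨h5, h6⟩
    exact ⟨h5, by simp at h6; omega⟩
  have hlt : bl + 1 ≤ br := by omega
  have hb1 : (bl + 1) * blk l ≤ br * blk l := Nat.mul_le_mul_right _ hlt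
  have hb2 : (bl + 1) * blk l = bl * blk l + blk l := by ring
  have hblk : (a - 1) / blk l = ((bl + 1) * blk l - 1) / blk l := by
    rw [← hbl, show (bl + 1) * blk l - 1 = (blk l - 1) + bl * blk l by omega,
      Nat.add_mul_div_right _ _ h3, Nat.div_eq_of_lt (by omega), zero_add]
  have hblk' : (br * blk l + 1 - 1) / blk l = (c - 1) / blk l := by
    rw [Nat.add_sub_cancel, Nat.mul_div_cancel _ h3]
  rw [wp_seq]
  refine wp_then (wp_inBlock (a := a) (c := (bl + 1) * blk l) sz
    (T₂.congr (fun _ _ => rfl) (fun _ _ => rfl)) hqi₂ hi1 him trivial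
    (by simp [hbl₂, T₂.lookup.reg_b]; omega) hql₂ (by simp [hbl₂, T₂.lookup.reg_b]) ha
    (by omega) (by omega) hblk (by simp) (by simp)) ?_
  rintro s₃ hF₃ ⟨h5, h6⟩
  simp only [tick_time] at h6
  have T₃ := T₂.frame (c := inBlock .res (v .ql) ((v .bl + 1) * v .b)) ⟨hF₃.reg, hF₃.arr, hF₃.out⟩
  have hqr₃ := (hF₃.reg .qr rfl).trans hqr₂
  have hqi₃ := (hF₃.reg .qi rfl).trans hqi₂
  have hbl₃ := (hF₃.reg .bl rfl).trans hbl₂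
  have hbr₃ := (hF₃.reg .br rfl).trans hbr₂
  rw [wp_seq]
  refine wp_then (Q := fun s' => LeftMin (MCS.sf x y m l i) a (br * blk l) (s'.reg .res) ∧
    s'.time ≤ s.time + 220) ?_ ?_
  · rw [wp_ite]
    simp only [safe_lt, safe_reg, safe_add, safe_ofNat, holds_lt, val_reg, val_add, val_ofNat,
      hbl₃, hbr₃, cost_lt, cost_reg, cost_add, cost_ofNat]
    refine ⟨⟨⟨trivial, by omega, by omega⟩, trivial⟩, fun hlt' => ?_, fun hge => ?_⟩
    · have hlog := Nat.pow_log_le_self 2 (by omega : br - bl - 1 ≠ 0)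
      have hlog' := Nat.lt_pow_succ_log_self one_lt_two (br - bl - 1)
      have hlog'' := (Nat.log_mono_right (b := 2) (by omega : br - bl - 1 ≤ nblk l)).trans
        (log_nblk_le h2)
      set t := Nat.log 2 (br - bl - 1) with ht
      rw [pow_succ] at hlog'
      have h2t : 0 < 2 ^ t := by positivity
      have hlg := T₃.lookup.lg (br - bl - 1) (by omega) (by omega)
      rw [wp_seq]
      refine wp_assign_of (x := t) (by simp [hbl₃, hbr₃]; omega)
        (by simp [hbl₃, hbr₃, hlg, ht]) fun s₄ hF₄ ht₄ h7 => ?_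
      have T₄ := T₃.frame (c := .assign .qt (.get .lg (v .br - v .bl - 1)))
        ⟨hF₄.reg, hF₄.arr, hF₄.out⟩
      have hqi₄ := (hF₄.reg .qi rfl).trans hqi₃
      have hbl₄ := (hF₄.reg .bl rfl).trans hbl₃
      have hbr₄ := (hF₄.reg .br rfl).trans hbr₃
      have hres₄ := hF₄.reg .res rfl
      have e1 := (T₄.rmq i hi1 him).sparse t (bl + 1) (by omega)
      have e2 := (T₄.rmq i hi1 him).sparse t (br - 2 ^ t) (by omega)
      have a1 := spos_bounds sz him hlog'' (by omega : bl + 1 < nblk l)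
      have a2 := spos_bounds sz him hlog'' (by omega : br - 2 ^ t < nblk l)
      have hm1 : (bl + 1 + 2 ^ t) * blk l ≤ br * blk l := Nat.mul_le_mul_right _ (by omega)
      have hm2 : (bl + 1) * blk l ≤ (bl + 1 + 2 ^ t) * blk l := Nat.mul_le_mul_right _ (by omega)
      have hm3 : (br - 2 ^ t) * blk l ≤ (bl + 1 + 2 ^ t) * blk l :=
        Nat.mul_le_mul_right _ (by omega)
      have hm4 : (bl + 1) * blk l ≤ (br - 2 ^ t) * blk l := Nat.mul_le_mul_right _ (by omega)
      rw [min_eq_left (by omega)] at e1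
      rw [Nat.sub_add_cancel (by omega), min_eq_left (by omega)] at e2
      rw [wp_seq]
      refine wp_assign_of (x := s₄.arr .sparse (spos l i t (bl + 1)))
        (by simp [sparseAt, v, hqi₄, ht₄, hbl₄, T₄.lookup.reg_lev, T₄.lookup.reg_nb];
            simp only [spos] at a1; omega)
        (by simp [sparseAt, v, hqi₄, ht₄, hbl₄, T₄.lookup.reg_lev, T₄.lookup.reg_nb, spos])
        fun s₅ hF₅ hc₅ h8 => ?_
      have T₅ := T₄.frame (c := .assign .cand (.get .sparse (sparseAt (v .qi) (v .qt) (v .bl + 1))))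
        ⟨hF₅.reg, hF₅.arr, hF₅.out⟩
      have hqi₅ := (hF₅.reg .qi rfl).trans hqi₄
      have hbr₅ := (hF₅.reg .br rfl).trans hbr₄
      have ht₅ := (hF₅.reg .qt rfl).trans ht₄
      have hres₅ := (hF₅.reg .res rfl).trans hres₄
      have hsp₅ := hF₅.arr .sparse rfl
      rw [wp_seq]
      refine wp_then (wp_improve sz T₅ hqi₅ hi1 him hres₅ hc₅ h5 e1 ha (by omega) (by omega)
        (by omega) (by omega)) ?_
      rintro s₆ hF₆ ⟨h9, h10⟩
      have T₆ := T₅.frame hF₆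
      have hqi₆ := (hF₆.reg .qi rfl).trans hqi₅
      have hbr₆ := (hF₆.reg .br rfl).trans hbr₅
      have ht₆ := (hF₆.reg .qt rfl).trans ht₅
      have hsp₆ := (hF₆.arr .sparse rfl).trans hsp₅
      rw [wp_seq]
      refine wp_assign_of (x := s₄.arr .sparse (spos l i t (br - 2 ^ t)))
        (by simp [sparseAt, v, hqi₆, ht₆, hbr₆, T₆.lookup.reg_lev, T₆.lookup.reg_nb,
              T₆.lookup.pow t hlog''];
            simp only [spos] at a2; omega)
        (by simp [sparseAt, v, hqi₆, ht₆, hbr₆, T₆.lookup.reg_lev, T₆.lookup.reg_nb, spos,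
              T₆.lookup.pow t hlog'', hsp₆])
        fun s₇ hF₇ hc₇ h11 => ?_
      have T₇ := T₆.frame (c := .assign .cand
        (.get .sparse (sparseAt (v .qi) (v .qt) (v .br - .get .pow (v .qt)))))
        ⟨hF₇.reg, hF₇.arr, hF₇.out⟩
      have hqi₇ := (hF₇.reg .qi rfl).trans hqi₆
      have hres₇ := hF₇.reg .res rfl
      refine wp_then (wp_improve sz T₇ hqi₇ hi1 him hres₇ hc₇ h9 e2 ha (by omega) (by omega)
        (by omega) (by omega)) ?_
      rintro s₈ - ⟨h12, h13⟩
      refine ⟨h12, ?_⟩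
      simp [sparseAt, v] at h7 h8 h11
      omega
    · have : br = bl + 1 := by omega
      rw [this]
      exact ⟨h5, by simp; omega⟩
  · rintro s₄ hF₄ ⟨h7, h8⟩
    have T₄ := T₃.frame hF₄
    have hqi₄ := (hF₄.reg .qi rfl).trans hqi₃
    have hqr₄ := (hF₄.reg .qr rfl).trans hqr₃
    have hbr₄ := (hF₄.reg .br rfl).trans hbr₃
    rw [wp_seq]
    refine wp_then (wp_inBlock (a := br * blk l + 1) (c := c) sz T₄ hqi₄ hi1 him
      (by simp [hbr₄, T₄.lookup.reg_b]; omega) trivial (by simp [hbr₄, T₄.lookup.reg_b]) hqr₄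
      (by omega) (by omega) hcl hblk' (by simp) (by simp)) ?_
    rintro s₅ hF₅ ⟨h9, h10⟩
    have T₅ := T₄.frame (c := inBlock .cand (v .br * v .b + 1) (v .qr)) ⟨hF₅.reg, hF₅.arr, hF₅.out⟩
    refine wp_then (wp_improve sz T₅ ((hF₅.reg .qi rfl).trans hqi₄) hi1 him (hF₅.reg .res rfl)
      rfl h7 h9 ha hcl (by omega) le_rfl (by omega)) ?_
    rintro s₆ - ⟨h11, h12⟩
    exact ⟨h11, by omega⟩

end Enum221

namespace Enum221

variable {M W m l σ : ℕ} {x y : ℕ → ℕ}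

/-! ### The whole preprocessing -/

/-- The last part of the preprocessing: the construction of the sequences `Suff_i` and of their
structures for range minimum queries, for descending `i`. -/
def buildD221 : Cmd Reg Arr :=
  initSuff ;;
  .assign .i (v .m) ;; buildRMQ ;;
  .forDown .i (v .m - 1) (updateSuff ;; buildRMQ)

theorem wp_buildD221 {s : State Reg Arr} (sz : Sizes M W m l σ) (hL : Lens m l σ s)
    (hS : Strings x y m l s) (hTx : Table x m σ .nextX .prevX s) (hTy : Table y l σ .nextY .prevY s)
    (hK : Lookup l s) (hst : ∀ a, s.arr .stack a ≤ l)
    (hx : MCS.Ends x m σ) (hy : MCS.Ends y l σ) (hxσ : ∀ k, 1 ≤ k → k ≤ m → 1 ≤ x k ∧ x k ≤ σ) :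
    wp M W buildD221 (fun s' => Tables x y m l σ s' ∧
      s'.time ≤ s.time + (m + 1) * (1200 * (l + 1))) s := by
  have h1 := sz.small
  have h2 := sz.two_le_m
  set B := 1200 * (l + 1) with hB
  rw [buildD221, wp_seq]
  refine wp_then (wp_initSuff sz hL hx hy) ?_
  rintro s₁ hF₁ ⟨h3, h4⟩
  rw [wp_seq]
  refine wp_assign_of (x := m) trivial ((hL.frame hF₁).reg_m) ?_
  intro s₂ hF₂ hi₂ ht₂
  have hL₂ := (hL.frame hF₁).frame hF₂
  rw [wp_seq]
  refine wp_then (wp_buildRMQ (x := x) (y := y) (i := m) sz hL₂ ((hK.frame hF₁).frame hF₂)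
    hi₂ le_rfl
    (h3.frame hF₂) (hF₂.arr .stack rfl ▸ hF₁.arr .stack rfl ▸ hst) fun i' _ _ => by omega) ?_
  rintro s₃ hF₃ ⟨h5, h6, h7⟩
  have hL₃ := hL₂.frame hF₃
  have hK₃ := ((hK.frame hF₁).frame hF₂).frame hF₃
  have hS₃ := ((hS.frame hF₁).frame hF₂).frame hF₃
  have hTx₃ := ((hTx.frame hF₁).frame hF₂).frame hF₃
  have hTy₃ := ((hTy.frame hF₁).frame hF₂).frame hF₃
  have hR₃ := (h3.frame hF₂).frame hF₃
  have hv : (v .m).cost = 1 := rfl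
  rw [hv] at ht₂
  refine wp_forDown (m - 1) (fun i s' => SuffRows x y m l (i + 1) s' ∧
    (∀ i', i + 1 ≤ i' → i' ≤ m → RMQRow (MCS.sf x y m l i') l i' s') ∧
    (∀ a, s'.arr .stack a ≤ l) ∧ s'.time + i * B ≤ s₃.time + 10 + (m - 1) * B)
    (by simp [v]; omega) (by simp [v, hL₃.reg_m]) (by omega) ?_ ?_ ?_
  · rw [Nat.sub_add_cancel (by omega)]
    refine ⟨hR₃, fun i' h8 h9 => ⟨(h5 i' h8 h9).mask, (h5 i' h8 h9).sparse⟩, h6, by simp [v]⟩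
  · rintro i s' hi hF hi' ⟨h8, h9, h10, h11⟩
    rw [wp_seq]
    have hL' := hL₃.frame hF
    have hF0 : ∀ {c : Cmd Reg Arr}, Frame c s' (s'.tick 4) := ⟨fun _ _ => rfl, fun _ _ => rfl,
      fun _ => ⟨rfl, rfl⟩⟩
    refine wp_then (wp_updateSuff (s := s'.tick 4) (i := i + 1) sz (hL'.frame (c := .skip) hF0)
      ((hS₃.frame hF).frame (c := .skip) hF0) ((hTx₃.frame hF).frame (c := .skip) hF0)
      ((hTy₃.frame hF).frame (c := .skip) hF0) (h8.frame (c := .skip) hF0) hi' (by omega) (by omega)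
      hx hy hxσ) ?_
    rintro s'' hF' ⟨h12, h13⟩
    have hi'' := (hF'.reg .i rfl).trans hi'
    have emask := hF'.arr .mask rfl
    have esparse := hF'.arr .sparse rfl
    refine wp_then (wp_buildRMQ (x := x) (y := y) (i := i + 1) sz
      ((hL'.frame (c := .skip) hF0).frame hF')
      (((hK₃.frame hF).frame (c := .skip) hF0).frame hF') hi'' (by omega) h12
      (hF'.arr .stack rfl ▸ h10) fun i' h14 h15 => ?_) ?_
    · exact ⟨emask ▸ (h9 i' h14 h15).mask, esparse ▸ (h9 i' h14 h15).sparse⟩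
    · rintro s₄ hF₄ ⟨h16, h17, h18⟩
      have h19 := h12.frame hF₄
      refine ⟨(hF₄.reg .i rfl).trans hi'', h19,
        fun i' h14 h15 => ⟨(h16 i' h14 h15).mask, (h16 i' h14 h15).sparse⟩, h17, ?_⟩
      simp only [setReg_time, tick_time] at h13 ⊢
      rw [add_mul, one_mul] at h11
      linarith
  · rintro s₄ hF₄ - ⟨h8, h9, h10, h11⟩
    have hF0 : ∀ {c : Cmd Reg Arr}, Frame c s₄ (s₄.tick 4) := ⟨fun _ _ => rfl, fun _ _ => rfl,
      fun _ => ⟨rfl, rfl⟩⟩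
    refine ⟨⟨(hL₃.frame hF₄).frame (c := .skip) hF0, (hS₃.frame hF₄).frame (c := .skip) hF0,
      (hTx₃.frame hF₄).frame (c := .skip) hF0, (hTy₃.frame hF₄).frame (c := .skip) hF0,
      (hK₃.frame hF₄).frame (c := .skip) hF0, h8,
      fun i h12 h13 => ⟨(h9 i h12 h13).mask, (h9 i h12 h13).sparse⟩⟩, ?_⟩
    have h12 : (m + 1) * B = (m - 1) * B + 2 * B := by
      obtain ⟨k, rfl⟩ : ∃ k, m = k + 1 := ⟨m - 1, by omega⟩
      rw [Nat.add_sub_cancel]; ring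
    simp only [tick_time, h12]
    linarith

theorem chars_normalForm_bounds {X Y S : List ℕ} (hS : S ⊆ X ++ Y) (k : ℕ) (h1 : 1 ≤ k)
    (h2 : k ≤ S.length + 2) : 1 ≤ MCS.chars (normalForm X Y S) k ∧
      MCS.chars (normalForm X Y S) k ≤ X.length + Y.length + 2 := by
  obtain rfl | rfl | ⟨k, hk, rfl⟩ :
      k = 1 ∨ k = S.length + 2 ∨ ∃ k', k' < S.length ∧ k = k' + 2 := by
    by_cases h3 : k = 1
    · exact Or.inl h3
    · by_cases h4 : k = S.length + 2
      · exact Or.inr (Or.inl h4)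
      · exact Or.inr (Or.inr ⟨k - 2, by omega, by omega⟩)
  · rw [MCS.chars_normalForm_one]; omega
  · rw [MCS.chars_normalForm_last]; omega
  · rw [MCS.chars_normalForm_mid hk]
    have := MCS.encode_bounds (hS (List.getElem_mem hk))
    omega

theorem wp_preprocessing {X Y : List ℕ} {s : State Reg Arr}
    (sz : Sizes M W (X.length + 2) (Y.length + 2) (X.length + Y.length + 2)) (hs : Input X Y s)
    (hst : ∀ a, s.arr .stack a = 0) :
    wp M W preprocessing (fun s' => Tables (MCS.chars (normalForm X Y X))
      (MCS.chars (normalForm X Y Y)) (X.length + 2) (Y.length + 2) (X.length + Y.length + 2) s' ∧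
      s'.time ≤ s.time + 2000 * (X.length + Y.length + 4) ^ 2) s := by
  have hX : X ⊆ X ++ Y := by simp
  have hY : Y ⊆ X ++ Y := by simp
  have hx := MCS.ends_normalForm hX
  have hy := MCS.ends_normalForm hY
  rw [MCS.normalForm_length] at hx hy
  have hxσ := chars_normalForm_bounds hX
  change wp M W (initLengths ;; buildStrings ;; buildTable .X .nextX .prevX .m .wX ;;
    buildTable .Y .nextY .prevY .l .wY ;; buildLookup ;; buildD221) _ s
  rw [wp_seq]
  refine wp_then (wp_initLengths sz hs) ?_
  rintro s₁ hF₁ ⟨L₁, t₁⟩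
  rw [wp_seq]
  refine wp_then (wp_buildStrings sz (hs.frame hF₁) L₁) ?_
  rintro s₂ hF₂ ⟨S₂, t₂⟩
  have L₂ := L₁.frame hF₂
  rw [wp_seq]
  refine wp_then (wp_buildTable (Or.inl ⟨rfl, rfl, rfl, rfl, rfl⟩) sz L₂.reg_m L₂.wX L₂.reg_σ S₂.X
    (by omega)) ?_
  rintro s₃ hF₃ ⟨Tx, t₃⟩
  have L₃ := L₂.frame hF₃
  have S₃ := S₂.frame hF₃
  rw [wp_seq]
  refine wp_then (wp_buildTable (Or.inr ⟨rfl, rfl, rfl, rfl, rfl⟩) sz L₃.reg_l L₃.wY L₃.reg_σ S₃.Y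
    (by omega)) ?_
  rintro s₄ hF₄ ⟨Ty, t₄⟩
  have L₄ := L₃.frame hF₄
  rw [wp_seq]
  refine wp_then (wp_buildLookup sz L₄) ?_
  rintro s₅ hF₅ ⟨K₅, t₅⟩
  have hst' : s₅.arr .stack = s.arr .stack := by
    rw [hF₅.arr .stack rfl, hF₄.arr .stack rfl, hF₃.arr .stack rfl, hF₂.arr .stack rfl,
      hF₁.arr .stack rfl]
  refine wp_then (wp_buildD221 sz (L₄.frame hF₅) ((S₃.frame hF₄).frame hF₅)
    ((Tx.frame hF₄).frame hF₅) (Ty.frame hF₅) K₅ (fun a => by rw [hst', hst]; omega) hx hy hxσ) ?_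
  rintro s₆ - ⟨T₆, t₆⟩
  refine ⟨T₆, ?_⟩
  set a := X.length
  set b := Y.length
  nlinarith

end Enum221

namespace Enum221

variable {M W m l σ : ℕ} {x y : ℕ → ℕ}

/-! ### Enumeration: the characters that continue a prefix -/

theorem wit_iff {S : ℕ → ℕ} {q lim h r j : ℕ} (hr : LeftMin S (q + 1) h r) (hS : S r ≤ lim) :
    MCS.Wit S q lim h j ↔ j = r ∨ MCS.Wit S q lim (r - 1) j := by
  have h1 := hr.le
  have h2 := hr.le'
  constructor
  · rintro ⟨h3, h4, h5, h6⟩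
    rcases lt_trichotomy j r with hlt | rfl | hlt
    · exact Or.inr ⟨h3, by omega, h5, h6⟩
    · exact Or.inl rfl
    · have := h6 r (by omega) hlt
      have := hr.right j hlt h4
      omega
  · rintro (rfl | ⟨h3, h4, h5, h6⟩)
    · exact ⟨by omega, h2, hS, fun j' h3 h4 => hr.left j' (by omega) h4⟩
    · exact ⟨h3, by omega, h5, h6⟩

theorem not_wit {S : ℕ → ℕ} {q lim h r j : ℕ} (hr : LeftMin S (q + 1) h r) (hS : lim < S r) :
    ¬ MCS.Wit S q lim h j := by
  rintro ⟨h3, h4, h5, h6⟩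
  rcases lt_trichotomy j r with hlt | rfl | hlt
  · have := hr.left j (by omega) hlt
    omega
  · omega
  · have := hr.right j hlt h4
    omega

/-- The list `L` is in the array at the positions from `e`. -/
def Segment (f : ℕ → ℕ) (e : ℕ) (L : List ℕ) : Prop := ∀ k (hk : k < L.length), f (e + k) = L[k]

/-- The state after a part of the search for witnesses, namely for those above `h`: these are the
elements of `F`, and `L` is the list of their distinct characters. -/
structure Found (S y : ℕ → ℕ) (q lim h₀ e h : ℕ) (F : Finset ℕ) (L : List ℕ)
    (alt mark : ℕ → ℕ) (top : ℕ) : Prop where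
  wit : ∀ j, MCS.Wit S q lim h₀ j ↔ j ∈ F ∨ MCS.Wit S q lim h j
  lt : ∀ j ∈ F, h < j
  mem : ∀ c, c ∈ L ↔ ∃ j ∈ F, y j = c
  nodup : L.Nodup
  card : L.length ≤ F.card
  seg : Segment alt e L
  mark : ∀ c, mark c = if c ∈ L then 1 else 0
  top : top = e + L.length

variable {S alt mark : ℕ → ℕ} {q lim h₀ e h r top : ℕ} {F : Finset ℕ} {L : List ℕ}

theorem Found.new (hF : Found S y q lim h₀ e h F L alt mark top) (hr : LeftMin S (q + 1) h r)
    (hS : S r ≤ lim) (hm : mark (y r) = 0) :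
    Found S y q lim h₀ e (r - 1) (insert r F) (L ++ [y r])
      (Function.update alt (e + L.length) (y r))
      (Function.update mark (y r) 1) (e + L.length + 1) := by
  have h1 := hr.le
  have h2 := hr.le'
  have hrF : r ∉ F := fun h' => by have := hF.lt r h'; omega
  have hcL : y r ∉ L := fun h' => by simp [hF.mark, h'] at hm
  refine ⟨fun j => ?_, fun j hj => ?_, fun c => ?_, ?_, ?_, fun k hk => ?_, fun c => ?_, ?_⟩
  · rw [hF.wit j, wit_iff hr hS, Finset.mem_insert]
    tauto
  · rw [Finset.mem_insert] at hj
    rcases hj with rfl | hj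
    · omega
    · have := hF.lt j hj
      omega
  · simp [hF.mem, or_comm, eq_comm]
  · simpa [List.nodup_append, hF.nodup] using fun a ha (h : a = y r) => hcL (h ▸ ha)
  · have := hF.card
    simp [hrF]; omega
  · rw [List.length_append, List.length_singleton] at hk
    rw [Function.update_apply]
    split_ifs with he
    · simp [(by omega : k = L.length)]
    · rw [hF.seg k (by omega), List.getElem_append_left]
  · rw [Function.update_apply, hF.mark c]
    simp only [List.mem_append, List.mem_singleton]
    split_ifs <;> first | rfl | tauto
  · simp; omega

theorem Found.old (hF : Found S y q lim h₀ e h F L alt mark top) (hr : LeftMin S (q + 1) h r)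
    (hS : S r ≤ lim) (hm : mark (y r) ≠ 0) :
    Found S y q lim h₀ e (r - 1) (insert r F) L alt mark top := by
  have h1 := hr.le
  have h2 := hr.le'
  have hrF : r ∉ F := fun h' => by have := hF.lt r h'; omega
  have hcL : y r ∈ L := by
    by_contra h'
    simp [hF.mark, h'] at hm
  refine ⟨fun j => ?_, fun j hj => ?_, fun c => ⟨fun hc => ?_, ?_⟩, hF.nodup, ?_, hF.seg, hF.mark,
    hF.top⟩
  · rw [hF.wit j, wit_iff hr hS, Finset.mem_insert]
    tauto
  · rw [Finset.mem_insert] at hj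
    rcases hj with rfl | hj
    · omega
    · have := hF.lt j hj
      omega
  · obtain ⟨j, hj, hc⟩ := (hF.mem c).1 hc
    exact ⟨j, Finset.mem_insert_of_mem hj, hc⟩
  · rintro ⟨j, hj, rfl⟩
    rw [Finset.mem_insert] at hj
    rcases hj with rfl | hj
    · exact hcL
    · exact (hF.mem _).2 ⟨j, hj, rfl⟩
  · have := hF.card
    simp [hrF]; omega

theorem Found.finish (hF : Found S y q lim h₀ e h F L alt mark top)
    (hw : ∀ j, ¬ MCS.Wit S q lim h j) : Found S y q lim h₀ e 0 F L alt mark top := by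
  refine ⟨fun j => ?_, fun j hj => ?_, hF.mem, hF.nodup, hF.card, hF.seg, hF.mark, hF.top⟩
  · rw [hF.wit j]
    refine or_congr_right ⟨fun h => absurd h (hw j), fun h => ?_⟩
    have := h.1; have := h.2.1; omega
  · have := hF.lt j hj
    omega

/-- The loop over the witnesses. -/
def queryLoop : Cmd Reg Arr :=
  .while (.lt (v .pJ) (v .hi))
    (.assign .qr (v .hi) ;; rmq ;;
     .ite (.le (.get .suff (v .qi * v .wY + v .res)) (v .lim))
      (.assign .c (.get .Y (v .res)) ;;
       .ite (.eq (.get .mark (v .c)) 0)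
        (.store .mark (v .c) 1 ;; .store .alt (v .top) (v .c) ;; .assign .top (v .top + 1))
        .skip ;;
       .assign .hi (v .res - 1))
      (.assign .hi 0))

theorem wp_queryLoop {p q lim h₀ e : ℕ} {s : State Reg Arr} (sz : Sizes M W m l σ)
    (T : Tables x y m l σ s) (hyσ : ∀ k, 1 ≤ k → k ≤ l → 1 ≤ y k ∧ y k ≤ σ)
    (hqi : s.reg .qi = p + 1) (hq : s.reg .pJ = q) (hql : s.reg .ql = q + 1)
    (hlim : s.reg .lim = lim) (hhi : s.reg .hi = h₀) (htop : s.reg .top = e) (hpm : p < m)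
    (hh₀ : h₀ ≤ l) (hmark : ∀ c, s.arr .mark c = 0) (heM : e + l < M) :
    wp M W queryLoop (fun s' => ∃ (F : Finset ℕ) (L : List ℕ),
      Found (MCS.sf x y m l (p + 1)) y q lim h₀ e 0 F L (s'.arr .alt)
        (s'.arr .mark) (s'.reg .top) ∧
      (∀ a < e, s'.arr .alt a = s.arr .alt a) ∧ s'.time ≤ s.time + 500 * (F.card + 1)) s := by
  have h1 := sz.small
  have h2 := sz.sigma
  set S := MCS.sf x y m l (p + 1) with hS
  refine wp_while (fun s' => ∃ (F : Finset ℕ) (L : List ℕ), s'.reg .hi ≤ h₀ ∧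
      Found S y q lim h₀ e (s'.reg .hi) F L (s'.arr .alt) (s'.arr .mark) (s'.reg .top) ∧
      (∀ a < e, s'.arr .alt a = s.arr .alt a) ∧
      s'.time + 450 * min (s'.reg .hi) 1 ≤ s.time + 450 * (F.card + 1)) (fun s' => s'.reg .hi) ?_ ?_
  · refine ⟨∅, [], hhi.le, ⟨fun j => by simp [hhi], by simp, by simp, by simp, by simp,
      fun k hk => by simp at hk, by simp [hmark], by simp [htop]⟩, fun _ _ => rfl, ?_⟩
    have := min_le_right (s.reg .hi) 1
    simp only [Finset.card_empty]
    omega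
  · rintro s' hF ⟨F, L, hhi', hFd, halt, htime⟩
    have T' := T.frame hF
    have eqi := (hF.reg .qi rfl).trans hqi
    have eq := (hF.reg .pJ rfl).trans hq
    have eql := (hF.reg .ql rfl).trans hql
    have elim := (hF.reg .lim rfl).trans hlim
    simp only [v, safe_lt, safe_reg, holds_lt, val_reg, eq, cost_lt, cost_reg, wp_seq]
    refine ⟨⟨trivial, trivial⟩, fun hlt => ?_, fun hge => ?_⟩
    · set h := s'.reg .hi with hh
      have hmin : min h 1 = 1 := by omega
      rw [hmin] at htime
      refine wp_assign_of (x := h) trivial rfl fun s₁ F₁ qr₁ time₁ => ?_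
      have T₁ : Tables x y m l σ s₁ := T'.frame (c := .assign .qr (v .hi)) ⟨F₁.reg, F₁.arr, F₁.out⟩
      rw [wp_seq]
      refine wp_then (wp_rmq (i := p + 1) (a := q + 1) sz T₁ ((F₁.reg .qi rfl).trans eqi) (by omega)
        (by omega) ((F₁.reg .ql rfl).trans eql) qr₁ (by omega) (by omega) (by omega)) ?_
      rintro s₂ F₂ ⟨hmn, time₂⟩
      have T₂ := T₁.frame F₂
      simp only [tick_time, cost_reg] at time₁
      have r1 := hmn.le
      have r2 := hmn.le'
      set r := s₂.reg .res with hr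
      have lim₂ : s₂.reg .lim = lim := (F₂.reg .lim rfl).trans ((F₁.reg .lim rfl).trans elim)
      have qi₂ : s₂.reg .qi = p + 1 := (F₂.reg .qi rfl).trans ((F₁.reg .qi rfl).trans eqi)
      have top₂ : s₂.reg .top = e + L.length :=
        (F₂.reg .top rfl).trans ((F₁.reg .top rfl).trans hFd.top)
      have mark₂ : s₂.arr .mark = s'.arr .mark := (F₂.arr .mark rfl).trans (F₁.arr .mark rfl)
      have alt₂ : s₂.arr .alt = s'.arr .alt := (F₂.arr .alt rfl).trans (F₁.arr .alt rfl)
      have suff₂ : s₂.arr .suff ((p + 1) * (l + 1) + r) = S r :=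
        T₂.suff (p + 1) r (by omega) (by omega) (by omega) (by omega)
      have Y₂ := T₂.strings.Y r (by omega) (by omega)
      have hc := hyσ r (by omega) (by omega)
      have ha := sz.addr (a := p + 1) (b := l + 1) (c := r) (by omega) (by omega) (by omega)
      have hcard : F.card ≤ h₀ - h := by
        have hsub : F ⊆ Finset.Ioc h h₀ := fun j hj => by
          rw [Finset.mem_Ioc]
          exact ⟨hFd.lt j hj, ((hFd.wit j).2 (Or.inl hj)).2.1⟩
        simpa using Finset.card_le_card hsub
      have hcL := hFd.card
      have hrF : r ∉ F := fun h' => by have := hFd.lt r h'; omega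
      rw [← alt₂, ← mark₂, hFd.top] at hFd
      have hcard' : (insert r F).card = F.card + 1 := by simp [hrF]
      simp [lim₂, qi₂, T₂.lens.wY, suff₂, Y₂, ← hr, top₂]
      rw [← alt₂] at halt
      refine ⟨by omega, fun hle => ⟨by omega, by omega, fun h0 => ?_, fun h0 => ?_⟩, fun hgt => ?_⟩
      · refine ⟨by omega, by omega, by omega, by omega, by omega,
          ⟨by omega, insert r F, ⟨_, hFd.new hmn hle h0⟩, fun a ha => ?_, ?_⟩, by omega⟩
        · rw [Function.update_of_ne (by omega), halt a ha]
        · have := min_le_right (r - 1) 1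
          omega
      · refine ⟨by omega, ⟨by omega, insert r F, ⟨_, hFd.old hmn hle h0⟩, halt, ?_⟩, by omega⟩
        have := min_le_right (r - 1) 1
        omega
      · exact ⟨⟨F, ⟨_, hFd.finish fun j => not_wit hmn hgt⟩, halt, by omega⟩, by omega⟩
    · refine ⟨F, L, hFd.finish fun j hw => ?_, halt, by simp; omega⟩
      have := hw.1; have := hw.2.1; omega

/-- The initialization of the loop over the witnesses. -/
def queryStart : Cmd Reg Arr :=
  .assign .top (.get .altEnd (v .len)) ;;
  .assign .qi (v .pI + 1) ;;
  .assign .ql (v .pJ + 1) ;;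
  .assign .lim (v .sI) ;; setMin .lim (v .m) ;;
  .assign .hi (v .sJ) ;; setMin .hi (v .l)

theorem wp_queryStart {p q s₀ t₀ e : ℕ} {s : State Reg Arr} (sz : Sizes M W m l σ)
    (hL : Lens m l σ s) (hlen : s.reg .len < M) (he : s.arr .altEnd (s.reg .len) = e)
    (hp : s.reg .pI = p) (hq : s.reg .pJ = q) (hs₀ : s.reg .sI = s₀) (ht₀ : s.reg .sJ = t₀)
    (hpm : p < m) (hql : q < l) :
    wp M W queryStart (fun s' => s'.reg .top = e ∧ s'.reg .qi = p + 1 ∧ s'.reg .ql = q + 1 ∧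
      s'.reg .lim = min s₀ m ∧ s'.reg .hi = min t₀ l ∧ s'.time ≤ s.time + 100) s := by
  have h1 := sz.small
  simp [queryStart, setMin, v, he, hp, hq, hs₀, ht₀, hL.reg_m, hL.reg_l]
  refine ⟨hlen, by omega, by omega, fun h2 => ⟨fun h3 => ?_, fun h3 => ?_⟩,
    fun h2 => ⟨fun h3 => ?_, fun h3 => ?_⟩⟩ <;> omega

/-- The removal of the marks. -/
def queryClear : Cmd Reg Arr :=
  .assign .p (.get .altEnd (v .len)) ;;
  .while (.lt (v .p) (v .top))
    (.store .mark (.get .alt (v .p)) 0 ;; .assign .p (v .p + 1))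

theorem wp_queryClear {s : State Reg Arr} (hlen : s.reg .len < M)
    (he : s.arr .altEnd (s.reg .len) = e) (htop : s.reg .top = e + L.length)
    (hseg : Segment (s.arr .alt) e L) (hmark : ∀ c, c ∉ L → s.arr .mark c = 0)
    (hLM : ∀ c ∈ L, c < M) (heM : e + L.length < M) (hMW : M ≤ W) :
    wp M W queryClear (fun s' => (∀ c, s'.arr .mark c = 0) ∧
      s'.time ≤ s.time + 20 * (L.length + 1)) s := by
  rw [queryClear, wp_seq]
  refine wp_assign_of (x := e) (by simpa [v] using hlen) (by simp [v, he]) fun s₁ F₁ p₁ time₁ => ?_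
  have alt₁ := F₁.arr .alt rfl
  have mark₁ := F₁.arr .mark rfl
  have top₁ := F₁.reg .top rfl
  simp [v] at time₁
  refine wp_while (fun s' => ∃ k ≤ L.length, s'.reg .p = e + k ∧
    (∀ c, c ∉ L.drop k → s'.arr .mark c = 0) ∧ s'.time ≤ s₁.time + 20 * k)
    (fun s' => e + L.length - s'.reg .p) ⟨0, by omega, p₁, by simpa [mark₁] using hmark, by simp⟩ ?_
  rintro s' hF ⟨k, hk, hp, h1, h2⟩
  have alt' : s'.arr .alt = s.arr .alt := (hF.arr .alt rfl).trans alt₁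
  have top' : s'.reg .top = e + L.length := (hF.reg .top rfl).trans (top₁.trans htop)
  simp [v, hp, alt', top']
  refine ⟨fun hlt => ?_, fun hge => ?_⟩
  · rw [hseg k hlt]
    have hc := hLM _ (List.getElem_mem hlt)
    refine ⟨by omega, by omega, by omega, ⟨k + 1, hlt, by omega,
      fun c hc => ?_, by omega⟩, by omega⟩
    rw [Function.update_apply]
    split_ifs with hce
    · rfl
    · refine h1 c ?_
      rw [List.drop_eq_getElem_cons hlt, List.mem_cons]
      tauto
  · obtain rfl : k = L.length := by omega
    exact ⟨fun c => h1 c (by simp), by omega⟩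

theorem wp_queryExt {p q s₀ t₀ e : ℕ} {s : State Reg Arr} (sz : Sizes M W m l σ)
    (T : Tables x y m l σ s) (hyσ : ∀ k, 1 ≤ k → k ≤ l → 1 ≤ y k ∧ y k ≤ σ)
    (hlen : s.reg .len < M) (he : s.arr .altEnd (s.reg .len) = e) (hp : s.reg .pI = p)
    (hq : s.reg .pJ = q) (hs₀ : s.reg .sI = s₀) (ht₀ : s.reg .sJ = t₀) (hpm : p < m) (hql : q < l)
    (hmark : ∀ c, s.arr .mark c = 0) (heM : e + l < M) :
    wp M W queryExt (fun s' => ∃ (F : Finset ℕ) (L : List ℕ),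
      (∀ j ∈ F, MCS.Wit (MCS.sf x y m l (p + 1)) q (min s₀ m) (min t₀ l) j) ∧
      (∀ c, c ∈ L ↔ ∃ j, MCS.Wit (MCS.sf x y m l (p + 1)) q (min s₀ m) (min t₀ l) j ∧ y j = c) ∧
      L.Nodup ∧ L.length ≤ F.card ∧ L.length ≤ l ∧ Segment (s'.arr .alt) e L ∧
      s'.reg .top = e + L.length ∧
      (∀ a < e, s'.arr .alt a = s.arr .alt a) ∧ (∀ c, s'.arr .mark c = 0) ∧
      s'.time ≤ s.time + 1000 * (F.card + 1)) s := by
  have h1 := sz.small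
  have h2 := sz.sigma
  set S := MCS.sf x y m l (p + 1) with hS
  change wp M W queryStart (wp M W queryLoop (wp M W queryClear _)) s
  refine wp_then (wp_queryStart sz T.lens hlen he hp hq hs₀ ht₀ hpm hql) ?_
  rintro s₁ F₁ ⟨top₁, qi₁, ql₁, lim₁, hi₁, time₁⟩
  refine wp_then (wp_queryLoop sz (T.frame F₁) hyσ qi₁ ((F₁.reg .pJ rfl).trans hq) ql₁ lim₁ hi₁ top₁
    hpm (min_le_right _ _) (F₁.arr .mark rfl ▸ hmark) heM) ?_
  rintro s₂ F₂ ⟨F, L, hFd, halt, time₂⟩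
  have hF : ∀ j, j ∈ F ↔ MCS.Wit S q (min s₀ m) (min t₀ l) j := by
    intro j
    rw [hFd.wit j]
    exact ⟨Or.inl, fun h => h.resolve_right fun hw => by
      have := hw.1; have := hw.2.1; omega⟩
  have hFl : F.card ≤ l := by
    have hsub : F ⊆ Finset.Ioc 0 l := fun j hj => by
      have := (hF j).1 hj
      rw [Finset.mem_Ioc]
      exact ⟨hFd.lt j hj, this.2.1.trans (min_le_right _ _)⟩
    simpa using Finset.card_le_card hsub
  have hcL := hFd.card
  have hLM : ∀ c ∈ L, c < M := by
    intro c hc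
    obtain ⟨j, hj, rfl⟩ := (hFd.mem c).1 hc
    have := (hF j).1 hj
    have := hyσ j (hFd.lt j hj) (this.2.1.trans (min_le_right _ _))
    omega
  have len₂ := (F₂.reg .len rfl).trans (F₁.reg .len rfl)
  have altEnd₂ := (F₂.arr .altEnd rfl).trans (F₁.arr .altEnd rfl)
  refine wp_then (wp_queryClear (L := L) (len₂ ▸ hlen) (by rw [len₂, altEnd₂, he]) hFd.top hFd.seg
    (fun c hc => by simp [hFd.mark, hc]) hLM (by omega) h1.2) ?_
  rintro s₃ F₃ ⟨mark₃, time₃⟩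
  have alt₃ := F₃.arr .alt rfl
  have alt₁ := F₁.arr .alt rfl
  refine ⟨F, L, fun j => (hF j).1, fun c => ?_, hFd.nodup, hcL, by omega, alt₃ ▸ hFd.seg,
    (F₃.reg .top rfl).trans hFd.top, fun a ha => ?_, mark₃, by omega⟩
  · rw [hFd.mem]
    simp only [hF]
  · rw [alt₃, halt a ha, alt₁]

end Enum221

namespace Enum221

variable {M W m l σ : ℕ} {x y : ℕ → ℕ}

/-! ### Enumeration: the steps of the walk -/

/-- The removal of an element from a list by moving the last element to its place. -/
theorem perm_cons_dropLast_set {L : List ℕ} {i : ℕ} (hi : i < L.length) :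
    L.Perm (L[i] :: (L.set i L[L.length - 1]).dropLast) := by
  obtain ⟨A, z, rfl⟩ : ∃ A z, L = A ++ [z] := by
    rcases L.eq_nil_or_concat with rfl | ⟨A, z, rfl⟩
    · simp at hi
    · exact ⟨A, z, by simp⟩
  simp only [List.length_append, List.length_singleton] at hi
  rcases Nat.lt_succ_iff_lt_or_eq.1 hi with h | rfl
  · have h1 : ((A ++ [z]).set i (A ++ [z])[(A ++ [z]).length - 1]).dropLast = A.set i z := by
      rw [List.set_append_left _ _ h]
      simp
    rw [h1, List.getElem_append_left h]
    have h2 := List.getElem_cons_eraseIdx_perm h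
    have h3 := List.set_perm_cons_eraseIdx h z
    refine (List.perm_append_singleton z A).trans ?_
    refine ((h2.symm.cons z).trans (List.Perm.swap _ _ _)).trans (h3.symm.cons _)
  · simp [List.set_append_right]

theorem wp_selectLeast {k e : ℕ} {L : List ℕ} {s : State Reg Arr} (hlen : s.reg .len = k)
    (he : s.arr .altEnd k = e) (hL : L ≠ []) (htop : s.reg .top = e + L.length)
    (hseg : Segment (s.arr .alt) e L) (hkM : k + 1 < M) (heM : e + L.length < M) (hMW : M ≤ W) :
    wp M W selectLeast (fun s' => ∃ L' : List ℕ, L.Perm (s'.reg .c :: L') ∧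
      Segment (s'.arr .alt) e L' ∧ s'.reg .top = e + L'.length ∧
      s'.arr .altEnd = Function.update (s.arr .altEnd) (k + 1) (e + L'.length) ∧
      (∀ a < e, s'.arr .alt a = s.arr .alt a) ∧ s'.time ≤ s.time + 60 * (L.length + 1)) s := by
  have hpos := List.length_pos_iff.2 hL
  rw [selectLeast, wp_seq]
  refine wp_assign_of (x := e) (by simp [v, hlen]; omega) (by simp [v, hlen, he])
    fun s₁ F₁ q₁ time₁ => ?_
  rw [wp_seq]
  refine wp_assign_of (x := e + 1) (by simp [v, q₁]; omega) (by simp [v, q₁])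
    fun s₂ F₂ p₂ time₂ => ?_
  have q₂ := (F₂.reg .q rfl).trans q₁
  have len₂ := (F₂.reg .len rfl).trans ((F₁.reg .len rfl).trans hlen)
  have top₂ := (F₂.reg .top rfl).trans ((F₁.reg .top rfl).trans htop)
  have alt₂ := (F₂.arr .alt rfl).trans (F₁.arr .alt rfl)
  have altEnd₂ := (F₂.arr .altEnd rfl).trans (F₁.arr .altEnd rfl)
  simp [v] at time₁ time₂
  rw [wp_seq]
  refine wp_then (Q := fun s' => (∃ i < L.length, s'.reg .q = e + i) ∧
    s'.time ≤ s₂.time + 30 + 40 * L.length) ?_ ?_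
  · refine wp_while (fun s' => (∃ i < L.length, s'.reg .q = e + i) ∧
      (∃ j ≤ L.length, s'.reg .p = e + j ∧ s'.time ≤ s₂.time + 40 * j))
      (fun s' => e + L.length - s'.reg .p) ⟨⟨0, hpos, q₂⟩, 1, hpos, p₂, by omega⟩ ?_
    rintro s' hF ⟨⟨i, hi, hq⟩, j, hj, hp, ht⟩
    have top' := (hF.reg .top rfl).trans top₂
    have alt' := ((hF.arr .alt rfl).trans alt₂)
    simp [v, hq, hp, top', alt']
    refine ⟨fun hlt => ⟨by omega, fun _ => ⟨by omega, ⟨hlt, j + 1, hlt, by omega, by omega⟩,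
      by omega⟩, fun _ => ⟨by omega, ⟨hi, j + 1, hlt, by omega, by omega⟩,
      by omega⟩⟩, fun hge => ⟨hi, by omega⟩⟩
  · rintro s₃ F₃ ⟨⟨i, hi, hq⟩, time₃⟩
    have len₃ := (F₃.reg .len rfl).trans len₂
    have top₃ := (F₃.reg .top rfl).trans top₂
    have alt₃ := (F₃.arr .alt rfl).trans alt₂
    have altEnd₃ := (F₃.arr .altEnd rfl).trans altEnd₂
    have hlast : s.arr .alt (e + L.length - 1) = L[L.length - 1] := by
      rw [← hseg _ (by omega)]
      congr 1
      omega
    simp [v, hq, len₃, top₃, alt₃, altEnd₃, hseg i hi, hlast]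
    refine ⟨by omega, by omega, by omega, by omega, by omega, by omega,
      (L.set i L[L.length - 1]).dropLast, perm_cons_dropLast_set hi, fun j hj => ?_, ?_, ?_,
      fun a ha => Function.update_of_ne (by omega) .., by omega⟩
    · rw [List.length_dropLast, List.length_set] at hj
      rw [List.getElem_dropLast, List.getElem_set, Function.update_apply]
      simp only [Nat.add_left_cancel_iff, hseg j (by omega)]
      split_ifs <;> first | rfl | omega
    · simp; omega
    · simp; rw [Nat.add_sub_assoc hpos]

theorem wp_load {k : ℕ} {s : State Reg Arr} (hlen : s.reg .len = k) (hk : k < M) :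
    wp M W load (fun s' => s'.reg .pI = s.arr .prefI k ∧ s'.reg .pJ = s.arr .prefJ k ∧
      s'.reg .sI = s.arr .safeI k ∧ s'.reg .sJ = s.arr .safeJ k ∧ s'.time ≤ s.time + 20) s := by
  simp [load, v, hlen, hk]

theorem val_tick (e : Expr Reg Arr) (s : State Reg Arr) (t : ℕ) : e.val (s.tick t) = e.val s := by
  induction e with
  | const => rfl
  | reg => rfl
  | get a e ih => simp [ih]
  | _ e f ihe ihf => simp only [Expr.val, ihe, ihf]

theorem safe_tick (e : Expr Reg Arr) (s : State Reg Arr) (t : ℕ) :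
    e.Safe M W (s.tick t) ↔ e.Safe M W s := by
  induction e with
  | const => rfl
  | reg => rfl
  | get a e ih => simp [ih, val_tick]
  | _ e f ihe ihf => simp only [Expr.Safe, ihe, ihf, val_tick]

theorem wp_setMin {r : Reg} {e : Expr Reg Arr} {a b : ℕ} {s : State Reg Arr} (he : e.Safe M W s)
    (hr : s.reg r = a) (hb : e.val s = b) (hc : e.cost ≤ 10) :
    wp M W (setMin r e) (fun s' => s'.reg r = min a b ∧ s'.time ≤ s.time + 30) s := by
  simp [setMin, v, he, hr, hb, val_tick, safe_tick]
  omega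

/-- The computation of one component of `safe(Z' ∘ c)`, for the string with the table `next`. -/
def computeSafe (r pO nO : Reg) (O next : Arr) (w lenS pS sS : Reg) (dst : Arr) : Cmd Reg Arr :=
  .assign .u (v lenS + 1) ;;
  .forUp r (v pO + 1) (v nO - 1)
    (.assign .t (.get next (.get O (v r) * v w + v pS)) ;;
     .ite (.le (v .t) (v lenS)) (setMin .u (.get next (v .c * v w + v .t))) .skip) ;;
  .ite (.le (v sS) (v lenS)) (setMin .u (.get next (v .c * v w + v sS))) .skip ;;
  .store dst (v .len + 1) (v .u)

theorem wp_computeSafe {r pO nO : Reg} {O next : Arr} {w lenS pS sS : Reg} {dst : Arr}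
    (hcase : (r = .j ∧ pO = .pJ ∧ nO = .nJ ∧ O = .Y ∧ next = .nextX ∧ w = .wX ∧ lenS = .m ∧
        pS = .pI ∧ sS = .sI ∧ dst = .safeI) ∨
      (r = .i ∧ pO = .pI ∧ nO = .nI ∧ O = .X ∧ next = .nextY ∧ w = .wY ∧ lenS = .l ∧
        pS = .pJ ∧ sS = .sJ ∧ dst = .safeJ))
    {z z' : ℕ → ℕ} {n p q q' s₀ c k : ℕ} {s : State Reg Arr} (sz : Sizes M W m l σ)
    (hn : s.reg lenS = n) (hw : s.reg w = n + 1)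
    (hT : ∀ c h, 1 ≤ c → c ≤ σ → 1 ≤ h → h ≤ n → s.arr next (c * (n + 1) + h) = MCS.nextPos z n c h)
    (hO : ∀ k, q < k → k < q' → s.arr O k = z' k ∧ 1 ≤ z' k ∧ z' k ≤ σ) (hq : s.reg pO = q)
    (hq' : s.reg nO = q') (hqq : q < q') (hql : q' ≤ m + l) (hp : s.reg pS = p) (hp1 : 1 ≤ p)
    (hpn : p ≤ n) (hs₀ : s.reg sS = s₀) (hs1 : 1 ≤ s₀) (hc : s.reg .c = c) (hc1 : 1 ≤ c)
    (hcσ : c ≤ σ) (hk : s.reg .len = k) (hkM : k + 1 < M) (hnm : n ≤ m + l) :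
    wp M W (computeSafe r pO nO O next w lenS pS sS dst) (fun s' => ∃ u,
      s'.arr dst = Function.update (s.arr dst) (k + 1) u ∧ 1 ≤ u ∧ u ≤ n + 1 ∧
      (∀ i ≤ n + 1, i ≤ u ↔ (∀ k, q < k → k < q' → MCS.nextPos z n (z' k) p ≤ n →
        i ≤ MCS.nextPos z n c (MCS.nextPos z n (z' k) p)) ∧
          (s₀ ≤ n → i ≤ MCS.nextPos z n c s₀)) ∧
      s'.time ≤ s.time + 100 * (q' - q) + 100) s := by
  have h1 := sz.small
  have h2 := sz.sigma
  obtain ⟨f, hf⟩ : ∃ f, s.arr dst = f := ⟨_, rfl⟩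
  rw [hf]
  rcases hcase with hcase | hcase <;>
    obtain ⟨rfl, rfl, rfl, rfl, rfl, rfl, rfl, rfl, rfl, rfl⟩ := hcase
  all_goals
    rw [computeSafe, wp_seq]
    refine wp_assign_of (x := n + 1) (by simp [v, hn]; omega) (by simp [v, hn])
      fun s₁ F₁ u₁ time₁ => ?_
    rw [wp_seq]
    refine wp_forUp (q + 1) (q' - 1) (fun j s' => 1 ≤ s'.reg .u ∧ s'.reg .u ≤ n + 1 ∧
      (∀ i ≤ n + 1, i ≤ s'.reg .u ↔ (∀ k, q < k → k < j → MCS.nextPos z n (z' k) p ≤ n →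
        i ≤ MCS.nextPos z n c (MCS.nextPos z n (z' k) p))) ∧
      s'.time ≤ s₁.time + 10 + 100 * (j - (q + 1))) (by simp [v, (F₁.reg _ rfl).trans hq]; omega)
      (by simp [v, (F₁.reg _ rfl).trans hq]) (by omega) (by omega)
      ⟨by simp [u₁], by simp [u₁], fun i hi => ?_, by simp [v]⟩ ?_ ?_ ?_
    · simp only [setReg_reg, tick_reg, reduceCtorEq, if_false, u₁, hi, true_iff]
      intro k hk1 hk2; omega
    · intro s' hF
      simp [v, (hF.reg _ rfl).trans ((F₁.reg _ rfl).trans hq')]; omega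
    · rintro j s' hj1 hj2 hF hj ⟨h3, h4, h5, h6⟩
      have en := (hF.reg _ rfl).trans ((F₁.reg _ rfl).trans hn)
      have ew := (hF.reg _ rfl).trans ((F₁.reg _ rfl).trans hw)
      have ep := (hF.reg _ rfl).trans ((F₁.reg _ rfl).trans hp)
      have ec := (hF.reg .c rfl).trans ((F₁.reg .c rfl).trans hc)
      have eT := (hF.arr _ rfl).trans (F₁.arr _ rfl) ▸ hT
      have hOj := hO j (by omega) (by omega)
      have eO := (congrFun ((hF.arr _ rfl).trans (F₁.arr _ rfl)) j).trans hOj.1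
      have enx := eT (z' j) p hOj.2.1 hOj.2.2 hp1 hpn
      have a1 := sz.addr (a := z' j) (b := n + 1) (c := p) (by omega) (by omega) (by omega)
      have hlt := MCS.lt_nextPos z n (z' j) p
      have hle := MCS.nextPos_le_succ (x := z) (c := z' j) hpn
      rw [wp_seq]
      refine wp_assign_of (x := MCS.nextPos z n (z' j) p)
        (by simp [v, hj, eO, ew, ep]; omega) (by simp [v, hj, eO, ew, ep, enx])
        fun s₂ F₂ t₂ time₂ => ?_
      have u₂ : s₂.reg .u = s'.reg .u := F₂.reg .u rfl
      have j₂ := (F₂.reg _ rfl).trans hj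
      have n₂ := (F₂.reg _ rfl).trans en
      have w₂ := (F₂.reg _ rfl).trans ew
      have c₂ := (F₂.reg .c rfl).trans ec
      have T₂ := F₂.arr _ rfl ▸ eT
      set r := MCS.nextPos z n (z' j) p with hr
      have a2 := sz.addr (a := c) (b := n + 1) (c := r) (by omega) (by omega) (by omega)
      simp [v] at time₂
      have hsplit : ∀ P : ℕ → Prop, (∀ k, q < k → k < j + 1 → P k) ↔
          (∀ k, q < k → k < j → P k) ∧ P j := fun P => by
        refine ⟨fun h => ⟨fun k hk1 hk2 => h k hk1 (by omega), h j (by omega) (by omega)⟩,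
          fun h k hk1 hk2 => ?_⟩
        rcases Nat.lt_succ_iff_lt_or_eq.1 hk2 with h' | rfl
        exacts [h.1 k hk1 h', h.2]
      rw [wp_ite]
      refine ⟨⟨trivial, trivial⟩, fun hb => ?_, fun hb => ?_⟩
      · have hb : r ≤ n := by simpa [v, t₂, n₂] using hb
        have e2 := T₂ c r hc1 hcσ (by omega) hb
        refine wp_then (wp_setMin (a := s'.reg .u) (b := MCS.nextPos z n c r)
          (by simp [v, c₂, w₂, t₂]; omega) u₂ (by simp [v, c₂, w₂, t₂, e2]) (by simp [v])) ?_
        rintro s₃ F₃ ⟨u₃, time₃⟩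
        have hlt' := MCS.lt_nextPos z n c r
        simp [v] at time₃
        refine ⟨(F₃.reg _ rfl).trans j₂, ?_, ?_, fun i hi => ?_, ?_⟩
        · simp [u₃]; omega
        · simp [u₃]; omega
        · simp only [setReg_reg, tick_reg, reduceCtorEq, if_false, u₃, le_min_iff, hsplit, h5 i hi]
          simp only [← hr, hb, forall_const]
        · simp; omega
      · have hb : ¬ r ≤ n := by simpa [v, t₂, n₂] using hb
        refine ⟨j₂, ?_, ?_, fun i hi => ?_, ?_⟩
        · simp [u₂, h3]
        · simp [u₂, h4]
        · simp only [setReg_reg, tick_reg, reduceCtorEq, if_false, u₂, hsplit, h5 i hi]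
          simp only [← hr, hb, false_imp_iff, and_true]
        · simp [v]; omega
    · rintro s₂ F₂ - ⟨h3, h4, h5, h6⟩
      have n₂ := (F₂.reg _ rfl).trans ((F₁.reg _ rfl).trans hn)
      have w₂ := (F₂.reg _ rfl).trans ((F₁.reg _ rfl).trans hw)
      have sS₂ := (F₂.reg _ rfl).trans ((F₁.reg _ rfl).trans hs₀)
      have c₂ := (F₂.reg .c rfl).trans ((F₁.reg .c rfl).trans hc)
      have k₂ := (F₂.reg .len rfl).trans ((F₁.reg .len rfl).trans hk)
      have dst₂ := (F₂.arr _ rfl).trans ((F₁.arr _ rfl).trans hf)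
      have T₂ := (F₂.arr _ rfl).trans (F₁.arr _ rfl) ▸ hT
      rw [Nat.sub_add_cancel (by omega)] at h5 h6
      simp [v] at time₁
      rw [wp_seq]
      refine wp_then (Q := fun s' => 1 ≤ s'.reg .u ∧ s'.reg .u ≤ n + 1 ∧
        (∀ i ≤ n + 1, i ≤ s'.reg .u ↔ (∀ k, q < k → k < q' → MCS.nextPos z n (z' k) p ≤ n →
          i ≤ MCS.nextPos z n c (MCS.nextPos z n (z' k) p)) ∧
          (s₀ ≤ n → i ≤ MCS.nextPos z n c s₀)) ∧
        s'.time ≤ s₂.time + 60) ?_ ?_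
      · rw [wp_ite]
        refine ⟨⟨trivial, trivial⟩, fun hb => ?_, fun hb => ?_⟩
        · have hb : s₀ ≤ n := by simpa [v, sS₂, n₂] using hb
          have a2 := sz.addr (a := c) (b := n + 1) (c := s₀) (by omega) (by omega) (by omega)
          have e2 := T₂ c s₀ hc1 hcσ hs1 hb
          refine wp_then (wp_setMin (a := s₂.reg .u) (b := MCS.nextPos z n c s₀)
            (by simp [v, c₂, w₂, sS₂]; omega) rfl (by simp [v, c₂, w₂, sS₂, e2]) (by simp [v])) ?_
          rintro s₃ F₃ ⟨u₃, time₃⟩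
          have hlt' := MCS.lt_nextPos z n c s₀
          simp [v] at time₃
          refine ⟨by omega, by omega, fun i hi => ?_, by omega⟩
          rw [u₃, le_min_iff, h5 i hi]
          simp only [hb, forall_const]
        · have hb : ¬ s₀ ≤ n := by simpa [v, sS₂, n₂] using hb
          refine ⟨h3, h4, fun i hi => ?_, by simp [v]⟩
          simp only [tick_reg, h5 i hi, hb, false_imp_iff, and_true]
      · rintro s₃ F₃ ⟨h7, h8, h9, h10⟩
        have k₃ := (F₃.reg .len rfl).trans k₂
        have dst₃ := (F₃.arr _ rfl).trans dst₂
        simp [v, k₃, dst₃]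
        refine ⟨by omega, hkM, _, rfl, h7, h8, h9, by omega⟩

theorem wp_appendChar {p q p' q' s₀ t₀ c k : ℕ} {s : State Reg Arr} (sz : Sizes M W m l σ)
    (T : Tables x y m l σ s) (hxσ : ∀ k, 1 ≤ k → k ≤ m → 1 ≤ x k ∧ x k ≤ σ)
    (hyσ : ∀ k, 1 ≤ k → k ≤ l → 1 ≤ y k ∧ y k ≤ σ) (hp : s.reg .pI = p) (hq : s.reg .pJ = q)
    (hs₀ : s.reg .sI = s₀) (ht₀ : s.reg .sJ = t₀) (hc : s.reg .c = c) (hk : s.reg .len = k)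
    (hp1 : 1 ≤ p) (hq1 : 1 ≤ q) (hpm : p ≤ m) (hql : q ≤ l) (hs1 : 1 ≤ s₀) (ht1 : 1 ≤ t₀)
    (hc1 : 1 ≤ c) (hcσ : c ≤ σ) (hkM : k + 1 < M) (hp' : MCS.nextPos x m c p = p')
    (hq' : MCS.nextPos y l c q = q') (hpm' : p' ≤ m) (hql' : q' ≤ l) :
    wp M W appendChar (fun s' => ∃ u u',
      s'.arr .safeI = Function.update (s.arr .safeI) (k + 1) u ∧
      s'.arr .safeJ = Function.update (s.arr .safeJ) (k + 1) u' ∧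
      s'.arr .prefI = Function.update (s.arr .prefI) (k + 1) p' ∧
      s'.arr .prefJ = Function.update (s.arr .prefJ) (k + 1) q' ∧
      s'.arr .Z = Function.update (s.arr .Z) (k + 1) c ∧ s'.reg .len = k + 1 ∧
      1 ≤ u ∧ u ≤ m + 1 ∧ 1 ≤ u' ∧ u' ≤ l + 1 ∧
      (∀ i ≤ m + 1, i ≤ u ↔ (∀ k, q < k → k < q' → MCS.nextPos x m (y k) p ≤ m →
        i ≤ MCS.nextPos x m c (MCS.nextPos x m (y k) p)) ∧
          (s₀ ≤ m → i ≤ MCS.nextPos x m c s₀)) ∧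
      (∀ i ≤ l + 1, i ≤ u' ↔ (∀ k, p < k → k < p' → MCS.nextPos y l (x k) q ≤ l →
        i ≤ MCS.nextPos y l c (MCS.nextPos y l (x k) q)) ∧
          (t₀ ≤ l → i ≤ MCS.nextPos y l c t₀)) ∧
      s'.time ≤ s.time + 300 * ((p' - p) + (q' - q))) s := by
  have h1 := sz.small
  have h2 := sz.sigma
  have a1 := sz.addr (a := c) (b := m + 1) (c := p) (by omega) (by omega) (by omega)
  have a2 := sz.addr (a := c) (b := l + 1) (c := q) (by omega) (by omega) (by omega)
  have hlt := MCS.lt_nextPos x m c p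
  have hlt' := MCS.lt_nextPos y l c q
  rw [hp'] at hlt
  rw [hq'] at hlt'
  change wp M W (.assign .nI (.get .nextX (v .c * v .wX + v .pI)))
    (wp M W (.assign .nJ (.get .nextY (v .c * v .wY + v .pJ)))
    (wp M W (computeSafe .j .pJ .nJ .Y .nextX .wX .m .pI .sI .safeI)
    (wp M W (computeSafe .i .pI .nI .X .nextY .wY .l .pJ .sJ .safeJ)
    (wp M W (.assign .len (v .len + 1) ;; .store .Z (v .len) (v .c) ;;
      .store .prefI (v .len) (v .nI) ;; .store .prefJ (v .len) (v .nJ)) _)))) s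
  refine wp_assign_of (x := p') (by simp [v, hc, T.lens.wX, hp]; omega)
    (by simp [v, hc, T.lens.wX, hp, T.tabX.next c p hc1 hcσ hp1 hpm, hp']) fun s₁ F₁ nI₁ time₁ => ?_
  have T₁ := T.frame F₁
  have c₁ := (F₁.reg .c rfl).trans hc
  have pJ₁ := (F₁.reg .pJ rfl).trans hq
  refine wp_assign_of (x := q') (by simp [v, c₁, T₁.lens.wY, pJ₁]; omega)
    (by simp [v, c₁, T₁.lens.wY, pJ₁, T₁.tabY.next c q hc1 hcσ hq1 hql, hq'])
    fun s₂ F₂ nJ₂ time₂ => ?_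
  have T₂ := T₁.frame F₂
  have c₂ := (F₂.reg .c rfl).trans c₁
  have pI₂ := (F₂.reg .pI rfl).trans ((F₁.reg .pI rfl).trans hp)
  have pJ₂ := (F₂.reg .pJ rfl).trans pJ₁
  have sI₂ := (F₂.reg .sI rfl).trans ((F₁.reg .sI rfl).trans hs₀)
  have sJ₂ := (F₂.reg .sJ rfl).trans ((F₁.reg .sJ rfl).trans ht₀)
  have k₂ := (F₂.reg .len rfl).trans ((F₁.reg .len rfl).trans hk)
  have nI₂ := (F₂.reg .nI rfl).trans nI₁
  simp [v] at time₁ time₂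
  refine wp_then (wp_computeSafe (n := m) (p := p) (q := q) (q' := q') (s₀ := s₀) (c := c) (k := k)
    (z := x) (z' := y)
    (Or.inl ⟨rfl, rfl, rfl, rfl, rfl, rfl, rfl, rfl, rfl, rfl⟩) sz T₂.lens.reg_m T₂.lens.wX
    T₂.tabX.next (fun k hk1 hk2 => ⟨T₂.strings.Y k (by omega) (by omega),
      hyσ k (by omega) (by omega)⟩) pJ₂ nJ₂ hlt' (by omega) pI₂ hp1 hpm sI₂ hs1 c₂ hc1 hcσ k₂ hkM
    (by omega)) ?_
  rintro s₃ F₃ ⟨u, h3, h4, h5, h6, h7⟩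
  have T₃ := T₂.frame F₃
  refine wp_then (wp_computeSafe (n := l) (p := q) (q := p) (q' := p') (s₀ := t₀) (c := c) (k := k)
    (z := y) (z' := x)
    (Or.inr ⟨rfl, rfl, rfl, rfl, rfl, rfl, rfl, rfl, rfl, rfl⟩) sz T₃.lens.reg_l T₃.lens.wY
    T₃.tabY.next (fun k hk1 hk2 => ⟨T₃.strings.X k (by omega) (by omega),
      hxσ k (by omega) (by omega)⟩) ((F₃.reg .pI rfl).trans pI₂) ((F₃.reg .nI rfl).trans nI₂) hlt
    (by omega) ((F₃.reg .pJ rfl).trans pJ₂) hq1 hql ((F₃.reg .sJ rfl).trans sJ₂) ht1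
    ((F₃.reg .c rfl).trans c₂) hc1 hcσ ((F₃.reg .len rfl).trans k₂) hkM (by omega)) ?_
  rintro s₄ F₄ ⟨u', h8, h9, h10, h11, h12⟩
  have k₄ := (F₄.reg .len rfl).trans ((F₃.reg .len rfl).trans k₂)
  have c₄ := (F₄.reg .c rfl).trans ((F₃.reg .c rfl).trans c₂)
  have nI₄ := (F₄.reg .nI rfl).trans ((F₃.reg .nI rfl).trans nI₂)
  have nJ₄ := (F₄.reg .nJ rfl).trans ((F₃.reg .nJ rfl).trans nJ₂)
  have hframe : ∀ {a : Arr}, a ≠ .safeI → a ≠ .safeJ → s₄.arr a = s.arr a := by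
    intro a ha ha'
    rw [F₄.arr a, F₃.arr a, F₂.arr a rfl, F₁.arr a rfl]
    all_goals simp [computeSafe, setMin, Cmd.forUp, Cmd.modArr, ha.symm, ha'.symm]
  have sI₄ : s₄.arr .safeI = Function.update (s.arr .safeI) (k + 1) u := by
    rw [F₄.arr .safeI rfl, h3, F₂.arr .safeI rfl, F₁.arr .safeI rfl]
  have sJ₄ : s₄.arr .safeJ = Function.update (s.arr .safeJ) (k + 1) u' := by
    rw [h8, F₃.arr .safeJ rfl, F₂.arr .safeJ rfl, F₁.arr .safeJ rfl]
  simp [v, k₄, c₄, nI₄, nJ₄, sI₄, sJ₄, hframe]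
  exact ⟨by omega, hkM, u, rfl, u', rfl, h4, h5, h9, h10, h6, h11, by omega⟩

theorem wp_outputZ {X Y Z : List ℕ} {k : ℕ} {s : State Reg Arr} (hI : Input X Y s)
    (hk : s.reg .len = k) (hZ : Z.length + 2 = k) (hkM : k < M) (hMW : M ≤ W)
    (hXM : X.length + Y.length ≤ M)
    (hseg : ∀ i (hi : i < Z.length), s.arr .Z (i + 2) = encode X Y Z[i])
    (hsub : Z ⊆ X ++ Y) (hbuf : s.buf = []) :
    wp M W outputZ (fun s' => s'.buf = [] ∧ s'.out = s.out ++ [(Z, s'.time)] ∧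
      s'.time ≤ s.time + 50 * k) s := by
  rw [outputZ, wp_seq]
  refine wp_forUp 2 (k - 1) (fun j s' => s'.buf = Z.take (j - 2) ∧ s'.out = s.out ∧
    s'.time ≤ s.time + 2 + 40 * (j - 2)) (by simp; omega) (by simp) (by omega) (by omega)
    ⟨by simp [hbuf], rfl, by simp⟩ ?_ ?_ ?_
  · intro s' hF
    simp [v, (hF.reg .len rfl).trans hk]; omega
  · rintro j s' hj1 hj2 hF hj ⟨h1, h2, h3⟩
    obtain ⟨i, rfl⟩ : ∃ i, j = i + 2 := ⟨j - 2, by omega⟩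
    have hi : i < Z.length := by omega
    have hI' := hI.mono (hF.reg .lenX0 rfl) (hF.reg .lenY0 rfl) (hF.arr .inX rfl) (hF.arr .inY rfl)
    have hc := hsub (List.getElem_mem hi)
    have hq := List.idxOf_lt_length_iff.2 hc
    have hget : (X ++ Y).getD ((X ++ Y).idxOf Z[i]) 0 = Z[i] := by
      rw [List.getD_eq_getElem _ _ hq, List.getElem_idxOf]
    have htake : Z.take (i + 1) = Z.take i ++ [Z[i]] := by simp
    have eZ := (congrFun (hF.arr .Z rfl) (i + 2)).trans (hseg i hi)
    rw [List.length_append] at hq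
    rw [wp_seq]
    refine wp_assign_of (x := (X ++ Y).idxOf Z[i]) (by simp [v, hj]; omega)
      (by simp [v, hj, eZ, encode]) fun s₁ F₁ q₁ time₁ => ?_
    have buf₁ := (F₁.out rfl).2
    have out₁ := (F₁.out rfl).1
    have j₁ := (F₁.reg .p rfl).trans hj
    have inX₁ : ∀ k, s₁.arr .inX k = X.getD k 0 := fun k => by rw [F₁.arr .inX rfl]; exact hI'.inX k
    have inY₁ : ∀ k, s₁.arr .inY k = Y.getD k 0 := fun k => by rw [F₁.arr .inY rfl]; exact hI'.inY k
    have lenX₁ : s₁.reg .lenX0 = X.length := (F₁.reg .lenX0 rfl).trans hI'.lenX0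
    simp [v] at time₁ buf₁ out₁ h1 h3
    set q := (X ++ Y).idxOf Z[i] with hqd
    rw [wp_ite]
    simp only [v, holds_lt, val_reg, q₁, lenX₁, wp_emit, safe_lt, safe_reg, safe_get, safe_sub,
      val_get, val_sub, tick_reg, tick_arr, inX₁, inY₁, cost_lt, cost_reg, cost_get, cost_sub,
      write_reg, write_buf, write_out, write_time, tick_buf, tick_out, tick_time, setReg_buf,
      setReg_out, setReg_time, buf₁, out₁, h1, h2, j₁, true_and, and_true]
    have e1 : i + 2 + 1 - 2 = i + 1 := by omega
    rw [e1, htake]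
    refine ⟨fun hlt => ⟨by omega, ?_, by omega⟩, fun hge => ⟨by omega, ?_, by omega⟩⟩
    · rw [List.getD_append _ _ _ _ hlt] at hget
      rw [hget]
    · rw [List.getD_append_right _ _ _ _ (by omega)] at hget
      rw [hget]
  · rintro s' hF - ⟨h1, h2, h3⟩
    have e1 : Z.take (k - 1 + 1 - 2) = Z := List.take_of_length_le (by omega)
    simp only [v, wp_endOutput, complete_buf, complete_out, complete_time, tick_buf, tick_out,
      tick_time, h1, h2, e1, true_and, cost_sub, cost_reg, cost_ofNat]
    omega

end Enum221

namespace MCS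

variable {x y : ℕ → ℕ} {m l : ℕ}

theorem Maximal.pref_le {U V : List ℕ} (h : Maximal x y m l (U ++ V)) :
    pref x m U ≤ m ∧ pref y l U ≤ l := by
  have h1 := h.1
  rw [← gap_append] at h1
  have h2 := suf_le (x := x) (m := m) (V ++ [])
  have h3 := suf_le (x := y) (m := l) (V ++ [])
  have := h1.1
  have := h1.2
  omega

end MCS

namespace Enum221

variable {M W m l σ : ℕ} {x y : ℕ → ℕ}

/-! ### Enumeration: the path from the root of the trie to the current prefix -/

/-- The prefix `Z'` at the end of a path in the trie of the prefixes of the maximal common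
subsequences. A path is a list, from the end to the root, of the characters of the prefix, each
with a list of the characters still to be tried in its place. -/
def word (P : List (ℕ × List ℕ)) : List ℕ := (P.map Prod.fst).reverse

/-- The number of the characters still to be tried along a path. -/
def altLen (P : List (ℕ × List ℕ)) : ℕ := (P.map fun a => a.2.length).sum

variable {c d k e : ℕ} {A : List ℕ} {P : List (ℕ × List ℕ)}

@[simp] theorem word_nil : word [] = [] := rfl
@[simp] theorem word_cons : word ((c, A) :: P) = word P ++ [c] := by simp [word]
@[simp] theorem length_word : (word P).length = P.length := by simp [word]
@[simp] theorem altLen_nil : altLen [] = 0 := rfl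
@[simp] theorem altLen_cons : altLen ((c, A) :: P) = altLen P + A.length := by
  simp [altLen, add_comm]

/-- The data stored for the prefix `U ++ [c]` of length `k`, with the list `A` of the characters
to be tried after `U` in place of `c`; the lists for the shorter prefixes end at `e`. -/
structure Cell (x y : ℕ → ℕ) (m l : ℕ) (s : State Reg Arr) (U : List ℕ) (k e c : ℕ)
    (A : List ℕ) : Prop where
  char : s.arr .Z k = c
  prefI : s.arr .prefI k = MCS.pref x m (U ++ [c])
  prefJ : s.arr .prefJ k = MCS.pref y l (U ++ [c])
  safe : MCS.IsSafe x y m l (U ++ [c]) (s.arr .safeI k) (s.arr .safeJ k)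
  safeI_pos : 1 ≤ s.arr .safeI k
  safeI_le : s.arr .safeI k ≤ m + 1
  safeJ_pos : 1 ≤ s.arr .safeJ k
  safeJ_le : s.arr .safeJ k ≤ l + 1
  altEnd : s.arr .altEnd k = e + A.length
  seg : Segment (s.arr .alt) e A

/-- The memory has the path `P`, including what is known about the prefixes along it. -/
def Stored (x y : ℕ → ℕ) (m l : ℕ) (s : State Reg Arr) : List (ℕ × List ℕ) → Prop
  | [] => s.arr .altEnd 0 = 0
  | (c, A) :: P => Stored x y m l s P ∧ Cell x y m l s (word P) (P.length + 1) (altLen P) c A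

/-- All characters along the path, the chosen ones and those still to be tried, lead to maximal
common subsequences. -/
def Live (x y : ℕ → ℕ) (m l : ℕ) : List (ℕ × List ℕ) → Prop
  | [] => True
  | (c, A) :: P => Live x y m l P ∧ (c :: A).Nodup ∧ A.length ≤ l ∧
      ∀ d ∈ c :: A, ∃ V, MCS.Maximal x y m l (word P ++ d :: V)

/-- `Z` extends an alternative that is still to be tried. -/
def Pending (Z : List ℕ) : List (ℕ × List ℕ) → Prop
  | [] => False
  | (_, A) :: P => (∃ d ∈ A, word P ++ [d] <+: Z) ∨ Pending Z P

theorem Stored.altEnd_eq {s : State Reg Arr} (h : Stored x y m l s P) :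
    s.arr .altEnd P.length = altLen P := by
  rcases P with _ | ⟨⟨c, A⟩, P⟩
  · exact h
  · simpa using h.2.altEnd

/-- Cells and lists behind those of the path are irrelevant. -/
theorem Stored.congr {s s' : State Reg Arr} (h : Stored x y m l s P)
    (ha : ∀ a ∈ [Arr.Z, .prefI, .prefJ, .safeI, .safeJ, .altEnd],
      ∀ k ≤ P.length, s'.arr a k = s.arr a k)
    (halt : ∀ a < altLen P, s'.arr .alt a = s.arr .alt a) : Stored x y m l s' P := by
  induction P with
  | nil => exact (ha .altEnd (by simp) 0 le_rfl).trans h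
  | cons a P ih =>
    obtain ⟨c, A⟩ := a
    obtain ⟨h1, h2⟩ := h
    rw [altLen_cons] at halt
    refine ⟨ih h1 (fun a h k hk => ha a h k (hk.trans (by simp))) fun a h => halt a (by omega), ?_⟩
    simp only [List.forall_mem_cons, List.not_mem_nil, false_imp_iff, implies_true,
      and_true] at ha
    obtain ⟨h3, h4, h5, h6, h7, h8⟩ := ha
    have h9 := h3 _ le_rfl
    have h10 := h4 _ le_rfl
    have h11 := h5 _ le_rfl
    have h12 := h6 _ le_rfl
    have h13 := h7 _ le_rfl
    have h14 := h8 _ le_rfl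
    rw [List.length_cons] at *
    refine ⟨h9.trans h2.char, h10.trans h2.prefI, h11.trans h2.prefJ, ?_, ?_, ?_, ?_, ?_,
      h14.trans h2.altEnd, fun k hk => (halt _ (by omega)).trans (h2.seg k hk)⟩
    · rw [h12, h13]; exact h2.safe
    · rw [h12]; exact h2.safeI_pos
    · rw [h12]; exact h2.safeI_le
    · rw [h13]; exact h2.safeJ_pos
    · rw [h13]; exact h2.safeJ_le

theorem Stored.word_get {s : State Reg Arr} (h : Stored x y m l s P) :
    ∀ i (hi : i < (word P).length), s.arr .Z (i + 1) = (word P)[i] := by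
  induction P with
  | nil => simp
  | cons a P ih =>
    obtain ⟨c, A⟩ := a
    intro i hi
    have hi' : i < P.length + 1 := by simpa using hi
    simp only [word_cons]
    rcases Nat.lt_succ_iff_lt_or_eq.1 hi' with h1 | rfl
    · rw [List.getElem_append_left (by simpa using h1)]
      exact ih h.1 i (by simpa using h1)
    · simpa using h.2.char

theorem Live.pref_le (h : Live x y m l P) :
    MCS.pref x m (word P) ≤ m ∧ MCS.pref y l (word P) ≤ l := by
  rcases P with _ | ⟨⟨c, A⟩, P⟩
  · simp
  · obtain ⟨V, hV⟩ := h.2.2.2 c (by simp)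
    rw [List.append_cons] at hV
    rw [word_cons]
    exact hV.pref_le

theorem Live.length_le (h : Live x y m l P) : P.length ≤ m := by
  have h1 := MCS.length_le_pref (x := x) (m := m) (word P)
  have := h.pref_le.1
  simp at h1; omega

theorem Live.altLen_le (h : Live x y m l P) : altLen P ≤ P.length * l := by
  induction P with
  | nil => simp
  | cons a P ih =>
    obtain ⟨c, A⟩ := a
    have := ih h.1
    have := h.2.2.1
    rw [altLen_cons, List.length_cons, Nat.add_one_mul]
    omega

/-- The current prefix does not extend an alternative. -/
theorem Live.not_pending (h : Live x y m l P) {Z : List ℕ} (hZ : word P <+: Z) :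
    ¬ Pending Z P := by
  induction P with
  | nil => exact id
  | cons a P ih =>
    obtain ⟨c, A⟩ := a
    rw [word_cons] at hZ
    rintro (⟨d, hd, hdZ⟩ | hP)
    · have he := (List.prefix_of_prefix_length_le hZ hdZ (by simp)).eq_of_length (by simp)
      have hcd : c = d := by simpa using he
      subst hcd
      exact (List.nodup_cons.1 h.2.1).1 hd
    · exact ih h.1 ((List.prefix_append _ _).trans hZ) hP

/-! ### Enumeration: moving along an edge of the trie -/

/-- Selection of the next character among the candidates `L`, and the step along its edge. -/
theorem wp_advance {L : List ℕ} {s : State Reg Arr} (sz : Sizes M W m l σ)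
    (T : Tables x y m l σ s) (hxσ : ∀ k, 1 ≤ k → k ≤ m → 1 ≤ x k ∧ x k ≤ σ)
    (hyσ : ∀ k, 1 ≤ k → k ≤ l → 1 ≤ y k ∧ y k ≤ σ) (hP : P ≠ []) (hSt : Stored x y m l s P)
    (hLive : Live x y m l P) (hlen : s.reg .len = P.length)
    (hpI : s.reg .pI = s.arr .prefI P.length) (hpJ : s.reg .pJ = s.arr .prefJ P.length)
    (hsI : s.reg .sI = s.arr .safeI P.length) (hsJ : s.reg .sJ = s.arr .safeJ P.length)
    (hL : L ≠ []) (htop : s.reg .top = altLen P + L.length)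
    (hseg : Segment (s.arr .alt) (altLen P) L) (hLl : L.length ≤ l) (hnd : L.Nodup)
    (hmax : ∀ d ∈ L, ∃ V, MCS.Maximal x y m l (word P ++ d :: V)) :
    wp M W (selectLeast ;; appendChar) (fun s' => ∃ c A, L.Perm (c :: A) ∧
      Stored x y m l s' ((c, A) :: P) ∧ Live x y m l ((c, A) :: P) ∧
      s'.reg .len = P.length + 1 ∧
      s'.time ≤ s.time + 60 * (L.length + 1) +
        300 * ((MCS.pref x m (word P ++ [c]) - MCS.pref x m (word P)) +
          (MCS.pref y l (word P ++ [c]) - MCS.pref y l (word P)))) s := by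
  have h1 := sz.small
  have h2 := sz.sigma
  have h3 := hLive.length_le
  have h4 : altLen P + l < M := by
    have h5 := hLive.altLen_le
    have h6 := Nat.mul_le_mul_right l h3
    have h7 := sz.addr (a := m) (b := l) (c := l) (by omega) (by omega) (by omega)
    omega
  obtain ⟨p, hp⟩ : ∃ p, MCS.pref x m (word P) = p := ⟨_, rfl⟩
  obtain ⟨q, hq⟩ : ∃ q, MCS.pref y l (word P) = q := ⟨_, rfl⟩
  have hle := hLive.pref_le
  rw [hp, hq] at hle
  have h5 : 1 ≤ p ∧ 1 ≤ q := by
    have h6 := MCS.length_le_pref (x := x) (m := m) (word P)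
    have h7 := MCS.length_le_pref (x := y) (m := l) (word P)
    have := List.length_pos_iff.2 hP
    rw [length_word] at h6 h7
    omega
  -- the data of the last cell
  obtain ⟨a, b, e1, e2, hab, ha1, ha2, hb1, hb2, e3, e4⟩ : ∃ a b, s.reg .sI = a ∧ s.reg .sJ = b ∧
      MCS.IsSafe x y m l (word P) a b ∧ 1 ≤ a ∧ a ≤ m + 1 ∧ 1 ≤ b ∧ b ≤ l + 1 ∧
      s.reg .pI = p ∧ s.reg .pJ = q := by
    obtain _ | ⟨⟨c, A⟩, P⟩ := P
    · exact absurd rfl hP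
    · obtain ⟨-, C⟩ := hSt
      rw [word_cons] at *
      rw [List.length_cons] at hsI hsJ hpI hpJ
      exact ⟨_, _, hsI, hsJ, C.safe, C.safeI_pos, C.safeI_le, C.safeJ_pos, C.safeJ_le,
        hpI.trans (C.prefI.trans hp), hpJ.trans (C.prefJ.trans hq)⟩
  rw [wp_seq]
  refine wp_then (wp_selectLeast hlen hSt.altEnd_eq hL htop hseg (by omega) (by omega) h1.2) ?_
  rintro s₁ F₁ ⟨A, hperm, seg₁, top₁, altEnd₁, alt₁, time₁⟩
  obtain ⟨c, c₁⟩ : ∃ c, s₁.reg .c = c := ⟨_, rfl⟩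
  rw [c₁] at hperm
  have hmax' : ∀ d ∈ c :: A, ∃ V, MCS.Maximal x y m l (word P ++ d :: V) :=
    fun d hd => hmax d (hperm.mem_iff.2 hd)
  have hLA := hperm.length_eq
  rw [List.length_cons] at hLA
  have hLive' : Live x y m l ((c, A) :: P) :=
    ⟨hLive, hperm.nodup_iff.1 hnd, by omega, hmax'⟩
  have hle' := hLive'.pref_le
  obtain ⟨p', hp'⟩ : ∃ p', MCS.nextPos x m c p = p' := ⟨_, rfl⟩
  obtain ⟨q', hq'⟩ : ∃ q', MCS.nextPos y l c q = q' := ⟨_, rfl⟩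
  rw [word_cons, MCS.pref_concat, MCS.pref_concat, hp, hq, hp', hq'] at hle'
  have hpp' := hp' ▸ MCS.lt_nextPos x m c p
  have hc : 1 ≤ c ∧ c ≤ σ := by
    have := (MCS.nextPos_mem x m c p).2 (by omega)
    rw [hp'] at this
    exact this ▸ hxσ p' (by omega) hle'.1
  refine wp_then (wp_appendChar sz (T.frame F₁) hxσ hyσ ((F₁.reg .pI rfl).trans e3)
    ((F₁.reg .pJ rfl).trans e4) ((F₁.reg .sI rfl).trans e1) ((F₁.reg .sJ rfl).trans e2) c₁
    ((F₁.reg .len rfl).trans hlen) h5.1 h5.2 hle.1 hle.2 ha1 hb1 hc.1 hc.2 (by omega) hp' hq'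
    hle'.1 hle'.2) ?_
  rintro s₂ F₂ ⟨u, u', safeI₂, safeJ₂, prefI₂, prefJ₂, Z₂, len₂, hu1, hu2, hu1', hu2', hu, hu',
    time₂⟩
  have alt₂ := F₂.arr .alt rfl
  have altEnd₂ := (F₂.arr .altEnd rfl).trans altEnd₁
  refine ⟨c, A, hperm, ⟨hSt.congr ?_ fun a ha => by rw [alt₂, alt₁ a ha], ?_⟩, hLive', len₂, ?_⟩
  · have hne : ∀ k ≤ P.length, k ≠ P.length + 1 := fun k hk => by omega
    simp only [List.forall_mem_cons, List.not_mem_nil, false_imp_iff, implies_true, and_true]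
    refine ⟨?_, ?_, ?_, ?_, ?_, ?_⟩ <;> intro k hk
    · rw [Z₂, Function.update_of_ne (hne k hk), F₁.arr .Z rfl]
    · rw [prefI₂, Function.update_of_ne (hne k hk), F₁.arr .prefI rfl]
    · rw [prefJ₂, Function.update_of_ne (hne k hk), F₁.arr .prefJ rfl]
    · rw [safeI₂, Function.update_of_ne (hne k hk), F₁.arr .safeI rfl]
    · rw [safeJ₂, Function.update_of_ne (hne k hk), F₁.arr .safeJ rfl]
    · rw [altEnd₂, Function.update_of_ne (hne k hk)]
  · have eI : s₂.arr .safeI (P.length + 1) = u := by simp [safeI₂]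
    have eJ : s₂.arr .safeJ (P.length + 1) = u' := by simp [safeJ₂]
    refine ⟨by simp [Z₂], by simp [prefI₂, hp, hp'], by simp [prefJ₂, hq, hq'], ?_, ?_, ?_, ?_, ?_,
      by simp [altEnd₂], alt₂ ▸ seg₁⟩
    · rw [eI, eJ]
      exact hab.step hp hq hp' hq' ha2 hb2 hu hu'
    all_goals simpa only [eI, eJ]
  · rw [MCS.pref_concat, MCS.pref_concat, hp, hq, hp', hq']
    omega

theorem wp_loadCell {s : State Reg Arr} (hlen : s.reg .len = k) (hk : k < M) :
    wp M W load (fun s' => s'.reg .pI = s'.arr .prefI k ∧ s'.reg .pJ = s'.arr .prefJ k ∧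
      s'.reg .sI = s'.arr .safeI k ∧ s'.reg .sJ = s'.arr .safeJ k ∧ s'.time ≤ s.time + 20) s := by
  refine wp_then (wp_load hlen hk) ?_
  rintro s' F ⟨h1, h2, h3, h4, h5⟩
  rw [F.arr .prefI rfl, F.arr .prefJ rfl, F.arr .safeI rfl, F.arr .safeJ rfl]
  exact ⟨h1, h2, h3, h4, h5⟩

/-- The step to a longer prefix. -/
theorem wp_descend {s : State Reg Arr} (sz : Sizes M W m l σ)
    (T : Tables x y m l σ s) (hxσ : ∀ k, 1 ≤ k → k ≤ m → 1 ≤ x k ∧ x k ≤ σ)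
    (hyσ : ∀ k, 1 ≤ k → k ≤ l → 1 ≤ y k ∧ y k ≤ σ) (hP : P ≠ []) (hSt : Stored x y m l s P)
    (hLive : Live x y m l P) (hlen : s.reg .len = P.length) (hmark : ∀ c, s.arr .mark c = 0)
    (hpm : MCS.pref x m (word P) < m) (hql : MCS.pref y l (word P) < l)
    (hext : ∃ d V, MCS.Maximal x y m l (word P ++ d :: V)) :
    wp M W (load ;; queryExt ;; selectLeast ;; appendChar) (fun s' => ∃ c A,
      (∀ d, d ∈ c :: A ↔ ∃ V, MCS.Maximal x y m l (word P ++ d :: V)) ∧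
      Stored x y m l s' ((c, A) :: P) ∧ Live x y m l ((c, A) :: P) ∧
      s'.reg .len = P.length + 1 ∧ (∀ c, s'.arr .mark c = 0) ∧
      s'.time + 1900 * (MCS.pref x m (word P) + MCS.pref y l (word P)) ≤ s.time +
        1900 * (MCS.pref x m (word P ++ [c]) + MCS.pref y l (word P ++ [c]))) s := by
  have h1 := sz.small
  have h2 := sz.sigma
  have h3 := hLive.length_le
  have h4 : altLen P + l < M := by
    have h5 := hLive.altLen_le
    have h6 := Nat.mul_le_mul_right l h3
    have h7 := sz.addr (a := m) (b := l) (c := l) (by omega) (by omega) (by omega)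
    omega
  have hload : ∀ {s' : State Reg Arr} {k : Cmd Reg Arr}, Frame k s s' →
      (∀ a ∈ [Arr.Z, .prefI, .prefJ, .safeI, .safeJ, .altEnd], k.modArr a = false) →
      (∀ a < altLen P, s'.arr .alt a = s.arr .alt a) → Stored x y m l s' P :=
    fun hF h halt => hSt.congr (fun a ha k _ => congrFun (hF.arr a (h a ha)) k) halt
  rw [wp_seq]
  refine wp_then (wp_loadCell hlen (by omega)) ?_
  rintro s₁ F₁ ⟨pI₁, pJ₁, sI₁, sJ₁, time₁⟩
  have hSt₁ := hload F₁ (by decide) fun a _ => congrFun (F₁.arr .alt rfl) a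
  have len₁ := (F₁.reg .len rfl).trans hlen
  obtain ⟨hab, e1, e2⟩ : MCS.IsSafe x y m l (word P) (s₁.arr .safeI P.length)
      (s₁.arr .safeJ P.length) ∧ s₁.arr .prefI P.length = MCS.pref x m (word P) ∧
      s₁.arr .prefJ P.length = MCS.pref y l (word P) := by
    obtain _ | ⟨⟨c, A⟩, P⟩ := P
    · exact absurd rfl hP
    · rw [word_cons, List.length_cons]
      exact ⟨hSt₁.2.safe, hSt₁.2.prefI, hSt₁.2.prefJ⟩
  rw [e1] at pI₁
  rw [e2] at pJ₁
  have T₁ := T.frame F₁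
  rw [wp_seq]
  refine wp_then (wp_queryExt sz T₁ hyσ (by omega) (by rw [len₁]; exact hSt₁.altEnd_eq) pI₁ pJ₁
    sI₁ sJ₁ hpm hql (fun c => by rw [F₁.arr .mark rfl, hmark]) h4) ?_
  rintro s₂ F₂ ⟨F, L, hF, hL, hnd, hLF, hLl, seg₂, top₂, alt₂, mark₂, time₂⟩
  simp only [← MCS.exists_maximal_iff_wit hab rfl rfl] at hL
  have hSt₂ : Stored x y m l s₂ P := hSt₁.congr
    (fun a ha k _ => congrFun (F₂.arr a (by revert a; decide)) k) alt₂
  have hLne : L ≠ [] := by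
    rintro rfl
    obtain ⟨d, hd⟩ := hext
    simpa using (hL d).2 hd
  refine wp_then (wp_advance sz (T₁.frame F₂) hxσ hyσ hP hSt₂ hLive
    ((F₂.reg .len rfl).trans len₁) ?_ ?_ ?_ ?_ hLne top₂ seg₂ hLl hnd fun d hd => (hL d).1 hd) ?_
  · rw [F₂.reg .pI rfl, F₂.arr .prefI rfl, pI₁, e1]
  · rw [F₂.reg .pJ rfl, F₂.arr .prefJ rfl, pJ₁, e2]
  · rw [F₂.reg .sI rfl, F₂.arr .safeI rfl, sI₁]
  · rw [F₂.reg .sJ rfl, F₂.arr .safeJ rfl, sJ₁]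
  rintro s₃ F₃ ⟨c, A, hperm, hSt₃, hLive₃, len₃, time₃⟩
  refine ⟨c, A, fun d => by rw [← hperm.mem_iff, hL], hSt₃, hLive₃, len₃,
    fun c => by rw [F₃.arr .mark rfl, mark₂], ?_⟩
  have hle := hLive₃.pref_le
  rw [word_cons, MCS.pref_concat, MCS.pref_concat] at hle
  rw [MCS.pref_concat, MCS.pref_concat] at time₃ ⊢
  have hcard := MCS.card_wit_le (min_le_right _ _) rfl rfl hle.1 hle.2 hF
  have hlt := MCS.lt_nextPos x m c (MCS.pref x m (word P))
  have hlt' := MCS.lt_nextPos y l c (MCS.pref y l (word P))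
  omega

/-- The step to the next alternative at the last position of the path. -/
theorem wp_turn {s : State Reg Arr} (sz : Sizes M W m l σ)
    (T : Tables x y m l σ s) (hxσ : ∀ k, 1 ≤ k → k ≤ m → 1 ≤ x k ∧ x k ≤ σ)
    (hyσ : ∀ k, 1 ≤ k → k ≤ l → 1 ≤ y k ∧ y k ≤ σ) (hP : P ≠ []) (hA : A ≠ [])
    (hSt : Stored x y m l s ((c, A) :: P)) (hLive : Live x y m l ((c, A) :: P))
    (hlen : s.reg .len = P.length + 1) :
    wp M W (.assign .top (.get .altEnd (v .len)) ;; .assign .len (v .len - 1) ;; load ;;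
      selectLeast ;; appendChar) (fun s' => ∃ c' A', A.Perm (c' :: A') ∧
      Stored x y m l s' ((c', A') :: P) ∧ Live x y m l ((c', A') :: P) ∧
      s'.reg .len = P.length + 1 ∧ s'.time ≤ s.time + 400 * (m + l + 1)) s := by
  have h1 := sz.small
  have h2 := sz.sigma
  have h3 := hLive.length_le
  rw [List.length_cons] at h3
  rw [wp_seq]
  refine wp_assign_of (x := altLen P + A.length) (by simp [v, hlen]; omega)
    (by simp [v, hlen, hSt.2.altEnd]) fun s₁ F₁ top₁ time₁ => ?_
  rw [wp_seq]
  refine wp_assign_of (x := P.length) (by simp [v]; omega)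
    (by simp [v, F₁.reg .len rfl, hlen]) fun s₂ F₂ len₂ time₂ => ?_
  rw [wp_seq]
  refine wp_then (wp_loadCell len₂ (by omega)) ?_
  rintro s₃ F₃ ⟨pI₃, pJ₃, sI₃, sJ₃, time₃⟩
  have arr₃ : s₃.arr = s.arr := by
    funext a
    rw [F₃.arr a rfl, F₂.arr a rfl, F₁.arr a rfl]
  simp [v] at time₁ time₂
  have hSt₃ : Stored x y m l s₃ P :=
    hSt.1.congr (fun a _ k _ => by rw [arr₃]) fun a _ => by rw [arr₃]
  refine wp_then (wp_advance sz (((T.frame F₁).frame F₂).frame F₃) hxσ hyσ hP hSt₃ hLive.1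
    ((F₃.reg .len rfl).trans len₂) pI₃ pJ₃ sI₃ sJ₃ hA
    ((F₃.reg .top rfl).trans ((F₂.reg .top rfl).trans top₁)) (by rw [arr₃]; exact hSt.2.seg)
    hLive.2.2.1 (List.nodup_cons.1 hLive.2.1).2
    fun d hd => hLive.2.2.2 d (List.mem_cons_of_mem _ hd)) ?_
  rintro s₄ F₄ ⟨c', A', hperm, hSt₄, hLive₄, len₄, time₄⟩
  refine ⟨c', A', hperm, hSt₄, hLive₄, len₄, ?_⟩
  have hle := hLive₄.pref_le
  have hAl := hLive.2.2.1
  rw [word_cons] at hle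
  omega

end Enum221

namespace Enum221

variable {M W m l σ : ℕ} {x y : ℕ → ℕ} {X Y : List ℕ}

/-! ### Enumeration: the walk through the trie -/

/-- The sequences `x 1, …, x m` and `y 1, …, y l` are the normal forms of `X` and `Y`, over the
characters `1, …, σ`. -/
structure Normal (X Y : List ℕ) (x y : ℕ → ℕ) (m l σ : ℕ) : Prop where
  endsX : MCS.Ends x m σ
  endsY : MCS.Ends y l σ
  charX : ∀ k, 1 ≤ k → k ≤ m → 1 ≤ x k ∧ x k ≤ σ
  charY : ∀ k, 1 ≤ k → k ≤ l → 1 ≤ y k ∧ y k ≤ σ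
  m_eq : m = X.length + 2
  l_eq : l = Y.length + 2
  maximal_iff : ∀ Z, MCS.Maximal x y m l Z ↔ ∃ Z₀, IsMCS X Y Z₀ ∧ Z = MCS.wrap X Y Z₀

theorem normal_normalForm (X Y : List ℕ) :
    Normal X Y (MCS.chars (normalForm X Y X)) (MCS.chars (normalForm X Y Y)) (X.length + 2)
      (Y.length + 2) (X.length + Y.length + 2) := by
  have hX : X ⊆ X ++ Y := by simp
  have hY : Y ⊆ X ++ Y := by simp
  have hx := MCS.ends_normalForm hX
  have hy := MCS.ends_normalForm hY
  have hm := fun Z => MCS.isMCS_iff (S := normalForm X Y X) (T := normalForm X Y Y) (Z := Z)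
  rw [MCS.normalForm_length] at hx hy
  simp only [MCS.normalForm_length] at hm
  exact ⟨hx, hy, chars_normalForm_bounds hX, chars_normalForm_bounds hY, rfl, rfl,
    fun Z => (hm Z).symm.trans MCS.isMCS_normalForm_iff⟩

theorem wrap_injective {Z Z' : List ℕ} (hZ : Z ⊆ X ++ Y) (hZ' : Z' ⊆ X ++ Y)
    (h : MCS.wrap X Y Z = MCS.wrap X Y Z') : Z = Z' := by
  simp only [MCS.wrap, List.cons.injEq, true_and, List.append_cancel_right_eq] at h
  rw [← MCS.map_decode_map_encode hZ, h, MCS.map_decode_map_encode hZ']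

/-- At the root, `1` is the only character. -/
theorem Live.root {c : ℕ} {A : List ℕ} (hn : Normal X Y x y m l σ) (h : Live x y m l [(c, A)]) :
    A = [] := by
  obtain ⟨-, hnd, -, hmax⟩ := h
  have h1 : ∀ d ∈ c :: A, d = 1 := by
    intro d hd
    obtain ⟨V, hV⟩ := hmax d hd
    obtain ⟨V', hV'⟩ := hV.exists_cons hn.endsX hn.endsY
    simpa using (List.cons.inj hV').1
  rcases A with _ | ⟨d, A⟩
  · rfl
  · rw [List.nodup_cons] at hnd
    have := h1 c (by simp)
    have := h1 d (by simp)
    exact absurd (by simp; omega) hnd.1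

/-- `Z` extends the current prefix or an alternative that is still to be tried. -/
def Remaining (P : List (ℕ × List ℕ)) (Z : List ℕ) : Prop :=
  (P ≠ [] ∧ word P <+: Z) ∨ Pending Z P

/-- Backtracking to the longest prefix with a character still to be tried. -/
def backtrack : Cmd Reg Arr :=
  .while (.and (.ne (v .len) 0)
      (.eq (.get .altEnd (v .len)) (.get .altEnd (v .len - 1))))
    (.assign .len (v .len - 1)) ;;
  .ite (.ne (v .len) 0)
    (.assign .top (.get .altEnd (v .len)) ;;
     .assign .len (v .len - 1) ;;
     load ;; selectLeast ;; appendChar)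
    .skip

theorem wp_backtrack {P : List (ℕ × List ℕ)} {s : State Reg Arr} (sz : Sizes M W m l σ)
    (T : Tables x y m l σ s) (hn : Normal X Y x y m l σ) (hSt : Stored x y m l s P)
    (hLive : Live x y m l P) (hlen : s.reg .len = P.length) :
    wp M W backtrack (fun s' => ∃ Q, Stored x y m l s' Q ∧ Live x y m l Q ∧
      s'.reg .len = Q.length ∧ (∀ Z, Remaining Q Z ↔ Pending Z P) ∧
      s'.time ≤ s.time + 500 * (m + l + 1)) s := by
  have h1 := sz.small
  have h2 := sz.sigma
  have h3 := hLive.length_le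
  rw [backtrack, wp_seq]
  refine wp_then (Q := fun s' => ∃ Q, Stored x y m l s' Q ∧ Live x y m l Q ∧
    s'.reg .len = Q.length ∧ (∀ Z, Pending Z Q ↔ Pending Z P) ∧
    s'.time ≤ s.time + 20 * m + 20 ∧ ∀ c A Q', Q = (c, A) :: Q' → A ≠ []) ?_ ?_
  · refine wp_while (fun s' => ∃ Q, Stored x y m l s' Q ∧ Live x y m l Q ∧
      s'.reg .len = Q.length ∧ (∀ Z, Pending Z Q ↔ Pending Z P) ∧ Q.length ≤ P.length ∧
      s'.time ≤ s.time + 20 * (P.length - Q.length)) (fun s' => s'.reg .len)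
      ⟨P, hSt, hLive, hlen, fun _ => Iff.rfl, le_rfl, by simp⟩ ?_
    rintro s' hF ⟨Q, hStQ, hLiveQ, hlenQ, hQ, hQP, ht⟩
    have hS : ∀ t, Stored x y m l (s'.tick t) Q := fun t =>
      hStQ.congr (fun _ _ _ _ => rfl) fun _ _ => rfl
    rcases Q with _ | ⟨⟨c, A⟩, Q⟩
    · simp [v, hlenQ] at ht ⊢
      exact ⟨by omega, [], hS 13, trivial, rfl, hQ, by omega, by simp⟩
    · rw [List.length_cons] at hlenQ hQP ht
      have e1 := hStQ.2.altEnd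
      have e2 := hStQ.1.altEnd_eq
      simp only [v, wp_assign, safe_and, safe_ne, safe_eq, safe_reg, safe_ofNat, safe_get, safe_sub,
        val_reg, val_sub, val_ofNat, hlenQ, holds_and, holds_ne, holds_eq, val_get,
        Nat.add_sub_cancel, e1, e2, tick_reg, setReg_reg, tick_time, setReg_time, if_true,
        cost_and, cost_ne, cost_eq, cost_reg, cost_get, cost_sub, cost_ofNat, true_and]
      refine ⟨by omega, fun hb => ⟨by omega, ⟨Q, hStQ.1.congr (fun _ _ _ _ => rfl) fun _ _ => rfl,
        hLiveQ.1, rfl, fun Z => ?_, by omega, by omega⟩, by omega⟩, fun hb => ⟨(c, A) :: Q, hS _,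
        hLiveQ, rfl, hQ, by omega, ?_⟩⟩
      · obtain rfl : A = [] := List.length_eq_zero_iff.1 (by omega)
        rw [← hQ Z]
        simp [Pending]
      · rintro c' A' Q' h rfl
        simp only [List.cons.injEq, Prod.mk.injEq] at h
        obtain ⟨⟨-, rfl⟩, -⟩ := h
        simp at hb
  · rintro s₁ F₁ ⟨Q, hStQ, hLiveQ, hlenQ, hQ, ht, hA⟩
    have T₁ := T.frame F₁
    rw [wp_ite]
    refine ⟨⟨trivial, by change 0 ≤ W; omega⟩, fun hb => ?_, fun hb => ?_⟩
    · rcases Q with _ | ⟨⟨c, A⟩, Q⟩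
      · simp [v, hlenQ] at hb
      have hAne := hA c A Q rfl
      have hQne : Q ≠ [] := by
        rintro rfl
        exact hAne (hLiveQ.root hn)
      have hl := hLiveQ.length_le
      refine wp_then (wp_turn sz (T₁.congr (fun _ _ => rfl) fun _ _ => rfl) hn.charX hn.charY hQne
        hAne (hStQ.congr (fun _ _ _ _ => rfl) fun _ _ => rfl) hLiveQ hlenQ) ?_
      rintro s₂ F₂ ⟨c', A', hperm, hSt₂, hLive₂, len₂, time₂⟩
      refine ⟨(c', A') :: Q, hSt₂, hLive₂, len₂, fun Z => ?_, ?_⟩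
      · rw [← hQ Z]
        simp only [Remaining, Pending, word_cons, hperm.mem_iff, List.mem_cons,
          exists_eq_or_imp, ne_eq, reduceCtorEq, not_false_eq_true, true_and, or_assoc]
      · simp [v] at time₂
        linarith
    · rcases Q with _ | ⟨a, Q⟩
      · refine ⟨[], hStQ.congr (fun _ _ _ _ => rfl) fun _ _ => rfl, trivial, hlenQ, fun Z => ?_, ?_⟩
        · rw [← hQ Z]
          simp [Remaining, Pending]
        · simp [v]; omega
      · simp [v, hlenQ] at hb

/-- The invariant of the walk: the strings that have been output are those that do not remain. -/
structure Walk (X Y : List ℕ) (x y : ℕ → ℕ) (m l : ℕ) (s : State Reg Arr)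
    (P : List (ℕ × List ℕ)) : Prop where
  stored : Stored x y m l s P
  live : Live x y m l P
  len : s.reg .len = P.length
  mark : ∀ c, s.arr .mark c = 0
  buf : s.buf = []
  nodup : (s.out.map Prod.fst).Nodup
  mem_iff : ∀ Z, Z ∈ s.out.map Prod.fst ↔ IsMCS X Y Z ∧ ¬ Remaining P (MCS.wrap X Y Z)

/-- The delays, counted from the time `t₀`, are at most `D`, up to the last output at time `t`. -/
def Timely (t₀ D t : ℕ) (s : State Reg Arr) : Prop :=
  ∀ t' ≤ t + D, List.IsChain (fun a b => b ≤ a + D) (t₀ :: (s.out.map Prod.snd ++ [t']))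

theorem Timely.output {t₀ D t t' : ℕ} {s s' : State Reg Arr} {Z : List ℕ} (h : Timely t₀ D t s)
    (ho : s'.out = s.out ++ [(Z, t')]) (ht : t' ≤ t + D) : Timely t₀ D t' s' := by
  intro t'' ht''
  have h1 := h t' ht
  rw [← List.cons_append] at h1
  have h2 := h1.append (l₂ := [t'']) (List.isChain_singleton _) (by
    rw [List.getLast?_concat]; simpa using ht'')
  simpa [ho] using h2

theorem Walk.length_le {P : List (ℕ × List ℕ)} {s : State Reg Arr} (h : Walk X Y x y m l s P) :
    s.out.length ≤ X.sublists.length := by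
  rw [← List.length_map (f := Prod.fst)]
  exact (List.subperm_of_subset h.nodup fun Z hZ =>
    List.mem_sublists.2 ((h.mem_iff Z).1 hZ).1.1.1).length_le

/-- The strings output so far, once `Z₀` has been added to them. -/
theorem Walk.mem_output {P : List (ℕ × List ℕ)} {s : State Reg Arr} {Z₀ Z : List ℕ}
    (h : Walk X Y x y m l s P) (hn : Normal X Y x y m l σ) (hZ₀ : IsMCS X Y Z₀)
    (hw : word P = MCS.wrap X Y Z₀) :
    (Z ∈ s.out.map Prod.fst ∨ Z = Z₀) ↔ IsMCS X Y Z ∧ ¬ Pending (MCS.wrap X Y Z) P := by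
  have hsub : ∀ {Z}, IsMCS X Y Z → Z ⊆ X ++ Y := fun hZ c hc =>
    List.mem_append_left _ (hZ.1.1.subset hc)
  rw [h.mem_iff, Remaining]
  constructor
  · rintro (⟨h1, h2⟩ | rfl)
    · exact ⟨h1, fun h3 => h2 (Or.inr h3)⟩
    · exact ⟨hZ₀, h.live.not_pending (hw ▸ List.prefix_rfl)⟩
  · rintro ⟨h1, h2⟩
    by_cases h3 : word P <+: MCS.wrap X Y Z
    · right
      obtain ⟨V, hV⟩ := h3
      have hmax := (hn.maximal_iff _).2 ⟨Z, h1, rfl⟩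
      obtain ⟨U, hU⟩ := ((hn.maximal_iff _).2 ⟨Z₀, hZ₀, hw⟩).exists_concat hn.endsX hn.endsY
      rw [← hV, hU] at hmax
      rw [hmax.eq_nil_of_last hn.endsX, List.append_nil, hw] at hV
      exact (wrap_injective (hsub hZ₀) (hsub h1) hV).symm
    · exact Or.inl ⟨h1, by tauto⟩

theorem Normal.remaining_cons {P : List (ℕ × List ℕ)} {c : ℕ} {A : List ℕ}
    (hn : Normal X Y x y m l σ) (hP : P ≠ []) (hmax : ¬ MCS.Maximal x y m l (word P))
    (hA : ∀ d, d ∈ c :: A ↔ ∃ V, MCS.Maximal x y m l (word P ++ d :: V)) (Z : List ℕ)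
    (hZ : IsMCS X Y Z) :
    Remaining P (MCS.wrap X Y Z) ↔ Remaining ((c, A) :: P) (MCS.wrap X Y Z) := by
  have h1 : word P <+: MCS.wrap X Y Z ↔ ∃ d ∈ c :: A, word P ++ [d] <+: MCS.wrap X Y Z := by
    constructor
    · rintro ⟨_ | ⟨d, V⟩, hV⟩
      · rw [List.append_nil] at hV
        exact absurd ((hn.maximal_iff _).2 ⟨Z, hZ, hV⟩) hmax
      · exact ⟨d, (hA d).2 ⟨V, (hn.maximal_iff _).2 ⟨Z, hZ, hV⟩⟩, V, by simpa using hV⟩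
    · rintro ⟨d, -, hd⟩
      exact (List.prefix_append _ _).trans hd
  simp [Remaining, Pending, hP, h1, or_assoc]

/-- The loop body of the walk. -/
def walkStep : Cmd Reg Arr :=
  .ite (.ne (.get .Z (v .len)) (v .σ))
    (load ;; queryExt ;; selectLeast ;; appendChar)
    (outputZ ;; backtrack)

theorem wp_walkStep {P : List (ℕ × List ℕ)} {s : State Reg Arr} {t₀ t : ℕ} (sz : Sizes M W m l σ)
    (T : Tables x y m l σ s) (hI : Input X Y s) (hn : Normal X Y x y m l σ)
    (h : Walk X Y x y m l s P) (hP : P ≠ []) (ht : Timely t₀ (4000 * (m + l + 1)) t s)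
    (htime : s.time ≤ t + 1000 * (m + l + 1) +
      2000 * (MCS.pref x m (word P) + MCS.pref y l (word P))) :
    wp M W walkStep (fun s' => ∃ Q t', Walk X Y x y m l s' Q ∧
      Timely t₀ (4000 * (m + l + 1)) t' s' ∧
      s'.time + 50 ≤ t' + 1000 * (m + l + 1) +
        2000 * (MCS.pref x m (word Q) + MCS.pref y l (word Q)) ∧
      (s'.out.length = s.out.length ∧ Q.length = P.length + 1 ∨
        s'.out.length = s.out.length + 1)) s := by
  have h1 := sz.small
  have h2 := sz.sigma
  have h3 := h.live.length_le
  have h4 := h.live.pref_le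
  obtain ⟨⟨c, A⟩, P', rfl⟩ := List.exists_cons_of_ne_nil hP
  obtain ⟨V, hV⟩ := h.live.2.2.2 c (by simp)
  have hZ : s.arr .Z (s.reg .len) = c := by rw [h.len]; exact h.stored.2.char
  have hword : word ((c, A) :: P') = word P' ++ [c] := word_cons
  rw [walkStep, wp_ite]
  refine ⟨?_, fun hb => ?_, fun hb => ?_⟩
  · simp [v, h.len] at h3 ⊢; omega
  · -- the prefix does not end with `σ`
    have hc : c ≠ σ := by simpa [v, hZ, T.lens.reg_σ] using hb
    have hnot : ¬ MCS.Maximal x y m l (word ((c, A) :: P')) := by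
      intro hmax
      obtain ⟨U, hU⟩ := hmax.exists_concat hn.endsX hn.endsY
      rw [hword] at hU
      simpa [hc] using (List.append_inj' hU rfl).2
    have hpm : MCS.pref x m (word ((c, A) :: P')) ≠ m := by
      intro he
      rw [hword, MCS.pref_concat] at he
      have := (MCS.nextPos_mem x m c (MCS.pref x m (word P'))).2 (by omega)
      rw [he, (hn.endsX.last m (by have := hn.endsX.two_le; omega) le_rfl).2 rfl] at this
      exact hc this.symm
    have hql : MCS.pref y l (word ((c, A) :: P')) ≠ l := by
      intro he
      rw [hword, MCS.pref_concat] at he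
      have := (MCS.nextPos_mem y l c (MCS.pref y l (word P'))).2 (by omega)
      rw [he, (hn.endsY.last l (by have := hn.endsY.two_le; omega) le_rfl).2 rfl] at this
      exact hc this.symm
    have hext : ∃ d V, MCS.Maximal x y m l (word ((c, A) :: P') ++ d :: V) := by
      rw [List.append_cons, ← hword] at hV
      rcases V with _ | ⟨d, V⟩
      · rw [List.append_nil] at hV
        exact absurd hV hnot
      · exact ⟨d, V, hV⟩
    refine wp_then (wp_descend sz (T.congr (fun _ _ => rfl) fun _ _ => rfl) hn.charX hn.charY hP
      (h.stored.congr (fun _ _ _ _ => rfl) fun _ _ => rfl) h.live h.len h.mark (by omega) (by omega)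
      hext) ?_
    rintro s' F ⟨d, B, hB, hSt, hLive, hlen, hmark, htime'⟩
    obtain ⟨hout, hbuf⟩ := F.out rfl
    rw [tick_out] at hout
    rw [tick_buf] at hbuf
    refine ⟨(d, B) :: (c, A) :: P', t, ⟨hSt, hLive, hlen, hmark, hbuf.trans h.buf, ?_, fun Z => ?_⟩,
      fun t' ht' => ?_, ?_, Or.inl ⟨by rw [hout], rfl⟩⟩
    · rw [hout]; exact h.nodup
    · rw [hout, h.mem_iff]
      exact and_congr_right fun hZ => not_congr (hn.remaining_cons hP hnot hB Z hZ)
    · rw [hout]; exact ht t' ht'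
    · have hlt := MCS.lt_nextPos x m d (MCS.pref x m (word ((c, A) :: P')))
      have hlt' := MCS.lt_nextPos y l d (MCS.pref y l (word ((c, A) :: P')))
      rw [← MCS.pref_concat] at hlt hlt'
      rw [word_cons (P := (c, A) :: P')]
      simp [v] at htime'
      simp at hlt hlt' htime ⊢
      omega
  · -- the prefix is a maximal common subsequence
    have hc : c = σ := by simpa [v, hZ, T.lens.reg_σ] using hb
    subst hc
    have hmax : MCS.Maximal x y m l (word ((c, A) :: P')) := by
      rw [List.append_cons] at hV
      rw [hword]
      have := hV.eq_nil_of_last hn.endsX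
      rwa [this, List.append_nil] at hV
    obtain ⟨Z₀, hZ₀, hw⟩ := (hn.maximal_iff _).1 hmax
    have hlenZ : Z₀.length + 2 = ((c, A) :: P').length := by
      rw [← length_word, hw]; simp [MCS.wrap]
    have hmX := hn.m_eq
    have hlY := hn.l_eq
    have hget : ∀ i (hi : i < Z₀.length), s.arr .Z (i + 2) = encode X Y Z₀[i] := by
      intro i hi
      rw [h.stored.word_get (i + 1) (by rw [length_word]; omega)]
      simp [hw, MCS.wrap, hi]
    rw [wp_seq]
    refine wp_then (wp_outputZ (X := X) (Y := Y) (Z := Z₀) (hI.mono rfl rfl rfl rfl) h.len hlenZ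
      (by omega) h1.2 (by omega) hget (fun a ha => List.mem_append_left _ (hZ₀.1.1.subset ha))
      h.buf) ?_
    rintro s₁ F₁ ⟨buf₁, out₁, time₁⟩
    have arr₁ : s₁.arr = s.arr := funext fun a => F₁.arr a rfl
    refine wp_then (wp_backtrack sz (T.frame (c := outputZ) ⟨F₁.reg, F₁.arr, F₁.out⟩) hn
      (h.stored.congr (fun a _ k _ => by rw [arr₁]) fun a _ => by rw [arr₁]) h.live
      ((F₁.reg .len rfl).trans h.len)) ?_
    rintro s₂ F₂ ⟨Q, hSt, hLive, hlen, hQ, time₂⟩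
    obtain ⟨hout, hbuf⟩ := F₂.out rfl
    rw [out₁] at hout
    have hmem := fun Z => h.mem_output hn (Z := Z) hZ₀ hw
    have hout' : s₂.out.map Prod.fst = s.out.map Prod.fst ++ [Z₀] := by rw [hout]; simp
    have hdelay : s₁.time ≤ t + 4000 * (m + l + 1) := by
      simp [v] at time₁
      simp at h3
      omega
    refine ⟨Q, s₁.time, ⟨hSt, hLive, hlen, fun c => ?_, hbuf.trans buf₁, ?_, fun Z => ?_⟩,
      ht.output hout hdelay, by omega, Or.inr (by simp [hout])⟩
    · rw [F₂.arr .mark rfl, arr₁, h.mark]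
    · rw [hout', List.nodup_append]
      refine ⟨h.nodup, List.nodup_singleton _, fun Z hZ Z' hZ' hne => ?_⟩
      rw [List.mem_singleton.1 hZ'] at hne
      subst hne
      refine ((h.mem_iff _).1 hZ).2 (Or.inl ⟨hP, ?_⟩)
      rw [hw]
    · rw [hout', List.mem_append, List.mem_singleton, hmem, hQ]

/-- The start of the walk at the prefix `1`. -/
def startWalk : Cmd Reg Arr :=
  .assign .len 1 ;;
  .store .Z 1 1 ;;
  .store .prefI 1 1 ;;
  .store .prefJ 1 1 ;;
  .store .safeI 1 (v .m + 1) ;;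
  .store .safeJ 1 (v .l + 1) ;;
  .store .altEnd 0 0 ;;
  .store .altEnd 1 0

theorem wp_startWalk {s : State Reg Arr} (sz : Sizes M W m l σ) (hL : Lens m l σ s)
    (hn : Normal X Y x y m l σ) (hmark : ∀ c, s.arr .mark c = 0) (hbuf : s.buf = [])
    (hout : s.out = []) :
    wp M W startWalk (fun s' => Walk X Y x y m l s' [(1, [])] ∧ s'.time ≤ s.time + 50) s := by
  have h1 := sz.small
  have h2 := sz.sigma
  have hmax := MCS.exists_maximal hn.endsX hn.endsY
  refine wp_then (Q := fun s' => s'.reg .len = 1 ∧ s'.arr .Z 1 = 1 ∧ s'.arr .prefI 1 = 1 ∧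
    s'.arr .prefJ 1 = 1 ∧ s'.arr .safeI 1 = m + 1 ∧ s'.arr .safeJ 1 = l + 1 ∧
    s'.arr .altEnd 0 = 0 ∧ s'.arr .altEnd 1 = 0 ∧ s'.time ≤ s.time + 50) ?_ ?_
  · simp [startWalk, v, hL.reg_m, hL.reg_l]
    omega
  · rintro s' F ⟨e1, e2, e3, e4, e5, e6, e7, e8, ht⟩
    obtain ⟨hout', hbuf'⟩ := F.out rfl
    rw [hout] at hout'
    refine ⟨⟨⟨e7, e2, ?_, ?_, ?_, by simp [e5], by simp [e5], by simp [e6],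
      by simp [e6], e8, fun k hk => by simp at hk⟩,
      ⟨trivial, by simp, by simp, ?_⟩, e1, fun c => by rw [F.arr .mark rfl, hmark],
      hbuf'.trans hbuf, by simp [hout'], fun Z => ?_⟩, ht⟩
    · exact e3.trans (MCS.pref_one hn.endsX).symm
    · exact e4.trans (MCS.pref_one hn.endsY).symm
    · simp only [List.length_nil, Nat.zero_add, e5, e6]
      exact MCS.isSafe_one hn.endsX
    · simpa using hmax
    · simp [hout', Remaining, MCS.wrap]

theorem wp_enumeration {s : State Reg Arr} (sz : Sizes M W m l σ) (T : Tables x y m l σ s)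
    (hI : Input X Y s) (hn : Normal X Y x y m l σ) (hmark : ∀ c, s.arr .mark c = 0)
    (hbuf : s.buf = []) (hout : s.out = []) :
    wp M W enumeration (fun s' => s'.buf = [] ∧ (s'.out.map Prod.fst).Nodup ∧
      (∀ Z, Z ∈ s'.out.map Prod.fst ↔ IsMCS X Y Z) ∧
      List.IsChain (fun a b => b ≤ a + 4000 * (m + l + 1))
        (s.time :: (s'.out.map Prod.snd ++ [s'.time]))) s := by
  have h1 := sz.small
  have h2 := sz.sigma
  change wp M W startWalk (wp M W (.while (.ne (v .len) 0) walkStep) _) s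
  refine wp_then (wp_startWalk sz T.lens hn hmark hbuf hout) ?_
  rintro s₁ F₁ ⟨W₁, time₁⟩
  have T₁ := T.frame F₁
  have hI₁ := hI.frame F₁
  have out₁ : s₁.out = [] := (F₁.out rfl).1.trans hout
  -- every output is new, and the prefixes between two outputs become longer
  refine wp_while (fun s' => ∃ P t, Walk X Y x y m l s' P ∧
      Timely s.time (4000 * (m + l + 1)) t s' ∧
      s'.time + 10 ≤ t + 1000 * (m + l + 1) +
        2000 * (MCS.pref x m (word P) + MCS.pref y l (word P)))
    (fun s' => (X.sublists.length - s'.out.length) * (m + 2) + (m + 1 - s'.reg .len))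
    ⟨_, s.time, W₁, fun t' ht' => ?_, by omega⟩ ?_
  · simpa [out₁] using ht'
  rintro s' F ⟨P, t, hW, ht, htime⟩
  have hcost : (Cond.ne (v .len) (0 : Expr Reg Arr)).cost + 1 = 4 := rfl
  rw [hcost]
  refine ⟨⟨trivial, by change 0 ≤ W; omega⟩, fun hb => ?_, fun hb => ?_⟩
  · have hP : P ≠ [] := by
      rintro rfl
      simp [v, hW.len] at hb
    refine wp_then (wp_walkStep sz ((T₁.frame F).congr (fun _ _ => rfl) fun _ _ => rfl)
      ((hI₁.frame F).mono rfl rfl rfl rfl) hn (t := t) (t₀ := s.time) (P := P)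
      ⟨hW.stored.congr (fun _ _ _ _ => rfl) fun _ _ => rfl, hW.live, hW.len, hW.mark, hW.buf,
        hW.nodup, hW.mem_iff⟩ hP ht (by simp only [tick_time]; omega)) ?_
    rintro s'' - ⟨Q, t', hW', ht', htime', hdec⟩
    refine ⟨⟨Q, t', hW', ht', by omega⟩, ?_⟩
    have h3 := hW'.length_le
    have h4 := hW'.live.length_le
    rw [tick_out] at hdec
    rw [hW.len, hW'.len]
    rcases hdec with ⟨h5, h6⟩ | h5
    · rw [h5]
      omega
    · obtain ⟨k, hk⟩ : ∃ k, X.sublists.length - s'.out.length = k + 1 :=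
        ⟨X.sublists.length - s''.out.length, by omega⟩
      have hk' : X.sublists.length - s''.out.length = k := by omega
      rw [hk, hk', Nat.add_one_mul]
      omega
  · obtain rfl : P = [] := by
      rw [← List.length_eq_zero_iff, ← hW.len]
      simpa [v] using hb
    refine ⟨hW.buf, hW.nodup, fun Z => ?_, ?_⟩
    · simpa [Remaining, Pending] using hW.mem_iff Z
    · refine ht _ ?_
      simp at htime ⊢
      omega

end Enum221

namespace Enum221

variable {M W : ℕ} {X Y : List ℕ}

/-! ### Resource bounds -/

theorem exec_preprocessing {N : ℕ}
    (sz : Sizes M W (X.length + 2) (Y.length + 2) (X.length + Y.length + 2))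
    (hW : ∀ c ∈ X ++ Y, c ≤ W) (hN : X.length + Y.length + 4 ≤ N) :
    ∃ s : State Reg Arr, Exec M W preprocessing (_root_.Enum221.init X Y) s ∧ s.Bdd W ∧
      Tables (MCS.chars (normalForm X Y X)) (MCS.chars (normalForm X Y Y)) (X.length + 2)
        (Y.length + 2) (X.length + Y.length + 2) s ∧ Input X Y s ∧
      (∀ c, s.arr .mark c = 0) ∧ s.buf = [] ∧ s.out = [] ∧ s.time ≤ 2000 * N ^ 2 := by
  have h1 := sz.small
  have hget : ∀ S : List ℕ, S ⊆ X ++ Y → ∀ k, S.getD k 0 ≤ W := by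
    intro S hS k
    rw [List.getD_eq_getElem?_getD]
    by_cases hk : k < S.length
    · rw [List.getElem?_eq_getElem hk]
      exact hW _ (hS (List.getElem_mem hk))
    · rw [List.getElem?_eq_none (by omega)]
      exact Nat.zero_le _
  have hI : Input X Y (_root_.Enum221.init X Y) := by
    constructor <;> simp [EnumAlgorithm.init, _root_.Enum221]
  have hB : (_root_.Enum221.init X Y).Bdd W := by
    constructor
    · intro r
      simp only [EnumAlgorithm.init, _root_.Enum221, Function.update_apply]
      split_ifs <;> omega
    · intro a k
      simp only [EnumAlgorithm.init, _root_.Enum221, Function.update_apply]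
      split_ifs
      · exact hget Y (by simp) k
      · exact hget X (by simp) k
      · exact Nat.zero_le _
  have hz : ∀ a, a ≠ .inX → a ≠ .inY → ∀ k, (_root_.Enum221.init X Y).arr a k = 0 := by
    intro a ha ha' k
    simp [EnumAlgorithm.init, _root_.Enum221, ha, ha']
  obtain ⟨s, hE, hBs, hF, hT, ht⟩ := wp_sound _ _ _ hB (wp_then (wp_preprocessing sz hI
    (hz .stack (by decide) (by decide))) fun s' hF h => (⟨hF, h⟩ : Frame _ _ s' ∧ _))
  refine ⟨s, hE, hBs, hT, hI.frame hF, fun c => ?_, (hF.out rfl).2, (hF.out rfl).1, ht.trans ?_⟩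
  · rw [hF.arr .mark rfl, hz .mark (by decide) (by decide)]
  · have := Nat.pow_le_pow_left hN 2
    change 0 + _ ≤ _
    omega

theorem hasD221 {s : State Reg Arr}
    (sz : Sizes M W (X.length + 2) (Y.length + 2) (X.length + Y.length + 2)) (hB : s.Bdd W)
    (T : Tables (MCS.chars (normalForm X Y X)) (MCS.chars (normalForm X Y Y)) (X.length + 2)
      (Y.length + 2) (X.length + Y.length + 2) s) :
    HasD221 M W 300 (normalForm X Y X) (normalForm X Y Y) s := by
  have h1 := sz.small
  intro i hi him
  have hsf := MCS.isSuff_sf (normalForm X Y X) (normalForm X Y Y) i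
  simp only [MCS.normalForm_length] at him hsf ⊢
  refine ⟨fun j hj1 hj2 => ?_, fun a c ha hac hcl => ?_⟩
  · rw [T.suff i j hi him hj1 hj2]
    exact hsf j
  · have hB' : (((s.setReg .qi i).setReg .ql a).setReg .qr c).Bdd W := by
      refine ⟨fun r => ?_, hB.arr⟩
      have := hB.reg r
      simp only [setReg_reg]
      split_ifs <;> omega
    obtain ⟨s', hE, -, hF, hmin, ht⟩ := wp_sound _ _ _ hB' (wp_then (wp_rmq (i := i) (a := a)
      (c := c) sz (T.congr (by simp [tableRegs]) fun _ _ => rfl) (by simp) hi him (by simp)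
      (by simp) ha hac hcl) fun s' hF h => (⟨hF, h⟩ : Frame _ _ s' ∧ _))
    refine ⟨s', hE, ht, funext fun b => hF.arr b rfl, (LeftMin.congr hmin fun j h2 h3 => ?_).isRMQ⟩
    exact T.suff i j hi him (by omega) (by omega)

/-- The strings in normal form fit into the machine. -/
theorem sizes_of_le {a n C : ℕ} (hn : 0 < n) (hX : X.length ≤ a * n) (hY : Y.length ≤ a * n)
    (hC : 16 * (2 * a + 5) ^ 2 ≤ C) (hW : C * n ^ 2 ≤ W) :
    Sizes (C * n ^ 2) W (X.length + 2) (Y.length + 2) (X.length + Y.length + 2) ∧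
      X.length + Y.length + 5 ≤ (2 * a + 5) * n := by
  have h1 : X.length + Y.length + 5 ≤ (2 * a + 5) * n := by
    have : (2 * a + 5) * n = a * n + a * n + 5 * n := by ring
    omega
  refine ⟨⟨by omega, by omega, by omega, ?_, hW⟩, h1⟩
  calc 16 * (X.length + 2 + (Y.length + 2) + 1) ^ 2
      = 16 * (X.length + Y.length + 5) ^ 2 := by ring
    _ ≤ 16 * ((2 * a + 5) * n) ^ 2 := Nat.mul_le_mul_left _ (Nat.pow_le_pow_left h1 2)
    _ = 16 * (2 * a + 5) ^ 2 * n ^ 2 := by ring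
    _ ≤ C * n ^ 2 := Nat.mul_le_mul_right _ hC

end Enum221

theorem theorem3 :
    Enum221.SolvesMCSEnumeration (fun n => n ^ 2) (fun n => n ^ 2) (fun n => n) ∧
    (∀ a : ℕ, ∃ C : ℕ, ∀ n : ℕ, 0 < n → ∀ X Y : List ℕ, X.length ≤ a * n → Y.length ≤ a * n →
      ∀ W : ℕ, C * n ^ 2 ≤ W → (∀ c ∈ X ++ Y, c ≤ W) →
      ∃ s : RAM.State Enum221.Reg Enum221.Arr,
        RAM.Exec (C * n ^ 2) W Enum221.preprocessing (Enum221.init X Y) s ∧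
        s.time ≤ C * n ^ 2 ∧
        HasD221 (C * n ^ 2) W C (normalForm X Y X) (normalForm X Y Y) s) := by
  have hsq : ∀ a : ℕ, 2 * a + 5 ≤ (2 * a + 5) ^ 2 ∧ 25 ≤ (2 * a + 5) ^ 2 := fun a =>
    ⟨Nat.le_self_pow two_ne_zero _, Nat.pow_le_pow_left (by omega : 5 ≤ 2 * a + 5) 2⟩
  have hpre : ∀ a n : ℕ, 2000 * ((2 * a + 5) * n) ^ 2 ≤ 4000 * (2 * a + 5) ^ 2 * n ^ 2 :=
    fun a n => by rw [mul_pow, ← mul_assoc]; gcongr; norm_num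
  constructor
  · intro a
    refine ⟨4000 * (2 * a + 5) ^ 2, fun n hn X Y hX hY W hW hc => ?_⟩
    obtain ⟨sz, hN⟩ := Enum221.sizes_of_le hn hX hY (by omega) hW
    obtain ⟨s₁, hE₁, hB, T, hI, hmark, hbuf, hout, htime⟩ :=
      Enum221.exec_preprocessing sz hc ((by omega : _ ≤ X.length + Y.length + 5).trans hN)
    obtain ⟨s₂, hE₂, -, hbuf₂, hnd, hmem, hchain⟩ := RAM.wp_sound _ _ _ hB
      (Enum221.wp_enumeration sz T hI (Enum221.normal_normalForm X Y) hmark hbuf hout)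
    refine ⟨s₁, s₂, hE₁, htime.trans (hpre a n), hbuf, hout, hE₂, hbuf₂, hnd, hmem,
      hchain.imp fun t t' h => h.trans (Nat.add_le_add_left ?_ t)⟩
    calc 4000 * (X.length + 2 + (Y.length + 2) + 1)
        = 4000 * (X.length + Y.length + 5) := by ring
      _ ≤ 4000 * ((2 * a + 5) ^ 2 * n) :=
        Nat.mul_le_mul_left _ (hN.trans (Nat.mul_le_mul_right _ (hsq a).1))
      _ = 4000 * (2 * a + 5) ^ 2 * n := by ring
  · intro a
    refine ⟨4000 * (2 * a + 5) ^ 2, fun n hn X Y hX hY W hW hc => ?_⟩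
    obtain ⟨sz, hN⟩ := Enum221.sizes_of_le hn hX hY (by omega) hW
    obtain ⟨s₁, hE₁, hB, T, -, -, -, -, htime⟩ :=
      Enum221.exec_preprocessing sz hc ((by omega : _ ≤ X.length + Y.length + 5).trans hN)
    refine ⟨s₁, hE₁, htime.trans (hpre a n), fun i hi him => ?_⟩
    obtain ⟨h1, h2⟩ := Enum221.hasD221 sz hB T i hi him
    refine ⟨h1, fun k' k'' h3 h4 h5 => ?_⟩
    obtain ⟨s', h6, h7, h8⟩ := h2 k' k'' h3 h4 h5
    have := (hsq a).2
    exact ⟨s', h6, h7.trans (by omega), h8⟩
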